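/- **Model.** A sensor sends samples to a receiver over a forward channel that loses each packet independently with probability $\alpha\in[0,1)$; every transmission is answered by an error-free ACK/NACK over a backward channel. Sample $(k,1)$ is the $k$-th successfully delivered one ($k\ge 1$; the sample taken at time $0$ is sample $(1,1)$), and epoch $k$ lasts from its sampling time $S_k$ to $S_{k+1}$, with $S_1=0$. In epoch $k$ the samples $(k,2),\dots,(k,M_k)$ are lost and the next one is delivered, so $M_k$ is geometric, $\Pr(M_k=n)=\alpha^{n-1}(1-\alpha)$, $n\ge1$. Sample $(k,j)$ has forward delay $D^F_{k,j}$ and feedback delay $D^B_{k,j}$. All $D^F_{k,j}$, $D^B_{k,j}$, $M_k$ are mutually independent, $D^F_{k,j}\sim\mathbb P_{FD}$, $D^B_{k,j}\sim\mathbb P_{BD}$, where both laws are absolutely continuous, supported on $[\epsilon,\infty)$ for some $\epsilon>0$, and have fourth moment at most $B<\infty$. After the feedback of sample $(k,j)$ the sensor waits $W_{k,j}\ge0$ and then takes the next sample; hence $S_{k+1}=S_k+\sum_{j=1}^{M_k}(D^F_{k,j}+D^B_{k,j}+W_{k,j})$. The age of information is $A(t)=t-\max\{S_k: S_k+D^F_{k,1}\le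 t\}$, with $A(t)=t$ before the first reception. Write $D^{\rm a}_k=D^F_{k,1}+D^B_{k,1}$ and $D^{\rm v}_k=\sum_{j=2}^{M_k}(D^F_{k,j}+D^B_{k,j})$, and write $D^F,D^B,D^{\rm v}$ for generic copies. **Optimum.** $\mathrm{AoI}_{\rm opt}=\inf_\pi\limsup_{T\to\infty}\frac1T\mathbb E\int_0^TA(t)\,dt$, the infimum being over all causal policies, i.e. those whose waiting times $W_{k,j}$ are bounded nonnegative measurable functions of the delays and transmission outcomes observed up to the feedback of sample $(k,j)$; there is no constraint on the sampling frequency. Put $\gamma^\star=\mathrm{AoI}_{\rm opt}-\mathbb E[D^F]-\mathbb E[D^{\rm v}]$. **Algorithm.** Known are constants $f\le\mathbb E[D^F]$, $h\le\mathbb E[D^B]$, $v\le\mathbb E[D^{\rm v}]\le v'$ and $H\ge\mathbb E[(D^F+D^B+D^{\rm v})^2]$ with $\overline D:=f+h+v>0$. Put $\gamma_{\rm lb}=\max\{\frac12(f+h-v'),0\}$ and $\gamma_{\rm ub}=\frac{H}{2\overline D}-v$, and $\eta_1=\frac1{2\overline D}$, $\eta_k=\frac1{(k+2)\overline D}$ for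 $k\ge2$. Let $\gamma_0$ be any real random variable independent of the channel, $\mu_0=m_0=0$, and for $k\ge1$ $$\mu_k=\mu_{k-1}+\tfrac1k(V_k-\mu_{k-1}),\qquad m_k=m_{k-1}+\tfrac1k(V_k^2-m_{k-1}),$$ $$\gamma_k=\min\Big\{\gamma_{\rm ub},\max\Big\{\gamma_{\rm lb},\ \gamma_{k-1}+\eta_k\Big(\tfrac12\max\{D^{\rm a}_k,\gamma_{k-1}\}^2-\gamma_{k-1}\big(\max\{D^{\rm a}_k,\gamma_{k-1}\}+V_k\big)+\tfrac12m_k-\mu_k^2\Big)\Big\}\Big\}.$$ Here either $V_k=D^{\rm v}_k$ for all $k$, or $V_k=D^{\rm v}_{k-1}$ for all $k$ with $D^{\rm v}_0:=0$ (the virtual delay of the last completed epoch). The waiting times are $W_{k,1}=\max\{\gamma_k-D^{\rm a}_k,0\}$ and $W_{k,j}=0$ for $j\ge2$. **Theorem.** For either choice of $V_k$, $\mathrm{AoI}_{\rm opt}<\infty$ and, under the algorithm, $$\lim_{k\to\infty}\gamma_k=\gamma^\star\quad\text{almost surely,}\qquad \lim_{k\to\infty}\frac{1}{S_{k+1}}\int_0^{S_{k+1}}A(t)\,dt=\mathrm{AoI}_{\rm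 opt}\quad\text{almost surely.}$$ -/

import Mathlib

open MeasureTheory ProbabilityTheory Filter Topology
open scoped ENNReal

noncomputable section

namespace AoI

/-! ### Realizations of the two-way channel

Epochs and samples are numbered from 1: sample `(k, 1)` is the `k`-th successfully transmitted
sample, samples `(k, 2), …, (k, M k)` are the lost ones between it and the next successful one.
Entries with an index 0 are never used. -/

/-- A realization of the channel: the forward and backward delays of all samples `(k, j)`, and
the numbers `M k` of attempts in the epochs. -/
abbrev Path : Type := (ℕ → ℕ → ℝ × ℝ) × (ℕ → ℕ)

/-- Forward delay of sample `(k, j)`. -/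
def forward (p : Path) (k j : ℕ) : ℝ := (p.1 k j).1

/-- Backward delay of (the feedback of) sample `(k, j)`. -/
def backward (p : Path) (k j : ℕ) : ℝ := (p.1 k j).2

/-- Number of attempts in epoch `k`. -/
def attempts (p : Path) (k : ℕ) : ℕ := p.2 k

/-- The actual delay `Dᵃ_k` of epoch `k`. -/
def actualDelay (p : Path) (k : ℕ) : ℝ := forward p k 1 + backward p k 1

/-- The virtual delay `Dᵛ_k` of epoch `k`. -/
def virtualDelay (p : Path) (k : ℕ) : ℝ :=
  ∑ j ∈ Finset.Icc 2 (attempts p k), (forward p k j + backward p k j)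

/-! ### Age of information under given waiting times `W k j` -/

/-- Length of epoch `k`. -/
def epochLength (p : Path) (W : ℕ → ℕ → ℝ) (k : ℕ) : ℝ :=
  ∑ j ∈ Finset.Icc 1 (attempts p k), (forward p k j + backward p k j + W k j)

/-- Sampling time `S_k` of the `k`-th successful sample; the first one is taken at time 0. -/
def sampleTime (p : Path) (W : ℕ → ℕ → ℝ) (k : ℕ) : ℝ :=
  ∑ i ∈ Finset.Ico 1 k, epochLength p W i

/-- Reception time `R_k` of the `k`-th successful sample. -/
def receptionTime (p : Path) (W : ℕ → ℕ → ℝ) (k : ℕ) : ℝ :=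
  sampleTime p W k + forward p k 1

/-- The age `A(t) = t - max {S_k : R_k ≤ t}`. Before the first reception the age is `t`,
which is what the element 0 in the set is for. -/
def age (p : Path) (W : ℕ → ℕ → ℝ) (t : ℝ) : ℝ :=
  t - sSup (insert 0 {s | ∃ k, 1 ≤ k ∧ receptionTime p W k ≤ t ∧ s = sampleTime p W k})

/-! ### The stochastic model -/

/-- A delay distribution: an absolutely continuous probability measure on `[ε, ∞)` whose
fourth moment is at most `B`. -/
structure IsDelayLaw (ε B : ℝ) (P : Measure ℝ) : Prop where
  prob : IsProbabilityMeasure P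
  absCont : P ≪ volume
  support : P (Set.Iio ε) = 0
  fourthMoment : ∫⁻ x, ENNReal.ofReal (x ^ 4) ∂P ≤ ENNReal.ofReal B

/-- All basic random variables of the channel, as one family of real random variables. -/
def primitives {Ω : Type*} (X : Ω → Path) : (ℕ × ℕ) ⊕ ((ℕ × ℕ) ⊕ ℕ) → Ω → ℝ
  | .inl i => fun ω => forward (X ω) i.1 i.2
  | .inr (.inl i) => fun ω => backward (X ω) i.1 i.2
  | .inr (.inr k) => fun ω => (attempts (X ω) k : ℝ)

/-- `X` is a random channel with packet-loss probability `α`, forward delay law `PF` and backward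
delay law `PB`: forward delays, backward delays and numbers of attempts are mutually independent,
and the number of attempts in an epoch is geometric on `{1, 2, …}` with parameter `1 - α`. -/
structure IsChannel {Ω : Type*} [MeasurableSpace Ω] (μ : Measure Ω) (α : ℝ) (PF PB : Measure ℝ)
    (X : Ω → Path) : Prop where
  measurable : Measurable X
  indep : iIndepFun (primitives X) μ
  forward_law : ∀ k j, 1 ≤ k → 1 ≤ j → μ.map (fun ω => forward (X ω) k j) = PF
  backward_law : ∀ k j, 1 ≤ k → 1 ≤ j → μ.map (fun ω => backward (X ω) k j) = PB
  attempts_law : ∀ k n, 1 ≤ k → 1 ≤ n →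
    μ {ω | attempts (X ω) k = n} = ENNReal.ofReal (α ^ (n - 1) * (1 - α))

/-! ### Causal policies and the optimal age -/

/-- A causal sampling policy. The waiting time `wait k j` after the feedback of sample `(k, j)`
is a bounded nonnegative measurable function of what has been observed by then: the numbers of
attempts and the delays of all samples of the earlier epochs, and the delays of the
samples `(k, 1), …, (k, j)`. (It is used only if `j ≤ M k`, so it knows that much about `M k`.) -/
structure Policy where
  wait : ℕ → ℕ → Path → ℝ
  measurable : ∀ k j, Measurable (wait k j)
  nonneg : ∀ k j p, 0 ≤ wait k j p
  bounded : ∃ C, ∀ k j p, wait k j p ≤ C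
  causal : ∀ k j, 1 ≤ k → 1 ≤ j → ∀ p q : Path,
    (∀ i, 1 ≤ i → i < k → p.2 i = q.2 i ∧ ∀ l, 1 ≤ l → l ≤ p.2 i → p.1 i l = q.1 i l) →
    (∀ l, 1 ≤ l → l ≤ j → p.1 k l = q.1 k l) →
    wait k j p = wait k j q

/-- Long-run expected time-average age `limsup_{T → ∞} (1/T) E ∫₀ᵀ A(t) dt` of a policy. -/
def Policy.averageAge {Ω : Type*} [MeasurableSpace Ω] (π : Policy) (μ : Measure Ω)
    (X : Ω → Path) : ℝ≥0∞ :=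
  limsup (fun T : ℝ =>
    (∫⁻ ω, ∫⁻ t in Set.Icc 0 T,
        ENNReal.ofReal (age (X ω) (fun k j => π.wait k j (X ω)) t) ∂volume ∂μ)
      / ENNReal.ofReal T) atTop

/-- The optimal age without sampling-frequency constraint. -/
def optimalAge {Ω : Type*} [MeasurableSpace Ω] (μ : Measure Ω) (X : Ω → Path) : ℝ≥0∞ :=
  ⨅ π : Policy, π.averageAge μ X

/-- The optimal threshold `γ⋆ = AoI_opt - E[D^F] - E[Dᵛ]`. -/
def optimalThreshold {Ω : Type*} [MeasurableSpace Ω] (μ : Measure Ω) (X : Ω → Path) : ℝ :=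
  (optimalAge μ X).toReal - (∫ ω, forward (X ω) 1 1 ∂μ) - ∫ ω, virtualDelay (X ω) 1 ∂μ

/-! ### The online algorithm (no frequency constraint, so the dual variable vanishes) -/

/-- The constants known to the algorithm. -/
structure Bounds where
  /-- lower bound of the mean forward delay -/
  forwardLb : ℝ
  /-- lower bound of the mean backward delay -/
  backwardLb : ℝ
  /-- lower bound of the mean virtual delay -/
  virtualLb : ℝ
  /-- upper bound of the mean virtual delay -/
  virtualUb : ℝ
  /-- upper bound of the second moment of the total delay of an epoch -/
  secondUb : ℝ

/-- Lower bound of the mean total delay of an epoch. -/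
def Bounds.delayLb (b : Bounds) : ℝ := b.forwardLb + b.backwardLb + b.virtualLb

/-- Left end of the projection interval. -/
def Bounds.gammaLb (b : Bounds) : ℝ :=
  max ((1 / 2) * (b.forwardLb + b.backwardLb - b.virtualUb)) 0

/-- Right end of the projection interval (the case `1 / f_max = 0`). -/
def Bounds.gammaUb (b : Bounds) : ℝ := ((1 / 2) * b.secondUb) / b.delayLb - b.virtualLb

/-- The constants are correct bounds for the given channel. -/
structure Bounds.Valid {Ω : Type*} [MeasurableSpace Ω] (b : Bounds) (μ : Measure Ω)
    (X : Ω → Path) : Prop where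
  forward_le : b.forwardLb ≤ ∫ ω, forward (X ω) 1 1 ∂μ
  backward_le : b.backwardLb ≤ ∫ ω, backward (X ω) 1 1 ∂μ
  virtual_le : b.virtualLb ≤ ∫ ω, virtualDelay (X ω) 1 ∂μ
  le_virtual : ∫ ω, virtualDelay (X ω) 1 ∂μ ≤ b.virtualUb
  le_second : ∫ ω, (actualDelay (X ω) 1 + virtualDelay (X ω) 1) ^ 2 ∂μ ≤ b.secondUb
  delayLb_pos : 0 < b.delayLb

/-- The running estimate `x_0 = 0`, `x_k = x_{k-1} + (1/k) (V_k - x_{k-1})`. -/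
def runningMean (V : ℕ → ℝ) : ℕ → ℝ
  | 0 => 0
  | k + 1 => runningMean V k + (1 / ((k + 1 : ℕ) : ℝ)) * (V (k + 1) - runningMean V k)

/-- The step size `η_k`, `k ≥ 1`. -/
def Bounds.stepSize (b : Bounds) (k : ℕ) : ℝ :=
  if k = 1 then 1 / (2 * b.delayLb) else 1 / (((k : ℝ) + 2) * b.delayLb)

/-- The function `g_0(γ; Dᵃ, Dᵛ)`. -/
def drift (γ da dv : ℝ) : ℝ := (1 / 2) * (max da γ) ^ 2 - γ * (max da γ + dv)

/-- The virtual delay that enters the `k`-th update: `Dᵛ_k` for `lag = 0`, and for `lag = 1`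
the virtual delay `Dᵛ_{k-1}` of the last completed epoch, with `Dᵛ_0 = 0`. -/
def usedVirtualDelay (lag : ℕ) (p : Path) (k : ℕ) : ℝ :=
  if k ≤ lag then 0 else virtualDelay p (k - lag)

/-- The threshold iterates `γ_k` of the projected Robbins–Monro algorithm. -/
def threshold (b : Bounds) (lag : ℕ) (γ₀ : ℝ) (p : Path) : ℕ → ℝ
  | 0 => γ₀
  | k + 1 =>
    min b.gammaUb (max b.gammaLb
      (threshold b lag γ₀ p k + b.stepSize (k + 1) *
        (drift (threshold b lag γ₀ p k) (actualDelay p (k + 1)) (usedVirtualDelay lag p (k + 1))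
          + ((1 / 2) * runningMean (fun i => usedVirtualDelay lag p i ^ 2) (k + 1)
            - runningMean (usedVirtualDelay lag p) (k + 1) ^ 2))))

/-- The waiting times of the algorithm: `(γ_k - Dᵃ_k)⁺` after an ACK, none after a NACK. -/
def algorithmWait (b : Bounds) (lag : ℕ) (γ₀ : ℝ) (p : Path) (k j : ℕ) : ℝ :=
  if j = 1 then max (threshold b lag γ₀ p k - actualDelay p k) 0 else 0

end AoI

end

/-! Write L_k for the length of epoch k, F_k for the forward delay of its first sample, v = E[Dᵛ], θ
= γ + v and L^γ = max(Dᵃ, γ) + Dᵛ. The area under the age curve during epoch k is L_k²/2 + F_k (S_k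
- S_{k-1}) (`IsRegular.age_cycle`), and F_k is independent of the earlier epochs, hence of S_k -
S_{k-1}.

Because Dᵃ and Dᵛ are independent, `driftMean` at γ equals E[(L^γ)²/2 - θ L^γ]
(`Model.integral_thresholdEpoch`). It decreases with slope at most -E[Dᵃ + Dᵛ], and it is
nonnegative at 0 because E[(Dᵛ)²] ≥ 2v² (`Model.two_mul_sq_le_integral_virtualDelay_sq`). So it has
a root γ ≥ 0, which turns out to be the optimal threshold.

Optimality is a Lagrangian argument for the ratio of area to time. At the root, the threshold rule
makes the expected cost L²/2 - θL of an epoch zero whatever the past, and no causal policy makes it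
negative (`Model.integral_past_mul_epochLength_nonneg`). To see this, bound the parabola below by
its tangent at L^γ. The first-order term pairs each waiting time with a deviation of Dᵛ from v;
since the number of attempts is memoryless, the virtual delay still to come after any feedback of
the running epoch has mean v again, so waiting after a NACK gains nothing. Summed over the epochs
begun by time T, the lengths and the differences S_k - S_{k-1} both give T up to an overshoot, which
is O(√T) in mean by the fourth moments (`Model.expected_age_bounds`, `Model.exists_overshoot_le`).
Hence AoI_opt = γ + v + E[D^F] (`Model.optimalAge_eq`).

The algorithm is a projected Robbins–Monro scheme with mean field `driftMean`. The weighted noise is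
an L²-bounded martingale because the squared steps are summable (`Model.ae_cauchySeq_noise`), the
bias of the running estimates vanishes by the strong law, and the root lies in the projection
interval; the rest is a deterministic argument (`tendsto_of_projected_recursion`). The lag is
harmless: Dᵃ_k together with Dᵛ_{k-1} has the same joint law as (Dᵃ, Dᵛ) and is independent of the
data used before. A random starting point is handled by Fubini.

Finally, the true epoch lengths differ from those of the limiting threshold by at most |γ_k - γ|,
which tends to 0, so strong laws for L, L² and F_{k+1} L_k give the time average. It equals AoI_opt
because E[(L^γ)²]/2 = θ E[L^γ] at the root. -/

noncomputable section

namespace AoI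

set_option linter.unusedSectionVars false

/-! ### Pathwise analysis of the age -/

/-- A path on which every epoch has at least one attempt and all delays are at least `ε`. -/
structure IsRegular (ε : ℝ) (p : Path) : Prop where
  attempts_pos : ∀ k, 1 ≤ k → 1 ≤ attempts p k
  forward_ge : ∀ k j, 1 ≤ k → 1 ≤ j → ε ≤ forward p k j
  backward_ge : ∀ k j, 1 ≤ k → 1 ≤ j → ε ≤ backward p k j

/-- Area under the age curve between the sampling times `S_k` and `S_{k+1}`. -/
def cycleArea (p : Path) (W : ℕ → ℕ → ℝ) (k : ℕ) : ℝ :=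
  epochLength p W k ^ 2 / 2 + forward p k 1 * (sampleTime p W k - sampleTime p W (k - 1))

section Pathwise

variable {ε : ℝ} {p : Path} {W : ℕ → ℕ → ℝ}

lemma IsRegular.actualDelay_ge (hp : IsRegular ε p) {k : ℕ} (hk : 1 ≤ k) :
    2 * ε ≤ actualDelay p k := by
  have h1 := hp.forward_ge k 1 hk le_rfl
  have h2 := hp.backward_ge k 1 hk le_rfl
  unfold actualDelay; linarith

lemma IsRegular.actualDelay_le_epochLength (hp : IsRegular ε p) (hε : 0 < ε)
    (hW : ∀ k j, 0 ≤ W k j) {k : ℕ} (hk : 1 ≤ k) : actualDelay p k ≤ epochLength p W k := by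
  have h1 : 1 ∈ Finset.Icc 1 (attempts p k) := by simp [hp.attempts_pos k hk]
  have h := Finset.single_le_sum (f := fun j => forward p k j + backward p k j + W k j)
    (fun j hj => by
      have hj' : 1 ≤ j := (Finset.mem_Icc.1 hj).1
      have h1 := hp.forward_ge k j hk hj'
      have h2 := hp.backward_ge k j hk hj'
      have h3 := hW k j
      linarith) h1
  have := hW k 1
  unfold actualDelay epochLength
  linarith

lemma IsRegular.epochLength_ge (hp : IsRegular ε p) (hε : 0 < ε)
    (hW : ∀ k j, 0 ≤ W k j) {k : ℕ} (hk : 1 ≤ k) : 2 * ε ≤ epochLength p W k :=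
  (hp.actualDelay_ge hk).trans (hp.actualDelay_le_epochLength hε hW hk)

@[simp] lemma sampleTime_zero : sampleTime p W 0 = 0 := by simp [sampleTime]

@[simp] lemma sampleTime_one : sampleTime p W 1 = 0 := by simp [sampleTime]

lemma sampleTime_succ {k : ℕ} (hk : 1 ≤ k) :
    sampleTime p W (k + 1) = sampleTime p W k + epochLength p W k := by
  simp [sampleTime, Finset.sum_Ico_succ_top hk]

lemma sampleTime_succ_eq_sum_range (n : ℕ) :
    sampleTime p W (n + 1) = ∑ k ∈ Finset.range n, epochLength p W (k + 1) := by
  induction n with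
  | zero => simp
  | succ n ih => rw [sampleTime_succ (by omega), ih, Finset.sum_range_succ]

lemma IsRegular.sampleTime_mono (hp : IsRegular ε p) (hε : 0 < ε) (hW : ∀ k j, 0 ≤ W k j) :
    Monotone (sampleTime p W) := by
  refine monotone_nat_of_le_succ fun k => ?_
  rcases Nat.eq_zero_or_pos k with rfl | hk
  · simp
  · rw [sampleTime_succ hk]
    have := hp.epochLength_ge hε hW hk
    linarith

lemma IsRegular.sampleTime_ge (hp : IsRegular ε p) (hε : 0 < ε) (hW : ∀ k j, 0 ≤ W k j) (n : ℕ) :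
    2 * ε * n ≤ sampleTime p W (n + 1) := by
  rw [sampleTime_succ_eq_sum_range]
  have := Finset.card_nsmul_le_sum (Finset.range n) (fun k => epochLength p W (k + 1)) (2 * ε)
    (fun k _ => hp.epochLength_ge hε hW (by omega))
  simpa [mul_comm] using this

lemma IsRegular.sampleTime_nonneg (hp : IsRegular ε p) (hε : 0 < ε) (hW : ∀ k j, 0 ≤ W k j)
    (n : ℕ) : 0 ≤ sampleTime p W n := by
  simpa using hp.sampleTime_mono hε hW (Nat.zero_le n)

lemma IsRegular.sampleTime_le_receptionTime (hp : IsRegular ε p) (hε : 0 < ε) {k : ℕ}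
    (hk : 1 ≤ k) : sampleTime p W k ≤ receptionTime p W k := by
  have := hp.forward_ge k 1 hk le_rfl
  unfold receptionTime; linarith

lemma IsRegular.receptionTime_le_sampleTime_succ (hp : IsRegular ε p) (hε : 0 < ε)
    (hW : ∀ k j, 0 ≤ W k j) {k : ℕ} (hk : 1 ≤ k) :
    receptionTime p W k ≤ sampleTime p W (k + 1) := by
  have h1 := hp.backward_ge k 1 hk le_rfl
  have h2 := hp.actualDelay_le_epochLength hε hW hk
  rw [sampleTime_succ hk]
  unfold receptionTime
  unfold actualDelay at h2
  linarith

/-- Reception times increase, since R_k ≤ S_{k+1} ≤ R_{k+1}, so the freshest received sample is the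
last one received. The case `k = 0` covers the time before the first reception: `sampleTime p W 0 =
0` is the extra element of the set. -/
lemma IsRegular.age_eq (hp : IsRegular ε p) (hε : 0 < ε) (hW : ∀ k j, 0 ≤ W k j) {k : ℕ} {t : ℝ}
    (hk : k = 0 ∨ receptionTime p W k ≤ t) (ht : t < receptionTime p W (k + 1)) :
    age p W t = t - sampleTime p W k := by
  unfold age
  congr 1
  refine IsGreatest.csSup_eq ⟨?_, ?_⟩
  · rcases Nat.eq_zero_or_pos k with rfl | h
    · simp
    · exact Or.inr ⟨k, h, hk.resolve_left (by omega), rfl⟩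
  · rintro s (rfl | ⟨l, hl, hlt, rfl⟩)
    · exact hp.sampleTime_nonneg hε hW k
    · refine hp.sampleTime_mono hε hW ?_
      by_contra! hkl
      have h1 : receptionTime p W (k + 1) ≤ receptionTime p W l := by
        rcases Nat.eq_or_lt_of_le (Nat.succ_le_of_lt hkl) with h | h
        · rw [← h]
        · exact (hp.receptionTime_le_sampleTime_succ hε hW (by omega)).trans
            ((hp.sampleTime_mono hε hW h).trans (hp.sampleTime_le_receptionTime hε hl))
      linarith

lemma age_nonneg {t : ℝ} (hp : IsRegular ε p) (hε : 0 < ε) (ht : 0 ≤ t) : 0 ≤ age p W t := by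
  unfold age
  rw [sub_nonneg]
  refine csSup_le ⟨0, by simp⟩ ?_
  rintro s (rfl | ⟨l, hl, hlt, rfl⟩)
  · exact ht
  · exact (hp.sampleTime_le_receptionTime hε hl).trans hlt

/-- Until the reception the age is still counted from the previous sampling time, afterwards from
the current one. For the first epoch the "previous" time is `sampleTime p W 0 = 0`, so no separate
case arises. -/
lemma IsRegular.age_cycle (hp : IsRegular ε p) (hε : 0 < ε) (hW : ∀ k j, 0 ≤ W k j) (k : ℕ) :
    IntervalIntegrable (age p W) volume (sampleTime p W (k + 1)) (sampleTime p W (k + 2)) ∧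
    ∫ t in sampleTime p W (k + 1)..sampleTime p W (k + 2), age p W t
      = cycleArea p W (k + 1) := by
  set S := sampleTime p W (k + 1) with hS
  set R := receptionTime p W (k + 1) with hR
  set S' := sampleTime p W (k + 2) with hS'
  have hSR : S ≤ R := hp.sampleTime_le_receptionTime hε (by omega)
  have hRS' : R ≤ S' := hp.receptionTime_le_sampleTime_succ hε hW (by omega)
  have hlin : ∀ a b c : ℝ, IntervalIntegrable (fun t : ℝ => t - c) volume a b := fun a b c =>
    (continuous_id.sub continuous_const).intervalIntegrable _ _
  -- The right endpoints, where the age formula changes, are null and can be discarded.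
  have hne : ∀ c : ℝ, ∀ᵐ t : ℝ, t ≠ c := fun c => by
    simp [ae_iff]
  have e1 : ∀ᵐ t : ℝ, t ∈ Set.uIoc S R → age p W t = t - sampleTime p W k := by
    filter_upwards [hne R] with t htR ht
    rw [Set.uIoc_of_le hSR] at ht
    refine hp.age_eq hε hW ?_ (lt_of_le_of_ne ht.2 htR)
    rcases Nat.eq_zero_or_pos k with h | h
    · exact Or.inl h
    · exact Or.inr ((hp.receptionTime_le_sampleTime_succ hε hW h).trans ht.1.le)
  have e2 : ∀ᵐ t : ℝ, t ∈ Set.uIoc R S' → age p W t = t - S := by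
    filter_upwards [hne S'] with t htS ht
    rw [Set.uIoc_of_le hRS'] at ht
    refine hp.age_eq hε hW (Or.inr ht.1.le) ?_
    exact (lt_of_le_of_ne ht.2 htS).trans_le (hp.sampleTime_le_receptionTime hε (by omega))
  have i1 : IntervalIntegrable (age p W) volume S R :=
    (hlin S R (sampleTime p W k)).congr_ae <| by
      rw [EventuallyEq, ae_restrict_iff' measurableSet_uIoc]
      filter_upwards [e1] with t h ht using (h ht).symm
  have i2 : IntervalIntegrable (age p W) volume R S' :=
    (hlin R S' S).congr_ae <| by
      rw [EventuallyEq, ae_restrict_iff' measurableSet_uIoc]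
      filter_upwards [e2] with t h ht using (h ht).symm
  refine ⟨i1.trans i2, ?_⟩
  rw [← intervalIntegral.integral_add_adjacent_intervals i1 i2,
    intervalIntegral.integral_congr_ae e1, intervalIntegral.integral_congr_ae e2]
  have hR' : R = S + forward p (k + 1) 1 := rfl
  have hS'' : S' = S + epochLength p W (k + 1) := sampleTime_succ (by omega)
  have hint : ∀ a b c : ℝ, ∫ t in a..b, (t - c) = (b ^ 2 - a ^ 2) / 2 - (b - a) * c := by
    intro a b c
    rw [intervalIntegral.integral_sub (by simp) (by simp)]
    simp [integral_id]
  rw [hint, hint, cycleArea, hS'', hR', Nat.add_sub_cancel, ← hS]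
  ring

lemma IsRegular.integral_age (hp : IsRegular ε p) (hε : 0 < ε) (hW : ∀ k j, 0 ≤ W k j) (n : ℕ) :
    IntervalIntegrable (age p W) volume 0 (sampleTime p W (n + 1)) ∧
    ∫ t in (0 : ℝ)..sampleTime p W (n + 1), age p W t
      = ∑ k ∈ Finset.range n, cycleArea p W (k + 1) := by
  have h := fun k => hp.age_cycle hε hW k
  have h1 := IntervalIntegrable.trans_iterate (f := age p W) (μ := volume)
    (a := fun k => sampleTime p W (k + 1)) (n := n) (fun k _ => (h k).1)
  have h2 := intervalIntegral.sum_integral_adjacent_intervals (f := age p W) (μ := volume)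
    (a := fun k => sampleTime p W (k + 1)) (n := n) (fun k _ => (h k).1)
  simp only [zero_add, sampleTime_one] at h1 h2
  exact ⟨h1, h2.symm.trans (Finset.sum_congr rfl fun k _ => (h k).2)⟩

lemma IsRegular.lintegral_age (hp : IsRegular ε p) (hε : 0 < ε) (hW : ∀ k j, 0 ≤ W k j) (n : ℕ) :
    ∫⁻ t in Set.Icc 0 (sampleTime p W (n + 1)), ENNReal.ofReal (age p W t)
      = ENNReal.ofReal (∑ k ∈ Finset.range n, cycleArea p W (k + 1)) := by
  have h0 := hp.sampleTime_nonneg hε hW (n + 1)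
  obtain ⟨h1, h2⟩ := hp.integral_age hε hW n
  rw [← h2, intervalIntegral.integral_of_le h0, ← integral_Icc_eq_integral_Ioc,
    ofReal_integral_eq_lintegral_ofReal]
  · exact (intervalIntegrable_iff_integrableOn_Icc_of_le h0).1 h1
  · exact (ae_restrict_iff' measurableSet_Icc).2
      (Eventually.of_forall fun t ht => age_nonneg hp hε ht.1)

/-- The epoch that covers the time `T`. -/
lemma IsRegular.exists_epoch (hp : IsRegular ε p) (hε : 0 < ε) (hW : ∀ k j, 0 ≤ W k j)
    {T : ℝ} (hT : 0 ≤ T) {n : ℕ} (hn : T < 2 * ε * n) :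
    ∃ N < n, sampleTime p W (N + 1) ≤ T ∧ T < sampleTime p W (N + 2) ∧
      ∀ a : ℕ → ℝ, ∑ k ∈ Finset.range n, (if sampleTime p W (k + 1) ≤ T then a k else 0)
        = ∑ k ∈ Finset.range (N + 1), a k := by
  classical
  have hmono := hp.sampleTime_mono hε hW
  have hex : ∃ m, T < sampleTime p W (m + 1) := ⟨n, hn.trans_le (hp.sampleTime_ge hε hW n)⟩
  set m := Nat.find hex with hm
  have hm1 : T < sampleTime p W (m + 1) := Nat.find_spec hex
  have hm0 : m ≠ 0 := by
    intro h
    rw [h] at hm1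
    simp at hm1; linarith
  obtain ⟨N, hN⟩ := Nat.exists_eq_succ_of_ne_zero hm0
  have hle : m ≤ n := Nat.find_min' hex (hn.trans_le (hp.sampleTime_ge hε hW n))
  have hN1 : sampleTime p W (N + 1) ≤ T := by
    have := Nat.find_min hex (m := N) (by omega)
    exact not_lt.1 this
  rw [hN] at hm1
  refine ⟨N, by omega, hN1, hm1, fun a => ?_⟩
  -- Sampling times are monotone, so the indicator selects an initial segment of the epochs.
  rw [← Finset.sum_filter]
  congr 1
  ext k
  simp only [Finset.mem_filter, Finset.mem_range]
  constructor
  · rintro ⟨_, h⟩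
    by_contra! hk
    have := hmono (show N + 2 ≤ k + 1 by omega)
    have h3 : T < sampleTime p W (N + 2) := hm1
    linarith
  · intro h
    exact ⟨by omega, (hmono (show k + 1 ≤ N + 1 by omega)).trans hN1⟩

end Pathwise

/-! ### Averages of real sequences -/

/-- The average of the first `n` terms of `u`. -/
def average (u : ℕ → ℝ) (n : ℕ) : ℝ := (∑ i ∈ Finset.range n, u i) / n

lemma runningMean_eq_average (V : ℕ → ℝ) (k : ℕ) :
    runningMean V k = average (fun i => V (i + 1)) k := by
  induction k with
  | zero => simp [runningMean, average]
  | succ k ih =>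
    rw [runningMean, ih, average, average, Finset.sum_range_succ]
    rcases Nat.eq_zero_or_pos k with rfl | hk
    · simp
    · have : (k : ℝ) ≠ 0 := by positivity
      have : ((k + 1 : ℕ) : ℝ) ≠ 0 := by positivity
      push_cast at *
      field_simp
      ring

lemma tendsto_natCast_div_succ : Tendsto (fun n : ℕ => (n : ℝ) / ((n : ℝ) + 1)) atTop (𝓝 1) :=
  tendsto_natCast_div_add_atTop (1 : ℝ)

/-- One initial term contributes O(1/n). This absorbs the artificial value Dᵛ_0 = 0 of the lagged
scheme and the first epoch of the area sum. -/
lemma tendsto_average_of_shift {u : ℕ → ℝ} {a : ℝ}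
    (h : Tendsto (average fun i => u (i + 1)) atTop (𝓝 a)) : Tendsto (average u) atTop (𝓝 a) := by
  rw [← tendsto_add_atTop_iff_nat 1]
  have h1 : Tendsto (fun n : ℕ => u 0 / ((n : ℝ) + 1)) atTop (𝓝 0) :=
    tendsto_const_nhds.div_atTop (tendsto_natCast_atTop_atTop.atTop_add tendsto_const_nhds)
  have h2 := (h.mul tendsto_natCast_div_succ).add h1
  rw [mul_one, add_zero] at h2
  refine h2.congr fun n => ?_
  rw [average, average, Finset.sum_range_succ']
  rcases Nat.eq_zero_or_pos n with rfl | hn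
  · simp
  · have : (n : ℝ) ≠ 0 := by positivity
    have : (n : ℝ) + 1 ≠ 0 := by positivity
    push_cast
    field_simp

/-- A Cesàro argument with weights: an error that is o(b) termwise is o(Σ b) after summation, and Σ
b grows at most linearly. It transfers strong laws from the limiting threshold to the moving one. -/
lemma tendsto_average_of_abs_sub_le {u w b δ : ℕ → ℝ} {a B : ℝ}
    (hw : Tendsto (average w) atTop (𝓝 a)) (hb : Tendsto (average b) atTop (𝓝 B))
    (hb0 : ∀ k, 0 ≤ b k) (hδ : Tendsto δ atTop (𝓝 0)) (h : ∀ k, |u k - w k| ≤ δ k * b k) :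
    Tendsto (average u) atTop (𝓝 a) := by
  have hδ0 : ∀ k, 0 ≤ δ k * b k := fun k => (abs_nonneg _).trans (h k)
  -- The weight is b + 1 rather than b so that its partial sums certainly diverge.
  have o1 : (fun k => u k - w k) =o[atTop] fun k => b k + 1 := by
    have o2 : (fun k => δ k * (b k + 1)) =o[atTop] fun k => b k + 1 := by
      simpa using (Asymptotics.isLittleO_one_iff ℝ |>.2 hδ).mul_isBigO
        (Asymptotics.isBigO_refl (fun k => b k + 1) atTop)
    refine (Asymptotics.IsBigO.of_bound 1 (Eventually.of_forall fun k => ?_)).trans_isLittleO o2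
    rw [Real.norm_eq_abs, Real.norm_eq_abs, one_mul, abs_mul, abs_of_nonneg (by
      have := hb0 k; linarith : 0 ≤ b k + 1)]
    calc |u k - w k| ≤ δ k * b k := h k
      _ ≤ |δ k| * b k := mul_le_mul_of_nonneg_right (le_abs_self _) (hb0 k)
      _ ≤ |δ k| * (b k + 1) := by
        have := abs_nonneg (δ k); nlinarith
  have hge : ∀ n : ℕ, (n : ℝ) ≤ ∑ i ∈ Finset.range n, (b i + 1) := fun n => by
    have := Finset.sum_nonneg (s := Finset.range n) fun i _ => hb0 i
    rw [Finset.sum_add_distrib]; simp; linarith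
  have o3 := o1.sum_range (fun k => by have := hb0 k; simp; linarith)
    (tendsto_atTop_mono hge tendsto_natCast_atTop_atTop)
  have hb1 : Tendsto (fun n : ℕ => (∑ i ∈ Finset.range n, (b i + 1)) / n) atTop (𝓝 (B + 1)) := by
    refine (hb.add_const 1).congr' ?_
    filter_upwards [eventually_gt_atTop 0] with n hn
    have : (n : ℝ) ≠ 0 := by positivity
    rw [Finset.sum_add_distrib, average]
    simp
    field_simp
  have h3 := o3.tendsto_div_nhds_zero.mul hb1
  rw [zero_mul] at h3
  have h4 := h3.add hw
  rw [zero_add] at h4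
  refine h4.congr' ?_
  filter_upwards [eventually_gt_atTop 0] with n hn
  have h5 : (0 : ℝ) < n := by positivity
  have h6 : (∑ i ∈ Finset.range n, (b i + 1)) ≠ 0 := (h5.trans_le (hge n)).ne'
  rw [average, average, Finset.sum_sub_distrib]
  field_simp
  ring

lemma sum_range_eq_even_add_odd (y : ℕ → ℝ) (n : ℕ) :
    ∑ i ∈ Finset.range n, y i = ∑ i ∈ Finset.range ((n + 1) / 2), y (2 * i)
      + ∑ i ∈ Finset.range (n / 2), y (2 * i + 1) := by
  induction n with
  | zero => simp
  | succ n ih =>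
    rw [Finset.sum_range_succ, ih]
    rcases Nat.even_or_odd' n with ⟨m, rfl | rfl⟩
    · rw [show (2 * m + 1) / 2 = m by omega, show (2 * m + 1 + 1) / 2 = m + 1 by omega,
        show 2 * m / 2 = m by omega, Finset.sum_range_succ]
      ring
    · rw [show (2 * m + 1 + 1) / 2 = m + 1 by omega, show (2 * m + 1 + 1 + 1) / 2 = m + 1 by omega,
        show (2 * m + 1) / 2 = m by omega, Finset.sum_range_succ (fun i => y (2 * i + 1))]
      ring

/-- Needed for sequences that are only independent at distance two: each parity class obeys a strong
law of its own. -/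
lemma tendsto_average_of_even_odd {y : ℕ → ℝ} {a : ℝ}
    (h0 : Tendsto (average fun i => y (2 * i)) atTop (𝓝 a))
    (h1 : Tendsto (average fun i => y (2 * i + 1)) atTop (𝓝 a)) :
    Tendsto (average y) atTop (𝓝 a) := by
  have t1 : Tendsto (fun n : ℕ => (n + 1) / 2) atTop atTop :=
    tendsto_atTop_atTop.2 fun b => ⟨2 * b, fun n hn => by omega⟩
  have t2 : Tendsto (fun n : ℕ => n / 2) atTop atTop :=
    tendsto_atTop_atTop.2 fun b => ⟨2 * b, fun n hn => by omega⟩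
  have key : ∀ f : ℕ → ℕ, (∀ n, 2 * f n ≤ n + 1 ∧ n ≤ 2 * f n + 1) →
      Tendsto (fun n : ℕ => (f n : ℝ) / n) atTop (𝓝 (1 / 2)) := by
    intro f hf
    rw [tendsto_iff_norm_sub_tendsto_zero]
    refine squeeze_zero' (Eventually.of_forall fun n => norm_nonneg _) ?_
      (tendsto_one_div_atTop_nhds_zero_nat (𝕜 := ℝ))
    filter_upwards [eventually_gt_atTop 0] with n hn
    have h5 : (0 : ℝ) < n := by positivity
    have a1 : (2 : ℝ) * f n ≤ n + 1 := by exact_mod_cast (hf n).1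
    have a2 : (n : ℝ) ≤ 2 * f n + 1 := by exact_mod_cast (hf n).2
    rw [Real.norm_eq_abs, abs_le]
    constructor
    · rw [← sub_nonneg]; field_simp; linarith
    · rw [← sub_nonneg]; field_simp; linarith
  have k1 := key (fun n => (n + 1) / 2) fun n => by omega
  have k2 := key (fun n => n / 2) fun n => by omega
  have h2 := ((h0.comp t1).mul k1).add ((h1.comp t2).mul k2)
  rw [show a * (1 / 2) + a * (1 / 2) = a by ring] at h2
  refine h2.congr' ?_
  filter_upwards [eventually_gt_atTop 1] with n hn
  have c1 : (((n + 1) / 2 : ℕ) : ℝ) ≠ 0 := by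
    have : 0 < (n + 1) / 2 := by omega
    positivity
  have c2 : ((n / 2 : ℕ) : ℝ) ≠ 0 := by
    have : 0 < n / 2 := by omega
    positivity
  simp only [Function.comp, average]
  rw [sum_range_eq_even_add_odd y n, add_div]
  field_simp

/-! ### Projected stochastic approximation along a fixed realization -/

/-- One-sided convergence of a perturbed recursion whose drift is negative above `z`, provided the
noise increments sum up to a convergent sequence `N`. -/
lemma eventually_le_of_recursion {x N η g : ℕ → ℝ} {z l G : ℝ} (hl : l ≤ z)
    (hη0 : ∀ k, 0 ≤ η k) (hη : Tendsto η atTop (𝓝 0))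
    (hsum : Tendsto (fun n => ∑ k ∈ Finset.range n, η k) atTop atTop)
    (hN : CauchySeq N)
    (hx : ∀ k, x (k + 1) ≤ max l (x k + η k * g k + (N (k + 1) - N k)))
    (hG : ∀ᶠ k in atTop, g k ≤ G)
    (hg : ∀ δ > 0, ∃ c > 0, ∀ᶠ k in atTop, z + δ ≤ x k → g k ≤ -c) {δ : ℝ} (hδ : 0 < δ) :
    ∀ᶠ k in atTop, x k ≤ z + δ := by
  -- Error budget: the level z + d below which the drift is not used, one upward step of size at
  -- most d, and noise of total size at most d stay within z + δ.
  set d := δ / 4 with hd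
  have hd0 : 0 < d := by positivity
  obtain ⟨c, hc, hgc⟩ := hg d hd0
  have hηG : ∀ᶠ k in atTop, η k * |G| ≤ d := by
    have : Tendsto (fun k => η k * |G|) atTop (𝓝 0) := by simpa using hη.mul_const |G|
    filter_upwards [this.eventually (gt_mem_nhds hd0)] with k hk using hk.le
  obtain ⟨K1, hK1⟩ := Metric.cauchySeq_iff.1 hN d hd0
  obtain ⟨K2, hK2⟩ := eventually_atTop.1 ((hgc.and hG).and hηG)
  set K := max K1 K2 with hK
  have hNK : ∀ j ≥ K, ∀ k ≥ K, N k - N j ≤ d := fun j hj k hk => by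
    have := hK1 k (le_trans (le_max_left _ _) hk) j (le_trans (le_max_left _ _) hj)
    rw [Real.dist_eq] at this
    exact (le_abs_self _).trans this.le
  have hdown : ∀ k ≥ K, z + d ≤ x k → g k ≤ -c := fun k hk =>
    (hK2 k (le_trans (le_max_right _ _) hk)).1.1
  have hup : ∀ k ≥ K, η k * g k ≤ d := fun k hk => by
    have h := hK2 k (le_trans (le_max_right _ _) hk)
    exact (mul_le_mul_of_nonneg_left (h.1.2.trans (le_abs_self G)) (hη0 k)).trans h.2
  -- If the iterates stayed above z + 2d, the projection at l ≤ z would never act and the divergent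
  -- sum of the steps would push them to -∞.
  have hex : ∃ k1 ≥ K, x k1 ≤ z + 2 * d := by
    by_contra! hcon
    have hdec : ∀ n, x (K + n) ≤ x K + (N (K + n) - N K)
        - c * ∑ k ∈ Finset.range n, η (K + k) := by
      intro n
      induction n with
      | zero => simp
      | succ n ih =>
        have h1 := hx (K + n)
        have h2 := hcon (K + n + 1) (by omega)
        have h3 := hdown (K + n) (by omega) (by have := hcon (K + n) (by omega); linarith)
        have h4 := mul_le_mul_of_nonneg_left h3 (hη0 (K + n))
        rw [Finset.sum_range_succ, ← add_assoc]
        rcases le_max_iff.1 h1 with h | h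
        · linarith
        · nlinarith
    have ht : Tendsto (fun n => ∑ k ∈ Finset.range n, η (K + k)) atTop atTop := by
      have h1 := (tendsto_add_atTop_iff_nat K).2 hsum
      have h2 := h1.atTop_add (tendsto_const_nhds (x := -∑ k ∈ Finset.range K, η k))
      refine h2.congr fun n => ?_
      rw [add_comm n K, Finset.sum_range_add]; ring
    obtain ⟨n, hn⟩ := (ht.eventually_gt_atTop ((x K + d - z) / c)).exists
    have h1 := hdec n
    have h2 := hNK K le_rfl (K + n) (by omega)
    have h3 := hcon (K + n) (by omega)
    rw [div_lt_iff₀ hc] at hn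
    nlinarith
  obtain ⟨k1, hk1, hxk1⟩ := hex
  -- Here j is a restart index: it moves forward when the iterate is projected or lies below z + d,
  -- so that only the noise accumulated since then counts.
  have hinv : ∀ k ≥ k1, ∃ j ≥ K, x k ≤ z + 2 * d + (N k - N j) := by
    intro k hk
    induction k, hk using Nat.le_induction with
    | base => exact ⟨k1, hk1, by linarith⟩
    | succ k hk ih =>
      obtain ⟨j, hj, hxj⟩ := ih
      rcases le_max_iff.1 (hx k) with h | h
      · exact ⟨k + 1, by omega, by linarith⟩
      · rcases le_or_gt (z + d) (x k) with h5 | h5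
        · have h3 := mul_le_mul_of_nonneg_left (hdown k (by omega) h5) (hη0 k)
          have h4 := mul_nonneg (hη0 k) hc.le
          exact ⟨j, hj, by linarith⟩
        · have := hup k (by omega)
          exact ⟨k, by omega, by linarith⟩
  filter_upwards [eventually_ge_atTop k1] with k hk
  obtain ⟨j, hj, hxj⟩ := hinv k hk
  have := hNK j hj k (by omega)
  linarith

/-- Convergence of a projected stochastic approximation scheme along a realization for which the
weighted noise is summable and the bias `e` vanishes. -/
lemma tendsto_of_projected_recursion {x N η e : ℕ → ℝ} {h : ℝ → ℝ} {z l u c G : ℝ}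
    (hl : l ≤ z) (hu : z ≤ u) (hc : 0 < c)
    (hη0 : ∀ k, 0 ≤ η k) (hη : Tendsto η atTop (𝓝 0))
    (hsum : Tendsto (fun n => ∑ k ∈ Finset.range n, η k) atTop atTop)
    (hN : CauchySeq N) (he : Tendsto e atTop (𝓝 0))
    (hx : ∀ k, x (k + 1)
      = min u (max l (x k + η k * (h (x k) + e k) + (N (k + 1) - N k))))
    (hxl : ∀ k, l ≤ x k) (hxu : ∀ k, x k ≤ u)
    (hG : ∀ y, l ≤ y → y ≤ u → |h y| ≤ G)
    (habove : ∀ y, z ≤ y → y ≤ u → h y ≤ -(c * (y - z)))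
    (hbelow : ∀ y, l ≤ y → y ≤ z → c * (z - y) ≤ h y) :
    Tendsto x atTop (𝓝 z) := by
  have hsmall : ∀ δ > 0, ∀ᶠ k in atTop, |e k| < δ := fun δ hδ => by
    have := (he.abs).eventually (gt_mem_nhds (by simpa using hδ : |(0 : ℝ)| < δ))
    exact this
  have up : ∀ δ > 0, ∀ᶠ k in atTop, x k ≤ z + δ := fun δ hδ => by
    refine eventually_le_of_recursion (g := fun k => h (x k) + e k) (G := G + 1) hl hη0 hη hsum hN
      (fun k => (hx k).le.trans (min_le_right _ _)) ?_ ?_ hδ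
    · filter_upwards [hsmall 1 one_pos] with k hk
      have h1 := (abs_le.1 (hG (x k) (hxl k) (hxu k))).2
      have h2 := (abs_lt.1 hk).2
      linarith
    · intro d hd
      refine ⟨c * d / 2, by positivity, ?_⟩
      filter_upwards [hsmall (c * d / 2) (by positivity)] with k hk hxk
      have h1 := habove (x k) (by linarith) (hxu k)
      have h2 := (abs_lt.1 hk).2
      have h3 : c * d ≤ c * (x k - z) := mul_le_mul_of_nonneg_left (by linarith) hc.le
      linarith
  -- The one-sided lemma applies to -x with barrier -u; raising an iterate to l only helps from
  -- below.
  have down : ∀ δ > 0, ∀ᶠ k in atTop, -x k ≤ -z + δ := fun δ hδ => by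
    refine eventually_le_of_recursion (x := fun k => -x k) (N := fun k => -N k)
      (g := fun k => -(h (x k) + e k)) (G := G + 1) (neg_le_neg hu) hη0 hη hsum hN.neg
      (fun k => ?_) ?_ ?_ hδ
    · rw [hx k]
      have := min_le_min_left u (le_max_right l (x k + η k * (h (x k) + e k) + (N (k + 1) - N k)))
      calc _ ≤ -(min u (x k + η k * (h (x k) + e k) + (N (k + 1) - N k))) := neg_le_neg this
        _ = _ := by rw [← max_neg_neg]; congr 1; ring
    · filter_upwards [hsmall 1 one_pos] with k hk
      have h1 := (abs_le.1 (hG (x k) (hxl k) (hxu k))).1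
      have h2 := (abs_lt.1 hk).1
      linarith
    · intro d hd
      refine ⟨c * d / 2, by positivity, ?_⟩
      filter_upwards [hsmall (c * d / 2) (by positivity)] with k hk hxk
      have h1 := hbelow (x k) (hxl k) (by linarith)
      have h2 := (abs_lt.1 hk).1
      have h3 : c * d ≤ c * (z - x k) := mul_le_mul_of_nonneg_left (by linarith) hc.le
      linarith
  rw [Metric.tendsto_nhds]
  intro δ hδ
  filter_upwards [up (δ / 2) (by positivity), down (δ / 2) (by positivity)] with k h1 h2
  rw [Real.dist_eq, abs_lt]
  constructor <;> linarith

/-! ### Information contained in parts of the channel -/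

/-- Index set of the primitive random variables given by the delays of the samples in `D` and the
numbers of attempts of the epochs in `A`. -/
def indexSet (D : Set (ℕ × ℕ)) (A : Set ℕ) : Set ((ℕ × ℕ) ⊕ ((ℕ × ℕ) ⊕ ℕ)) :=
  {i | Sum.elim (· ∈ D) (Sum.elim (· ∈ D) (· ∈ A)) i}

/-- The σ-algebra generated by the delays of the samples in `D` and the numbers of attempts of the
epochs in `A`. -/
@[reducible] def info {Ω : Type*} (X : Ω → Path) (D : Set (ℕ × ℕ)) (A : Set ℕ) : MeasurableSpace Ω :=
  ⨆ i ∈ indexSet D A, MeasurableSpace.comap (primitives X i) inferInstance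

/-- Samples of the epochs before `k`. -/
def pastSamples (k : ℕ) : Set (ℕ × ℕ) := {x | x.1 < k}

/-- Samples up to `(k, j)`. -/
def seenSamples (k j : ℕ) : Set (ℕ × ℕ) := {x | x.1 < k ∨ x.1 = k ∧ x.2 ≤ j}

/-- Samples of epoch `k` after `(k, j)`. -/
def laterSamples (k j : ℕ) : Set (ℕ × ℕ) := {x | x.1 = k ∧ j < x.2}

/-- Samples of epoch `k`. -/
def epochSamples (k : ℕ) : Set (ℕ × ℕ) := {x | x.1 = k}

/-- Round-trip delay of sample `(k, j)`. -/
def roundTrip (p : Path) (k j : ℕ) : ℝ := forward p k j + backward p k j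

/-- Total round-trip delay of the samples of epoch `k` after `(k, i)`. -/
def tailDelay (p : Path) (k i : ℕ) : ℝ :=
  ∑ j ∈ Finset.Icc (i + 1) (attempts p k), roundTrip p k j

lemma virtualDelay_eq_tailDelay (p : Path) (k : ℕ) : virtualDelay p k = tailDelay p k 1 := rfl

lemma actualDelay_eq_roundTrip (p : Path) (k : ℕ) : actualDelay p k = roundTrip p k 1 := rfl

/-- The path all of whose epochs look like epoch `k` of `p`. -/
def epochPath (p : Path) (k : ℕ) : Path :=
  -- Entries with j = 0 have no prescribed law; erasing them makes these paths identically
  -- distributed over k ≥ 1.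
  (fun _ j => if j = 0 then 0 else p.1 k j, fun _ => p.2 k)

lemma forward_epochPath (p : Path) (k l : ℕ) {j : ℕ} (hj : 1 ≤ j) :
    forward (epochPath p k) l j = forward p k j := by
  simp [forward, epochPath, show j ≠ 0 by omega]

lemma backward_epochPath (p : Path) (k l : ℕ) {j : ℕ} (hj : 1 ≤ j) :
    backward (epochPath p k) l j = backward p k j := by
  simp [backward, epochPath, show j ≠ 0 by omega]

lemma roundTrip_epochPath (p : Path) (k l : ℕ) {j : ℕ} (hj : 1 ≤ j) :
    roundTrip (epochPath p k) l j = roundTrip p k j := by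
  simp [roundTrip, forward_epochPath, backward_epochPath, hj]

lemma actualDelay_epochPath (p : Path) (k l : ℕ) :
    actualDelay (epochPath p k) l = actualDelay p k := roundTrip_epochPath p k l le_rfl

lemma virtualDelay_epochPath (p : Path) (k l : ℕ) :
    virtualDelay (epochPath p k) l = virtualDelay p k :=
  Finset.sum_congr rfl fun j hj =>
    roundTrip_epochPath p k l (by have := (Finset.mem_Icc.1 hj).1; omega)

/-! ### Measurability with respect to partial information -/

section Measurability

variable {Ω : Type*} {X : Ω → Path}

lemma info_mono {D D' : Set (ℕ × ℕ)} {A A' : Set ℕ} (hD : D ⊆ D') (hA : A ⊆ A') :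
    info X D A ≤ info X D' A' := by
  refine iSup₂_le fun i hi => ?_
  refine le_iSup₂ (f := fun i (_ : i ∈ indexSet D' A') =>
    MeasurableSpace.comap (primitives X i) inferInstance) i ?_
  rcases i with x | x | k
  · exact hD hi
  · exact hD hi
  · exact hA hi

lemma measurable_primitives_info {D : Set (ℕ × ℕ)} {A : Set ℕ} {i}
    (hi : i ∈ indexSet D A) : Measurable[info X D A] (primitives X i) :=
  Measurable.mono (comap_measurable _) (le_iSup₂ (f := fun i (_ : i ∈ indexSet D A) =>
    MeasurableSpace.comap (primitives X i) inferInstance) i hi) le_rfl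

lemma measurable_forward_info {D : Set (ℕ × ℕ)} {A : Set ℕ} {k j : ℕ} (h : (k, j) ∈ D) :
    Measurable[info X D A] fun ω => forward (X ω) k j :=
  measurable_primitives_info (i := Sum.inl (k, j)) h

lemma measurable_backward_info {D : Set (ℕ × ℕ)} {A : Set ℕ} {k j : ℕ} (h : (k, j) ∈ D) :
    Measurable[info X D A] fun ω => backward (X ω) k j :=
  measurable_primitives_info (i := Sum.inr (Sum.inl (k, j))) h

lemma measurable_roundTrip_info {D : Set (ℕ × ℕ)} {A : Set ℕ} {k j : ℕ} (h : (k, j) ∈ D) :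
    Measurable[info X D A] fun ω => roundTrip (X ω) k j :=
  (measurable_forward_info h).add (measurable_backward_info h)

lemma measurable_attempts_info {D : Set (ℕ × ℕ)} {A : Set ℕ} {k : ℕ} (h : k ∈ A) :
    Measurable[info X D A] fun ω => attempts (X ω) k := by
  have h1 : Measurable[info X D A] (primitives X (Sum.inr (Sum.inr k))) :=
    measurable_primitives_info h
  have h2 := Nat.measurable_floor.comp h1
  convert h2 using 2
  simp [primitives]

lemma measurable_sample_info {D : Set (ℕ × ℕ)} {A : Set ℕ} {k j : ℕ} (h : (k, j) ∈ D) :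
    Measurable[info X D A] fun ω => (X ω).1 k j :=
  (measurable_forward_info h).prodMk (measurable_backward_info h)

lemma measurable_of_random_index {m : MeasurableSpace Ω} {E : Type*} [MeasurableSpace E]
    {f : Ω → ℕ} (hf : Measurable f)
    {h : ℕ → Ω → E} (hh : ∀ n, Measurable (h n)) : Measurable fun ω => h (f ω) ω := by
  have : Measurable fun x : ℕ × Ω => h x.1 x.2 := measurable_from_prod_countable_right hh
  exact this.comp (hf.prodMk measurable_id)

lemma measurable_sum_attempts {m : MeasurableSpace Ω} {f : Ω → ℕ} (hf : Measurable f)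
    {g : ℕ → Ω → ℝ} (a : ℕ) (hg : ∀ j, a ≤ j → Measurable (g j)) :
    Measurable fun ω => ∑ j ∈ Finset.Icc a (f ω), g j ω :=
  measurable_of_random_index (h := fun n ω => ∑ j ∈ Finset.Icc a n, g j ω) hf fun _ =>
    Finset.measurable_fun_sum _ fun j hj => hg j (Finset.mem_Icc.1 hj).1

lemma measurable_tailDelay_info {D : Set (ℕ × ℕ)} {A : Set ℕ} {k i : ℕ}
    (h : ∀ j, i < j → (k, j) ∈ D) (hA : k ∈ A) :
    Measurable[info X D A] fun ω => tailDelay (X ω) k i :=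
  measurable_sum_attempts (measurable_attempts_info hA) _ fun j hj =>
    measurable_roundTrip_info (h j (by omega))

lemma measurable_virtualDelay_info {D : Set (ℕ × ℕ)} {A : Set ℕ} {k : ℕ}
    (h : ∀ j, 1 < j → (k, j) ∈ D) (hA : k ∈ A) :
    Measurable[info X D A] fun ω => virtualDelay (X ω) k :=
  measurable_tailDelay_info h hA

lemma measurable_epochPath_info (k : ℕ) :
    Measurable[info X (epochSamples k) {k}] fun ω => epochPath (X ω) k := by
  refine Measurable.prodMk ?_ ?_
  · refine @measurable_pi_lambda _ _ _ (info X (epochSamples k) {k}) _ _ fun _ => ?_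
    refine @measurable_pi_lambda _ _ _ (info X (epochSamples k) {k}) _ _ fun j => ?_
    by_cases hj : j = 0
    · simp [hj]
    · simp only [hj, if_false]
      exact measurable_sample_info rfl
  · exact @measurable_pi_lambda _ _ _ (info X (epochSamples k) {k}) _ _ fun _ =>
      measurable_attempts_info rfl

/-- The path in which everything not observed up to the feedback of sample `(k, j)` is erased. -/
def observed (k j : ℕ) (p : Path) : Path :=
  (fun i l => if i < k ∨ i = k ∧ l ≤ j then p.1 i l else 0, fun i => if i < k then p.2 i else 0)

lemma measurable_observed_info (k j : ℕ) :
    Measurable[info X (seenSamples k j) (Set.Iio k)] fun ω => observed k j (X ω) := by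
  refine Measurable.prodMk ?_ ?_
  · refine @measurable_pi_lambda _ _ _ (info X (seenSamples k j) (Set.Iio k)) _ _ fun i => ?_
    refine @measurable_pi_lambda _ _ _ (info X (seenSamples k j) (Set.Iio k)) _ _ fun l => ?_
    by_cases h : i < k ∨ i = k ∧ l ≤ j
    · simp only [h, if_true]
      exact measurable_sample_info h
    · simp [h]
  · refine @measurable_pi_lambda _ _ _ (info X (seenSamples k j) (Set.Iio k)) _ _ fun i => ?_
    by_cases h : i < k
    · simp only [h, if_true]
      exact measurable_attempts_info h
    · simp [h]

/-- Causality says that erasing everything unseen does not change the waiting time, which therefore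
factors through `observed`. -/
lemma Policy.measurable_wait_info (π : Policy) {k j : ℕ} (hk : 1 ≤ k) (hj : 1 ≤ j) :
    Measurable[info X (seenSamples k j) (Set.Iio k)] fun ω => π.wait k j (X ω) := by
  have h : ∀ p, π.wait k j p = π.wait k j (observed k j p) := fun p => by
    refine π.causal k j hk hj _ _ (fun i _ hi => ⟨by simp [observed, hi], fun l _ _ => by
      simp [observed, hi]⟩) fun l _ hl => by simp [observed, hl]
  simp_rw [fun ω => h (X ω)]
  exact (π.measurable k j).comp (measurable_observed_info k j)

end Measurability

/-! ### Independence of disjoint blocks of the channel -/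

namespace IsChannel

variable {Ω : Type*} [MeasurableSpace Ω] {μ : Measure Ω} {α : ℝ} {PF PB : Measure ℝ}
  {X : Ω → Path}

section

variable (hX : IsChannel μ α PF PB X)
include hX

lemma measurable_sample (k j : ℕ) : Measurable fun ω => (X ω).1 k j :=
  (measurable_pi_iff.1 (measurable_pi_iff.1 (measurable_fst.comp hX.measurable) k) j)

lemma measurable_forward (k j : ℕ) : Measurable fun ω => forward (X ω) k j :=
  measurable_fst.comp (hX.measurable_sample k j)

lemma measurable_backward (k j : ℕ) : Measurable fun ω => backward (X ω) k j :=
  measurable_snd.comp (hX.measurable_sample k j)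

lemma measurable_attempts (k : ℕ) : Measurable fun ω => attempts (X ω) k :=
  measurable_pi_iff.1 (measurable_snd.comp hX.measurable) k

lemma measurable_primitives (i) : Measurable (primitives X i) := by
  rcases i with x | x | k
  · exact hX.measurable_forward _ _
  · exact hX.measurable_backward _ _
  · exact measurable_from_nat.comp (hX.measurable_attempts k)

lemma info_le (D : Set (ℕ × ℕ)) (A : Set ℕ) : info X D A ≤ ‹MeasurableSpace Ω› :=
  iSup₂_le fun i _ => (hX.measurable_primitives i).comap_le

lemma indep_info {D D' : Set (ℕ × ℕ)} {A A' : Set ℕ} (hD : Disjoint D D') (hA : Disjoint A A') :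
    Indep (info X D A) (info X D' A') μ := by
  refine indep_iSup_of_disjoint (fun i => (hX.measurable_primitives i).comap_le) hX.indep ?_
  rw [Set.disjoint_left] at *
  rintro (x | x | k) h h'
  · exact hD h h'
  · exact hD h h'
  · exact hA h h'

lemma indepFun_of_info {D D' : Set (ℕ × ℕ)} {A A' : Set ℕ} (hD : Disjoint D D')
    (hA : Disjoint A A') {E E' : Type*} [MeasurableSpace E] [MeasurableSpace E'] {f : Ω → E}
    {g : Ω → E'} (hf : Measurable[info X D A] f) (hg : Measurable[info X D' A'] g) :
    IndepFun f g μ :=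
  indep_of_indep_of_le_left (indep_of_indep_of_le_right (hX.indep_info hD hA) hg.comap_le)
    hf.comap_le

end

end IsChannel

/-! ### The channel model and its moments -/

/-- The standing assumptions on the channel. -/
structure Model {Ω : Type*} [MeasurableSpace Ω] (μ : Measure Ω) (ε B α : ℝ) (PF PB : Measure ℝ)
    (X : Ω → Path) : Prop where
  eps_pos : 0 < ε
  loss_nonneg : 0 ≤ α
  loss_lt_one : α < 1
  forwardLaw : IsDelayLaw ε B PF
  backwardLaw : IsDelayLaw ε B PB
  channel : IsChannel μ α PF PB X

lemma memLp_four_iff {Ω : Type*} [MeasurableSpace Ω] {μ : Measure Ω} {f : Ω → ℝ}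
    (hf : AEStronglyMeasurable f μ) : MemLp f 4 μ ↔ ∫⁻ ω, ‖f ω‖ₑ ^ 4 ∂μ < ∞ := by
  rw [MemLp, and_iff_right hf,
    eLpNorm_lt_top_iff_lintegral_rpow_enorm_lt_top (by norm_num) (by norm_num)]
  simp

lemma IsDelayLaw.memLp {Ω : Type*} [MeasurableSpace Ω] {μ : Measure Ω} {ε B : ℝ} {f : Ω → ℝ} {P : Measure ℝ} (hf : Measurable f) (hP : μ.map f = P)
    (hL : IsDelayLaw ε B P) : MemLp f 4 μ := by
  rw [memLp_four_iff hf.aestronglyMeasurable]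
  have h2 : ∀ x : ℝ, ‖x‖ₑ ^ 4 = ENNReal.ofReal (x ^ 4) := fun x => by
    rw [← enorm_pow, Real.enorm_of_nonneg (by positivity)]
  simp_rw [h2]
  have h1 := hL.fourthMoment
  rw [← hP, lintegral_map (by fun_prop) hf] at h1
  exact h1.trans_lt ENNReal.ofReal_lt_top

/-- The random upper limit moves into an indicator, so that expectation and summation can be
exchanged. -/
lemma sum_Icc_eq_tsum (f : ℕ → ℝ≥0∞) (a n : ℕ) :
    ∑ j ∈ Finset.Icc a n, f j = ∑' m, if a + m ≤ n then f (a + m) else 0 := by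
  rw [tsum_eq_sum (s := Finset.range (n + 1 - a))]
  · rw [← Finset.Ico_add_one_right_eq_Icc, Finset.sum_Ico_eq_sum_range]
    refine Finset.sum_congr rfl fun m hm => ?_
    rw [if_pos]
    have := Finset.mem_range.1 hm
    omega
  · intro m hm
    rw [if_neg]
    have := mt Finset.mem_range.2 hm
    omega

lemma lintegral_random_index {Ω : Type*} [MeasurableSpace Ω] {μ : Measure Ω} {f : Ω → ℕ}
    (hf : Measurable f) (g : ℕ → Ω → ℝ≥0∞) (hg : ∀ n, Measurable (g n)) :
    ∫⁻ ω, g (f ω) ω ∂μ = ∑' n, ∫⁻ ω, (if f ω = n then g n ω else 0) ∂μ := by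
  have hm : ∀ n, Measurable fun ω => if f ω = n then g n ω else 0 := fun n =>
    Measurable.ite (hf (measurableSet_singleton n)) (hg n) measurable_const
  rw [← lintegral_tsum fun n => (hm n).aemeasurable]
  refine lintegral_congr fun ω => ?_
  rw [tsum_eq_single (f ω) fun n hn => if_neg (Ne.symm hn)]
  simp

lemma sum_pow_four_le (s : Finset ℕ) (f : ℕ → ℝ≥0∞) :
    (∑ i ∈ s, f i) ^ 4 ≤ (s.card : ℝ≥0∞) ^ 3 * ∑ i ∈ s, f i ^ 4 := by
  have h := ENNReal.rpow_sum_le_const_mul_sum_rpow s f (p := 4) (by norm_num)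
  rw [show (4 : ℝ) - 1 = 3 by norm_num] at h
  simpa using h

namespace Model

variable {Ω : Type*} [MeasurableSpace Ω] {μ : Measure Ω} [IsProbabilityMeasure μ]
  {ε B α : ℝ} {PF PB : Measure ℝ} {X : Ω → Path} (h : Model μ ε B α PF PB X)

include h

lemma prob_le_attempts {k j : ℕ} (hk : 1 ≤ k) (hj : 1 ≤ j) :
    μ {ω | j ≤ attempts (X ω) k} = ENNReal.ofReal (α ^ (j - 1)) := by
  have h0 := h.loss_nonneg
  have h1 := h.loss_lt_one
  have hU : {ω | j ≤ attempts (X ω) k} = ⋃ n : ℕ, {ω | attempts (X ω) k = n + j} := by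
    ext ω
    simp only [Set.mem_ofPred_eq, Set.mem_iUnion]
    exact ⟨fun hle => ⟨attempts (X ω) k - j, by omega⟩, fun ⟨n, hn⟩ => by omega⟩
  rw [hU, measure_iUnion]
  · have h2 : ∀ n : ℕ, μ {ω | attempts (X ω) k = n + j}
        = ENNReal.ofReal (α ^ n * (α ^ (j - 1) * (1 - α))) := fun n => by
      rw [h.channel.attempts_law k (n + j) hk (by omega), show n + j - 1 = n + (j - 1) by omega,
        pow_add]
      congr 1; ring
    simp_rw [h2]
    rw [← ENNReal.ofReal_tsum_of_nonneg]
    · rw [tsum_mul_right, tsum_geometric_of_lt_one h0 h1]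
      congr 1
      field_simp [show (1 - α) ≠ 0 by linarith]
    · intro n
      have : 0 ≤ 1 - α := by linarith
      positivity
    · exact (summable_geometric_of_lt_one h0 h1).mul_right _
  · intro a b hab
    rw [Function.onFun, Set.disjoint_left]
    intro ω ha hb
    simp only [Set.mem_ofPred_eq] at ha hb
    omega
  · intro n
    exact h.channel.measurable_attempts k (measurableSet_singleton (n + j))

lemma ae_isRegular : ∀ᵐ ω ∂μ, IsRegular ε (X ω) := by
  have h1 : ∀ᵐ ω ∂μ, ∀ k, 1 ≤ k → 1 ≤ attempts (X ω) k := by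
    rw [ae_all_iff]
    intro k
    by_cases hk : 1 ≤ k
    · have hm : MeasurableSet {ω | 1 ≤ attempts (X ω) k} :=
        measurableSet_le measurable_const (h.channel.measurable_attempts k)
      have : {ω | 1 ≤ attempts (X ω) k} ∈ ae μ := by
        rw [mem_ae_iff_prob_eq_one hm, h.prob_le_attempts hk le_rfl]
        simp
      filter_upwards [this] with ω hω _ using hω
    · exact Eventually.of_forall fun ω hk' => absurd hk' hk
  have aux : ∀ (f : Ω → ℝ) (P : Measure ℝ), Measurable f → μ.map f = P → IsDelayLaw ε B P →
      ∀ᵐ ω ∂μ, ε ≤ f ω := by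
    intro f P hf hP hL
    have h2 : μ (f ⁻¹' Set.Iio ε) = 0 := by
      rw [← Measure.map_apply hf measurableSet_Iio, hP, hL.support]
    rw [ae_iff]
    convert h2 using 2
    ext ω; simp
  have h2 : ∀ᵐ ω ∂μ, ∀ k j, 1 ≤ k → 1 ≤ j → ε ≤ forward (X ω) k j := by
    simp_rw [ae_all_iff]
    exact fun k j hk hj =>
      aux _ PF (h.channel.measurable_forward k j) (h.channel.forward_law k j hk hj) h.forwardLaw
  have h3 : ∀ᵐ ω ∂μ, ∀ k j, 1 ≤ k → 1 ≤ j → ε ≤ backward (X ω) k j := by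
    simp_rw [ae_all_iff]
    exact fun k j hk hj =>
      aux _ PB (h.channel.measurable_backward k j) (h.channel.backward_law k j hk hj) h.backwardLaw
  filter_upwards [h1, h2, h3] with ω a b c using ⟨a, b, c⟩

lemma identDistrib_forward {k j : ℕ} (hk : 1 ≤ k) (hj : 1 ≤ j) :
    IdentDistrib (fun ω => forward (X ω) k j) (fun ω => forward (X ω) 1 1) μ μ :=
  ⟨(h.channel.measurable_forward k j).aemeasurable, (h.channel.measurable_forward 1 1).aemeasurable,
    by rw [h.channel.forward_law k j hk hj, h.channel.forward_law 1 1 le_rfl le_rfl]⟩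

lemma identDistrib_backward {k j : ℕ} (hk : 1 ≤ k) (hj : 1 ≤ j) :
    IdentDistrib (fun ω => backward (X ω) k j) (fun ω => backward (X ω) 1 1) μ μ :=
  ⟨(h.channel.measurable_backward k j).aemeasurable,
    (h.channel.measurable_backward 1 1).aemeasurable,
    by rw [h.channel.backward_law k j hk hj, h.channel.backward_law 1 1 le_rfl le_rfl]⟩

/-- The model prescribes only the masses at n ≥ 1. They sum to one, as used in `ae_isRegular`, so
the mass at 0 vanishes. -/
lemma identDistrib_attempts {k : ℕ} (hk : 1 ≤ k) :
    IdentDistrib (fun ω => attempts (X ω) k) (fun ω => attempts (X ω) 1) μ μ := by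
  refine ⟨(h.channel.measurable_attempts k).aemeasurable,
    (h.channel.measurable_attempts 1).aemeasurable, ?_⟩
  have key : ∀ k, 1 ≤ k → ∀ n, μ.map (fun ω => attempts (X ω) k) {n}
      = if n = 0 then 0 else ENNReal.ofReal (α ^ (n - 1) * (1 - α)) := by
    intro k hk n
    rw [Measure.map_apply (h.channel.measurable_attempts k) (measurableSet_singleton n)]
    split_ifs with hn
    · have := h.ae_isRegular
      rw [ae_iff] at this
      refine measure_mono_null ?_ this
      intro ω hω hreg
      have h1 := hreg.attempts_pos k hk
      have h2 : attempts (X ω) k = n := hω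
      omega
    · exact h.channel.attempts_law k n hk (by omega)
  refine Measure.ext_of_singleton fun n => ?_
  rw [key k hk, key 1 le_rfl]

/-- The epoch is the image, under one measurable map not depending on k, of an independent family
whose marginals do not depend on k. Every stationarity statement about epochs is deduced from this.
-/
lemma identDistrib_epochPath {k : ℕ} (hk : 1 ≤ k) :
    IdentDistrib (fun ω => epochPath (X ω) k) (fun ω => epochPath (X ω) 1) μ μ := by
  -- The shift to j + 1 picks exactly the samples whose laws are prescribed.
  let emb : ℕ → ℕ ⊕ (ℕ ⊕ Unit) → (ℕ × ℕ) ⊕ ((ℕ × ℕ) ⊕ ℕ) := fun k =>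
    Sum.elim (fun j => Sum.inl (k, j + 1)) (Sum.elim (fun j => Sum.inr (Sum.inl (k, j + 1)))
      fun _ => Sum.inr (Sum.inr k))
  have hemb : ∀ k, Function.Injective (emb k) := by
    rintro k (a | a | a) (b | b | b) hab <;> simp_all [emb]
  have hid : IdentDistrib (fun ω i => primitives X (emb k i) ω)
      (fun ω i => primitives X (emb 1 i) ω) μ μ := by
    refine IdentDistrib.pi ?_ (h.channel.indep.precomp (hemb k)) (h.channel.indep.precomp (hemb 1))
    rintro (j | j | _)
    · exact (h.identDistrib_forward (j := j + 1) hk (by omega)).trans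
        (h.identDistrib_forward (j := j + 1) le_rfl (by omega)).symm
    · exact (h.identDistrib_backward (j := j + 1) hk (by omega)).trans
        (h.identDistrib_backward (j := j + 1) le_rfl (by omega)).symm
    · exact (h.identDistrib_attempts hk).comp (u := fun n : ℕ => (n : ℝ)) measurable_from_nat
  let Φ : (ℕ ⊕ (ℕ ⊕ Unit) → ℝ) → Path := fun z =>
    (fun _ j => if j = 0 then 0 else (z (Sum.inl (j - 1)), z (Sum.inr (Sum.inl (j - 1)))),
      fun _ => ⌊z (Sum.inr (Sum.inr ()))⌋₊)
  have hΦ : Measurable Φ := by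
    refine Measurable.prodMk ?_ ?_
    · refine measurable_pi_lambda _ fun _ => measurable_pi_lambda _ fun j => ?_
      by_cases hj : j = 0
      · simp [hj]
      · simp only [hj, if_false]
        fun_prop
    · exact measurable_pi_lambda _ fun _ => Nat.measurable_floor.comp (measurable_pi_apply _)
  have hrec : ∀ k ω, Φ (fun i => primitives X (emb k i) ω) = epochPath (X ω) k := by
    intro k ω
    refine Prod.ext ?_ ?_
    · funext _ j
      rcases j with _ | j
      · simp [Φ, epochPath]
      · simp [Φ, epochPath, emb, primitives, forward, backward]
    · funext _
      simp [Φ, epochPath, emb, primitives, attempts]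
  have := hid.comp hΦ
  simpa only [Function.comp_def, hrec] using this

lemma identDistrib_roundTrip {k j : ℕ} (hk : 1 ≤ k) (hj : 1 ≤ j) :
    IdentDistrib (fun ω => roundTrip (X ω) k j) (fun ω => roundTrip (X ω) 1 1) μ μ := by
  have hind : ∀ k j, IndepFun (fun ω => forward (X ω) k j) (fun ω => backward (X ω) k j) μ :=
    fun k j => h.channel.indep.indepFun (i := Sum.inl (k, j)) (j := Sum.inr (Sum.inl (k, j)))
      (by simp)
  exact ((h.identDistrib_forward hk hj).prodMk (h.identDistrib_backward hk hj) (hind k j)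
    (hind 1 1)).comp (measurable_fst.add measurable_snd)

lemma memLp_forward {k j : ℕ} (hk : 1 ≤ k) (hj : 1 ≤ j) :
    MemLp (fun ω => forward (X ω) k j) 4 μ :=
  h.forwardLaw.memLp (h.channel.measurable_forward k j) (h.channel.forward_law k j hk hj)

lemma memLp_backward {k j : ℕ} (hk : 1 ≤ k) (hj : 1 ≤ j) :
    MemLp (fun ω => backward (X ω) k j) 4 μ :=
  h.backwardLaw.memLp (h.channel.measurable_backward k j) (h.channel.backward_law k j hk hj)

lemma memLp_roundTrip {k j : ℕ} (hk : 1 ≤ k) (hj : 1 ≤ j) :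
    MemLp (fun ω => roundTrip (X ω) k j) 4 μ :=
  (h.memLp_forward hk hj).add (h.memLp_backward hk hj)

lemma measurable_roundTrip (k j : ℕ) : Measurable fun ω => roundTrip (X ω) k j :=
  (h.channel.measurable_forward k j).add (h.channel.measurable_backward k j)

end Model

/-- Upper bound of the length of epoch `k` if all waiting times are at most `C`. -/
def grossDelay (C : ℝ) (p : Path) (k : ℕ) : ℝ :=
  ∑ j ∈ Finset.Icc 1 (attempts p k), (roundTrip p k j + C)

/-! ### Fourth moments of random sums over an epoch -/

namespace Model

variable {Ω : Type*} [MeasurableSpace Ω] {μ : Measure Ω} [IsProbabilityMeasure μ]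
  {ε B α : ℝ} {PF PB : Measure ℝ} {X : Ω → Path} (h : Model μ ε B α PF PB X)

include h

lemma measurable_grossDelay (C : ℝ) (k : ℕ) : Measurable fun ω => grossDelay C (X ω) k :=
  measurable_sum_attempts (h.channel.measurable_attempts k) 1 fun j _ =>
    (h.measurable_roundTrip k j).add_const C

lemma tsum_pow_attempts_ne_top {k : ℕ} (hk : 1 ≤ k) :
    ∑' n : ℕ, (n : ℝ≥0∞) ^ 4 * μ {ω | attempts (X ω) k = n} ≠ ∞ := by
  have h0 := h.loss_nonneg
  have h1 := h.loss_lt_one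
  rw [tsum_eq_zero_add' ENNReal.summable]
  simp only [Nat.cast_zero, ne_eq, OfNat.ofNat_ne_zero, not_false_eq_true, zero_pow, zero_mul,
    zero_add]
  have h2 : ∀ n : ℕ, ((n + 1 : ℕ) : ℝ≥0∞) ^ 4 * μ {ω | attempts (X ω) k = n + 1}
      ≤ ENNReal.ofReal (16 * ((n : ℝ) ^ 4 * α ^ n) + α ^ n) := fun n => by
    rw [h.channel.attempts_law k (n + 1) hk (by omega), ← ENNReal.ofReal_natCast,
      ← ENNReal.ofReal_pow (by positivity), ← ENNReal.ofReal_mul (by positivity)]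
    refine ENNReal.ofReal_le_ofReal ?_
    have hn : ((n + 1 : ℕ) : ℝ) ^ 4 ≤ 16 * (n : ℝ) ^ 4 + 1 := by
      rcases Nat.eq_zero_or_pos n with rfl | hn
      · simp
      · have : (1 : ℝ) ≤ n := by exact_mod_cast hn
        calc ((n + 1 : ℕ) : ℝ) ^ 4 ≤ (2 * (n : ℝ)) ^ 4 := by
              refine pow_le_pow_left₀ (by positivity) ?_ 4
              push_cast; linarith
          _ = 16 * (n : ℝ) ^ 4 := by ring
          _ ≤ _ := by linarith
    have h3 : 0 ≤ α ^ n := by positivity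
    rw [Nat.add_sub_cancel]
    have h4 : α ^ n * (1 - α) ≤ α ^ n := mul_le_of_le_one_right h3 (by linarith)
    have h5 := mul_le_mul hn h4 (mul_nonneg h3 (by linarith)) (by positivity)
    linarith
  refine ne_top_of_le_ne_top ?_ (ENNReal.tsum_le_tsum h2)
  rw [← ENNReal.ofReal_tsum_of_nonneg (fun n => by positivity)]
  · exact ENNReal.ofReal_ne_top
  · have h3 : Summable fun n : ℕ => (n : ℝ) ^ 4 * α ^ n :=
      summable_pow_mul_geometric_of_norm_lt_one 4 (by rwa [Real.norm_of_nonneg h0])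
    exact (h3.mul_left 16).add (summable_geometric_of_lt_one h0 h1)

lemma lintegral_roundTrip_pow_four (C : ℝ) {k j : ℕ} (hk : 1 ≤ k) (hj : 1 ≤ j) :
    ∫⁻ ω, ‖roundTrip (X ω) k j + C‖ₑ ^ 4 ∂μ = ∫⁻ ω, ‖roundTrip (X ω) 1 1 + C‖ₑ ^ 4 ∂μ :=
  ((h.identDistrib_roundTrip hk hj).comp
    (u := fun x => ‖x + C‖ₑ ^ 4) (by fun_prop)).lintegral_eq

/-- The number of attempts of epoch k is independent of all delays and of the other epochs, so the
probability factors out. This is the source of all Wald-type identities here. -/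
lemma lintegral_ite_attempts {k : ℕ} {D : Set (ℕ × ℕ)} {A : Set ℕ} (hA : k ∉ A)
    {f : Ω → ℝ≥0∞} (hf : Measurable[info X D A] f) (P : ℕ → Prop) [DecidablePred P] :
    ∫⁻ ω, (if P (attempts (X ω) k) then f ω else 0) ∂μ
      = μ {ω | P (attempts (X ω) k)} * ∫⁻ ω, f ω ∂μ := by
  let I : Ω → ℝ≥0∞ := fun ω => if P (attempts (X ω) k) then 1 else 0
  have hI : Measurable[info X ∅ {k}] I :=
    (measurable_of_countable fun m : ℕ => if P m then (1 : ℝ≥0∞) else 0).comp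
      (measurable_attempts_info (Set.mem_singleton k))
  have hind : IndepFun I f μ :=
    h.channel.indepFun_of_info (Set.empty_disjoint _) (by simpa using hA) hI hf
  have hmul := lintegral_mul_eq_lintegral_mul_lintegral_of_indepFun
    (hI.mono (h.channel.info_le _ _) le_rfl) (hf.mono (h.channel.info_le _ _) le_rfl) hind
  have hset : MeasurableSet {ω | P (attempts (X ω) k)} :=
    h.channel.measurable_attempts k (MeasurableSet.of_discrete (s := {m | P m}))
  have hprob : ∫⁻ ω, I ω ∂μ = μ {ω | P (attempts (X ω) k)} := by
    rw [← lintegral_indicator_one hset]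
    refine lintegral_congr fun ω => ?_
    simp [I, Set.indicator_apply]
  rw [hprob] at hmul
  rw [← hmul]
  refine lintegral_congr fun ω => ?_
  simp only [I, Pi.mul_apply, ite_mul, one_mul, zero_mul]

lemma lintegral_sum_attempts (e : ℕ → Ω → ℝ≥0∞) (w : ℕ → ℝ≥0∞) {K : ℝ≥0∞} {k : ℕ}
    (he : ∀ j, Measurable[info X {(k, j)} ∅] (e j))
    (hK : ∀ j, 1 ≤ j → ∫⁻ ω, e j ω ∂μ = K) :
    ∫⁻ ω, w (attempts (X ω) k) * ∑ j ∈ Finset.Icc 1 (attempts (X ω) k), e j ω ∂μ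
      = ∑' n : ℕ, w n * (n * (μ {ω | attempts (X ω) k = n} * K)) := by
  have hm : ∀ j, Measurable (e j) := fun j => (he j).mono (h.channel.info_le _ _) le_rfl
  rw [lintegral_random_index (h.channel.measurable_attempts k)
    (fun n ω => w n * ∑ j ∈ Finset.Icc 1 n, e j ω) fun n =>
      (Finset.measurable_fun_sum _ fun j _ => hm j).const_mul _]
  refine tsum_congr fun n => ?_
  have hm' : ∀ j, Measurable fun ω => if attempts (X ω) k = n then e j ω else 0 := fun j =>
    Measurable.ite (h.channel.measurable_attempts k (measurableSet_singleton n)) (hm j)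
      measurable_const
  have h1 : ∀ ω, (if attempts (X ω) k = n then w n * ∑ j ∈ Finset.Icc 1 n, e j ω else 0)
      = w n * ∑ j ∈ Finset.Icc 1 n, (if attempts (X ω) k = n then e j ω else 0) := by
    intro ω
    split_ifs
    · rfl
    · rw [Finset.sum_const_zero, mul_zero]
  have h2 : ∀ j ∈ Finset.Icc 1 n, ∫⁻ ω, (if attempts (X ω) k = n then e j ω else 0) ∂μ
      = μ {ω | attempts (X ω) k = n} * K := by
    intro j hj
    rw [← hK j (Finset.mem_Icc.1 hj).1]
    exact h.lintegral_ite_attempts (Set.notMem_empty k) (he j) fun m => m = n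
  rw [lintegral_congr h1, lintegral_const_mul _ (Finset.measurable_fun_sum _ fun j _ => hm' j),
    lintegral_finsetSum _ fun j _ => hm' j, Finset.sum_congr rfl h2,
    Finset.sum_const, Nat.card_Icc, Nat.add_sub_cancel, nsmul_eq_mul]

/-- By the power mean inequality a sum of M terms has fourth power at most M³ times the sum of the
fourth powers. M is independent of the summands, which leaves E[M⁴] times a fourth moment of one
delay, and the geometric law has all moments. -/
lemma memLp_grossDelay (C : ℝ) {k : ℕ} (hk : 1 ≤ k) :
    MemLp (fun ω => grossDelay C (X ω) k) 4 μ := by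
  rw [memLp_four_iff (h.measurable_grossDelay C k).aestronglyMeasurable]
  have hKtop : ∫⁻ ω, ‖roundTrip (X ω) 1 1 + C‖ₑ ^ 4 ∂μ < ∞ := by
    have := (h.memLp_roundTrip le_rfl le_rfl).add (memLp_const C (μ := μ) (p := 4))
    exact (memLp_four_iff this.1).1 this
  have h1 : ∀ ω, ‖grossDelay C (X ω) k‖ₑ ^ 4 ≤ (attempts (X ω) k : ℝ≥0∞) ^ 3 *
      ∑ j ∈ Finset.Icc 1 (attempts (X ω) k), ‖roundTrip (X ω) k j + C‖ₑ ^ 4 := by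
    intro ω
    refine (pow_le_pow_left₀ zero_le (enorm_sum_le _ _) 4).trans ?_
    have := sum_pow_four_le (Finset.Icc 1 (attempts (X ω) k)) fun j => ‖roundTrip (X ω) k j + C‖ₑ
    rwa [Nat.card_Icc, Nat.add_sub_cancel] at this
  have h2 := h.lintegral_sum_attempts (fun j ω => ‖roundTrip (X ω) k j + C‖ₑ ^ 4)
    (fun n => (n : ℝ≥0∞) ^ 3)
    (fun j => (show Measurable fun x : ℝ => ‖x + C‖ₑ ^ 4 by fun_prop).comp
      (measurable_roundTrip_info (Set.mem_singleton (k, j))))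
    (fun j hj => h.lintegral_roundTrip_pow_four C hk hj)
  refine (lintegral_mono h1).trans_lt (h2.trans_lt ?_)
  have h3 : ∀ (n : ℕ) (a K : ℝ≥0∞), (n : ℝ≥0∞) ^ 3 * (n * (a * K)) = n ^ 4 * a * K := by
    intro n a K; ring
  simp_rw [h3]
  rw [ENNReal.tsum_mul_right]
  exact ENNReal.mul_lt_top (h.tsum_pow_attempts_ne_top hk).lt_top hKtop

end Model

/-! ### Independence of the remaining virtual delay -/

lemma IsRegular.roundTrip_nonneg {ε : ℝ} {p : Path} (hp : IsRegular ε p) (hε : 0 < ε) {k j : ℕ}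
    (hk : 1 ≤ k) (hj : 1 ≤ j) : 0 ≤ roundTrip p k j := by
  have h1 := hp.forward_ge k j hk hj
  have h2 := hp.backward_ge k j hk hj
  unfold roundTrip; linarith

lemma IsRegular.tailDelay_nonneg {ε : ℝ} {p : Path} (hp : IsRegular ε p) (hε : 0 < ε) {k : ℕ}
    (hk : 1 ≤ k) (i : ℕ) : 0 ≤ tailDelay p k i :=
  Finset.sum_nonneg fun j hj =>
    hp.roundTrip_nonneg hε hk (by have := (Finset.mem_Icc.1 hj).1; omega)

lemma IsRegular.virtualDelay_nonneg {ε : ℝ} {p : Path} (hp : IsRegular ε p) (hε : 0 < ε) {k : ℕ}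
    (hk : 1 ≤ k) : 0 ≤ virtualDelay p k := hp.tailDelay_nonneg hε hk 1

lemma IsRegular.tailDelay_le_virtualDelay {ε : ℝ} {p : Path} (hp : IsRegular ε p) (hε : 0 < ε)
    {k i : ℕ} (hk : 1 ≤ k) (hi : 1 ≤ i) : tailDelay p k i ≤ virtualDelay p k := by
  refine Finset.sum_le_sum_of_subset_of_nonneg (Finset.Icc_subset_Icc_left (by omega))
    fun j hj _ => hp.roundTrip_nonneg hε hk (by have := (Finset.mem_Icc.1 hj).1; omega)

lemma IsRegular.sum_Icc_eq_add {ε : ℝ} {p : Path} (hp : IsRegular ε p) {k : ℕ} (hk : 1 ≤ k)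
    (f : ℕ → ℝ) : ∑ j ∈ Finset.Icc 1 (attempts p k), f j
      = f 1 + ∑ j ∈ Finset.Icc 2 (attempts p k), f j := by
  rw [← Finset.add_sum_Ioc_eq_sum_Icc (hp.attempts_pos k hk)]
  rfl

lemma IsRegular.actual_add_virtual_le_grossDelay {ε C : ℝ} {p : Path} (hp : IsRegular ε p)
    (hC : 0 ≤ C) {k : ℕ} (hk : 1 ≤ k) :
    actualDelay p k + C + virtualDelay p k ≤ grossDelay C p k := by
  rw [grossDelay, hp.sum_Icc_eq_add hk]
  have : virtualDelay p k ≤ ∑ j ∈ Finset.Icc 2 (attempts p k), (roundTrip p k j + C) :=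
    Finset.sum_le_sum fun j _ => by unfold roundTrip; linarith
  unfold roundTrip at *
  unfold actualDelay
  linarith

lemma IsRegular.epochLength_le_grossDelay {C : ℝ} {p : Path} {W : ℕ → ℕ → ℝ}
    (hW : ∀ k j, W k j ≤ C) (k : ℕ) :
    epochLength p W k ≤ grossDelay C p k :=
  Finset.sum_le_sum fun j _ => by unfold roundTrip; linarith [hW k j]

/-- The left side is the off-diagonal part of the expanded square; the diagonal squares are dropped.
-/
lemma two_mul_sum_mul_tail_le_sq (y : ℕ → ℝ) (a n : ℕ) :
    2 * ∑ i ∈ Finset.Icc a n, y i * ∑ j ∈ Finset.Icc (i + 1) n, y j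
      ≤ (∑ i ∈ Finset.Icc a n, y i) ^ 2 := by
  induction n with
  | zero =>
    rcases Nat.eq_zero_or_pos a with rfl | ha
    · simp [sq_nonneg]
    · simp [Finset.Icc_eq_empty (by omega : ¬ a ≤ 0)]
  | succ n ih =>
    by_cases ha : a ≤ n + 1
    · rw [Finset.sum_Icc_succ_top ha, Finset.sum_Icc_succ_top ha (fun i => y i)]
      have h1 : ∀ i ∈ Finset.Icc a n, y i * ∑ j ∈ Finset.Icc (i + 1) (n + 1), y j
          = y i * ∑ j ∈ Finset.Icc (i + 1) n, y j + y i * y (n + 1) := by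
        intro i hi
        rw [Finset.sum_Icc_succ_top (by have := (Finset.mem_Icc.1 hi).2; omega)]
        ring
      rw [Finset.sum_congr rfl h1, Finset.sum_add_distrib, ← Finset.sum_mul,
        Finset.Icc_eq_empty (by omega : ¬ n + 1 + 1 ≤ n + 1)]
      simp only [Finset.sum_empty, mul_zero, add_zero]
      nlinarith [sq_nonneg (y (n + 1))]
    · simp [Finset.Icc_eq_empty ha]

namespace Model

variable {Ω : Type*} [MeasurableSpace Ω] {μ : Measure Ω} [IsProbabilityMeasure μ]
  {ε B α : ℝ} {PF PB : Measure ℝ} {X : Ω → Path} (h : Model μ ε B α PF PB X)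

include h

lemma measurable_actualDelay (k : ℕ) : Measurable fun ω => actualDelay (X ω) k :=
  h.measurable_roundTrip k 1

lemma measurable_tailDelay (k i : ℕ) : Measurable fun ω => tailDelay (X ω) k i :=
  measurable_sum_attempts (h.channel.measurable_attempts k) _ fun j _ =>
    h.measurable_roundTrip k j

lemma measurable_virtualDelay (k : ℕ) : Measurable fun ω => virtualDelay (X ω) k :=
  h.measurable_tailDelay k 1

/-- Memorylessness of the geometric law: given that attempt i takes place, the delay still to come
has the same mean as the full virtual delay. On both sides the j-th round trip carries the weight
P(M ≥ j) = α^(j-1). -/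
lemma lintegral_tailDelay {k i : ℕ} (hk : 1 ≤ k) (hi : 1 ≤ i) :
    ∫⁻ ω, (if i ≤ attempts (X ω) k then ENNReal.ofReal (tailDelay (X ω) k i) else 0) ∂μ
      = ENNReal.ofReal (α ^ (i - 1)) * ∫⁻ ω, ENNReal.ofReal (virtualDelay (X ω) k) ∂μ := by
  have h0 := h.loss_nonneg
  have key : ∀ i, 1 ≤ i →
      ∫⁻ ω, (if i ≤ attempts (X ω) k then ENNReal.ofReal (tailDelay (X ω) k i) else 0) ∂μ
        = ∑' m : ℕ, ENNReal.ofReal (α ^ (i + m))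
          * ∫⁻ ω, ENNReal.ofReal (roundTrip (X ω) 1 1) ∂μ := by
    intro i hi
    have h1 : ∀ᵐ ω ∂μ,
        (if i ≤ attempts (X ω) k then ENNReal.ofReal (tailDelay (X ω) k i) else 0)
          = ∑' m : ℕ, if i + 1 + m ≤ attempts (X ω) k then
            ENNReal.ofReal (roundTrip (X ω) k (i + 1 + m)) else 0 := by
      filter_upwards [h.ae_isRegular] with ω hω
      rw [← sum_Icc_eq_tsum (fun j => ENNReal.ofReal (roundTrip (X ω) k j)), tailDelay,
        ENNReal.ofReal_sum_of_nonneg fun j hj => hω.roundTrip_nonneg h.eps_pos hk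
          (by have := (Finset.mem_Icc.1 hj).1; omega)]
      split_ifs with hi'
      · rfl
      · rw [Finset.Icc_eq_empty (by omega), Finset.sum_empty]
    have hm : ∀ j, Measurable fun ω => ENNReal.ofReal (roundTrip (X ω) k j) := fun j =>
      (h.measurable_roundTrip k j).ennreal_ofReal
    rw [lintegral_congr_ae h1, lintegral_tsum fun m => (Measurable.ite
      (measurableSet_le measurable_const (h.channel.measurable_attempts k)) (hm _)
      measurable_const).aemeasurable]
    refine tsum_congr fun m => ?_
    have h2 : Measurable[info X {(k, i + 1 + m)} ∅] fun ω =>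
        ENNReal.ofReal (roundTrip (X ω) k (i + 1 + m)) :=
      ENNReal.measurable_ofReal.comp (measurable_roundTrip_info (Set.mem_singleton _))
    rw [h.lintegral_ite_attempts (Set.notMem_empty k) h2 fun n => i + 1 + m ≤ n,
      h.prob_le_attempts hk (by omega), show i + 1 + m - 1 = i + m by omega]
    congr 1
    exact ((h.identDistrib_roundTrip hk (by omega)).comp ENNReal.measurable_ofReal).lintegral_eq
  have hv : ∫⁻ ω, ENNReal.ofReal (virtualDelay (X ω) k) ∂μ
      = ∑' m : ℕ, ENNReal.ofReal (α ^ (1 + m))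
          * ∫⁻ ω, ENNReal.ofReal (roundTrip (X ω) 1 1) ∂μ := by
    rw [← key 1 le_rfl]
    refine lintegral_congr_ae ?_
    filter_upwards [h.ae_isRegular] with ω hω
    rw [if_pos (hω.attempts_pos k hk)]
    rfl
  rw [key i hi, hv, ← ENNReal.tsum_mul_left]
  refine tsum_congr fun m => ?_
  rw [← mul_assoc, ← ENNReal.ofReal_mul (by positivity), ← pow_add]
  congr 3
  omega

/-- `U i` does not involve the number of attempts of epoch k, so it is independent of the event i ≤
M_k jointly with the later delays. Each summand then factors through `lintegral_tailDelay`. -/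
lemma lintegral_sum_mul_tailDelay {k : ℕ} (hk : 1 ≤ k) {U : ℕ → Ω → ℝ≥0∞}
    (hU : ∀ i, 1 ≤ i → Measurable[info X (seenSamples k i) (Set.Iio k)] (U i)) :
    ∫⁻ ω, ∑ i ∈ Finset.Icc 1 (attempts (X ω) k),
        U i ω * ENNReal.ofReal (tailDelay (X ω) k i) ∂μ
      = (∫⁻ ω, ENNReal.ofReal (virtualDelay (X ω) k) ∂μ)
        * ∫⁻ ω, ∑ i ∈ Finset.Icc 1 (attempts (X ω) k), U i ω ∂μ := by
  have hUm : ∀ i, 1 ≤ i → Measurable (U i) := fun i hi =>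
    (hU i hi).mono (h.channel.info_le _ _) le_rfl
  have hset : ∀ i, MeasurableSet {ω | i ≤ attempts (X ω) k} := fun i =>
    measurableSet_le measurable_const (h.channel.measurable_attempts k)
  have htm : ∀ i, Measurable fun ω => ENNReal.ofReal (tailDelay (X ω) k i) := fun i =>
    (h.measurable_tailDelay k i).ennreal_ofReal
  have hm1 : ∀ m, Measurable fun ω => if 1 + m ≤ attempts (X ω) k then
      U (1 + m) ω * ENNReal.ofReal (tailDelay (X ω) k (1 + m)) else 0 := fun m =>
    Measurable.ite (hset _) ((hUm _ (by omega)).mul (htm _)) measurable_const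
  have hm2 : ∀ m, Measurable fun ω => if 1 + m ≤ attempts (X ω) k then U (1 + m) ω else 0 :=
    fun m => Measurable.ite (hset _) (hUm _ (by omega)) measurable_const
  simp_rw [sum_Icc_eq_tsum]
  rw [lintegral_tsum fun m => (hm1 m).aemeasurable,
    lintegral_tsum fun m => (hm2 m).aemeasurable, ← ENNReal.tsum_mul_left]
  refine tsum_congr fun m => ?_
  obtain ⟨i, hi⟩ : ∃ i, i = 1 + m := ⟨_, rfl⟩
  have hi1 : 1 ≤ i := by omega
  rw [← hi]
  have h1 : ∫⁻ ω, (if i ≤ attempts (X ω) k then U i ω else 0) ∂μ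
      = ENNReal.ofReal (α ^ (i - 1)) * ∫⁻ ω, U i ω ∂μ := by
    rw [h.lintegral_ite_attempts (by simp) (hU i hi1) fun n => i ≤ n, h.prob_le_attempts hk hi1]
  have hlater : Measurable[info X (laterSamples k i) {k}] fun ω =>
      if i ≤ attempts (X ω) k then ENNReal.ofReal (tailDelay (X ω) k i) else 0 := by
    have h2 : Measurable[info X (laterSamples k i) {k}] fun ω => attempts (X ω) k :=
      measurable_attempts_info (Set.mem_singleton k)
    have h3 : Measurable[info X (laterSamples k i) {k}] fun ω => tailDelay (X ω) k i :=
      measurable_tailDelay_info (fun j hj => ⟨rfl, hj⟩) (Set.mem_singleton k)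
    exact Measurable.ite (h2 (MeasurableSet.of_discrete (s := {n | i ≤ n})))
      (ENNReal.measurable_ofReal.comp h3) measurable_const
  have hD : Disjoint (seenSamples k i) (laterSamples k i) := by
    rw [Set.disjoint_left]
    rintro ⟨a, b⟩ (h1 | h1) h2
    · exact absurd h2.1 h1.ne
    · exact absurd h2.2 (not_lt.2 h1.2)
  have hind : IndepFun (U i) (fun ω =>
      if i ≤ attempts (X ω) k then ENNReal.ofReal (tailDelay (X ω) k i) else 0) μ :=
    h.channel.indepFun_of_info hD (by simp) (hU i hi1) hlater
  have hmul := lintegral_mul_eq_lintegral_mul_lintegral_of_indepFun (hUm i hi1)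
    (hlater.mono (h.channel.info_le _ _) le_rfl) hind
  simp only [Pi.mul_apply, mul_ite, mul_zero] at hmul
  rw [hmul, h1, h.lintegral_tailDelay hk hi1]
  ring

lemma identDistrib_comp_epochPath {E : Type*} [MeasurableSpace E] {Φ : Path → E}
    (hΦ : Measurable Φ) {k : ℕ} (hk : 1 ≤ k) :
    IdentDistrib (fun ω => Φ (epochPath (X ω) k)) (fun ω => Φ (epochPath (X ω) 1)) μ μ :=
  (h.identDistrib_epochPath hk).comp hΦ

end Model

lemma measurable_path_forward (k j : ℕ) : Measurable fun p : Path => forward p k j := by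
  unfold forward; fun_prop

lemma measurable_path_roundTrip (k j : ℕ) : Measurable fun p : Path => roundTrip p k j := by
  unfold roundTrip forward backward; fun_prop

lemma measurable_path_attempts (k : ℕ) : Measurable fun p : Path => attempts p k := by
  unfold attempts; fun_prop

lemma measurable_path_actualDelay (k : ℕ) : Measurable fun p : Path => actualDelay p k :=
  measurable_path_roundTrip k 1

lemma measurable_path_virtualDelay (k : ℕ) : Measurable fun p : Path => virtualDelay p k :=
  measurable_sum_attempts (measurable_path_attempts k) 2 fun j _ => measurable_path_roundTrip k j

namespace Model

variable {Ω : Type*} [MeasurableSpace Ω] {μ : Measure Ω} [IsProbabilityMeasure μ]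
  {ε B α : ℝ} {PF PB : Measure ℝ} {X : Ω → Path} (h : Model μ ε B α PF PB X)

include h

lemma identDistrib_actualDelay {k : ℕ} (hk : 1 ≤ k) :
    IdentDistrib (fun ω => actualDelay (X ω) k) (fun ω => actualDelay (X ω) 1) μ μ := by
  have := h.identDistrib_comp_epochPath (measurable_path_actualDelay 1) hk
  simpa only [actualDelay_epochPath] using this

lemma identDistrib_virtualDelay {k : ℕ} (hk : 1 ≤ k) :
    IdentDistrib (fun ω => virtualDelay (X ω) k) (fun ω => virtualDelay (X ω) 1) μ μ := by
  have := h.identDistrib_comp_epochPath (measurable_path_virtualDelay 1) hk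
  simpa only [virtualDelay_epochPath] using this

lemma memLp_actualDelay {k : ℕ} (hk : 1 ≤ k) : MemLp (fun ω => actualDelay (X ω) k) 4 μ :=
  h.memLp_roundTrip hk le_rfl

lemma memLp_virtualDelay {k : ℕ} (hk : 1 ≤ k) : MemLp (fun ω => virtualDelay (X ω) k) 4 μ := by
  refine (h.memLp_grossDelay 0 hk).mono (h.measurable_virtualDelay k).aestronglyMeasurable ?_
  filter_upwards [h.ae_isRegular] with ω hω
  have h1 := hω.actual_add_virtual_le_grossDelay le_rfl hk
  have h2 := hω.virtualDelay_nonneg h.eps_pos hk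
  have h3 := hω.roundTrip_nonneg h.eps_pos hk le_rfl
  rw [← actualDelay_eq_roundTrip] at h3
  rw [Real.norm_of_nonneg h2, Real.norm_of_nonneg (by linarith)]
  linarith

lemma memLp_two_actualDelay {k : ℕ} (hk : 1 ≤ k) : MemLp (fun ω => actualDelay (X ω) k) 2 μ :=
  (h.memLp_actualDelay hk).mono_exponent (by norm_num)

lemma memLp_two_virtualDelay {k : ℕ} (hk : 1 ≤ k) : MemLp (fun ω => virtualDelay (X ω) k) 2 μ :=
  (h.memLp_virtualDelay hk).mono_exponent (by norm_num)

lemma memLp_two_grossDelay (C : ℝ) {k : ℕ} (hk : 1 ≤ k) :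
    MemLp (fun ω => grossDelay C (X ω) k) 2 μ :=
  (h.memLp_grossDelay C hk).mono_exponent (by norm_num)

lemma integrable_actualDelay {k : ℕ} (hk : 1 ≤ k) :
    Integrable (fun ω => actualDelay (X ω) k) μ :=
  (h.memLp_actualDelay hk).integrable (by norm_num)

lemma integrable_virtualDelay {k : ℕ} (hk : 1 ≤ k) :
    Integrable (fun ω => virtualDelay (X ω) k) μ :=
  (h.memLp_virtualDelay hk).integrable (by norm_num)

lemma integrable_forward {k : ℕ} (hk : 1 ≤ k) :
    Integrable (fun ω => forward (X ω) k 1) μ :=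
  (h.memLp_forward hk le_rfl).integrable (by norm_num)

/-- If `U i` is known after the feedback of sample `(k, i)`, then it is uncorrelated with the
deviation of the remaining virtual delay from its mean. -/
lemma integral_sum_mul_tailDelay_sub {k : ℕ} (hk : 1 ≤ k) {C : ℝ} (hC : 0 ≤ C)
    {U : ℕ → Ω → ℝ}
    (hU : ∀ i, 1 ≤ i → Measurable[info X (seenSamples k i) (Set.Iio k)] (U i))
    (hU0 : ∀ᵐ ω ∂μ, ∀ i, 1 ≤ i → 0 ≤ U i ω)
    (hUC : ∀ᵐ ω ∂μ, ∑ i ∈ Finset.Icc 1 (attempts (X ω) k), U i ω ≤ grossDelay C (X ω) k) :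
    Integrable (fun ω => ∑ i ∈ Finset.Icc 1 (attempts (X ω) k),
      U i ω * (tailDelay (X ω) k i - ∫ ω, virtualDelay (X ω) 1 ∂μ)) μ ∧
    ∫ ω, ∑ i ∈ Finset.Icc 1 (attempts (X ω) k),
      U i ω * (tailDelay (X ω) k i - ∫ ω, virtualDelay (X ω) 1 ∂μ) ∂μ = 0 := by
  set v := ∫ ω, virtualDelay (X ω) 1 ∂μ with hv
  have hUm : ∀ i, 1 ≤ i → Measurable (U i) := fun i hi =>
    (hU i hi).mono (h.channel.info_le _ _) le_rfl
  have m1 : Measurable fun ω => ∑ i ∈ Finset.Icc 1 (attempts (X ω) k), U i ω :=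
    measurable_sum_attempts (h.channel.measurable_attempts k) 1 hUm
  have m2 : Measurable fun ω => ∑ i ∈ Finset.Icc 1 (attempts (X ω) k),
      U i ω * tailDelay (X ω) k i :=
    measurable_sum_attempts (g := fun i ω => U i ω * tailDelay (X ω) k i)
      (h.channel.measurable_attempts k) 1 fun i hi => (hUm i hi).mul (h.measurable_tailDelay k i)
  have n1 : ∀ᵐ ω ∂μ, 0 ≤ ∑ i ∈ Finset.Icc 1 (attempts (X ω) k), U i ω := by
    filter_upwards [hU0] with ω hω
    exact Finset.sum_nonneg fun i hi => hω i (Finset.mem_Icc.1 hi).1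
  have n2 : ∀ᵐ ω ∂μ, 0 ≤ ∑ i ∈ Finset.Icc 1 (attempts (X ω) k),
      U i ω * tailDelay (X ω) k i := by
    filter_upwards [hU0, h.ae_isRegular] with ω hω hreg
    exact Finset.sum_nonneg fun i hi => mul_nonneg (hω i (Finset.mem_Icc.1 hi).1)
      (hreg.tailDelay_nonneg h.eps_pos hk i)
  have i1 : Integrable (fun ω => ∑ i ∈ Finset.Icc 1 (attempts (X ω) k), U i ω) μ := by
    refine ((h.memLp_grossDelay C hk).integrable (by norm_num)).mono' m1.aestronglyMeasurable ?_
    filter_upwards [n1, hUC] with ω a b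
    rwa [Real.norm_of_nonneg a]
  -- Each tail and the sum of the `U i` are both at most the gross delay, whose square is
  -- integrable.
  have i2 : Integrable (fun ω => ∑ i ∈ Finset.Icc 1 (attempts (X ω) k),
      U i ω * tailDelay (X ω) k i) μ := by
    refine (h.memLp_two_grossDelay C hk).integrable_sq.mono' m2.aestronglyMeasurable ?_
    filter_upwards [n1, n2, hU0, hUC, h.ae_isRegular] with ω a a2 b c hreg
    rw [Real.norm_of_nonneg a2, sq]
    have h1 := hreg.actual_add_virtual_le_grossDelay hC hk
    have h2 := hreg.virtualDelay_nonneg h.eps_pos hk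
    have h3 := hreg.roundTrip_nonneg h.eps_pos hk le_rfl
    rw [← actualDelay_eq_roundTrip] at h3
    calc _ ≤ ∑ i ∈ Finset.Icc 1 (attempts (X ω) k), U i ω * grossDelay C (X ω) k := by
          refine Finset.sum_le_sum fun i hi => ?_
          have hi1 := (Finset.mem_Icc.1 hi).1
          have := hreg.tailDelay_le_virtualDelay h.eps_pos hk hi1
          exact mul_le_mul_of_nonneg_left (by linarith) (b i hi1)
      _ = (∑ i ∈ Finset.Icc 1 (attempts (X ω) k), U i ω) * grossDelay C (X ω) k := by
          rw [Finset.sum_mul]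
      _ ≤ _ := mul_le_mul_of_nonneg_right c (by linarith)
  have e : ∀ ω, ∑ i ∈ Finset.Icc 1 (attempts (X ω) k), U i ω * (tailDelay (X ω) k i - v)
      = ∑ i ∈ Finset.Icc 1 (attempts (X ω) k), U i ω * tailDelay (X ω) k i
        - (∑ i ∈ Finset.Icc 1 (attempts (X ω) k), U i ω) * v := by
    intro ω
    simp_rw [mul_sub]
    rw [Finset.sum_sub_distrib, Finset.sum_mul]
  simp_rw [e]
  refine ⟨i2.sub (i1.mul_const v), ?_⟩
  rw [integral_sub i2 (i1.mul_const v), integral_mul_const, sub_eq_zero]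
  have hv' : v = ∫ ω, virtualDelay (X ω) k ∂μ := (h.identDistrib_virtualDelay hk).integral_eq.symm
  have vn : ∀ᵐ ω ∂μ, 0 ≤ virtualDelay (X ω) k := by
    filter_upwards [h.ae_isRegular] with ω hω using hω.virtualDelay_nonneg h.eps_pos hk
  rw [hv', integral_eq_lintegral_of_nonneg_ae n2 m2.aestronglyMeasurable,
    integral_eq_lintegral_of_nonneg_ae n1 m1.aestronglyMeasurable,
    integral_eq_lintegral_of_nonneg_ae vn (h.measurable_virtualDelay k).aestronglyMeasurable,
    ← ENNReal.toReal_mul, mul_comm (∫⁻ ω, _ ∂μ)]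
  have key := h.lintegral_sum_mul_tailDelay hk (U := fun i ω => ENNReal.ofReal (U i ω))
    fun i hi => ENNReal.measurable_ofReal.comp (hU i hi)
  have c1 : ∫⁻ ω, ENNReal.ofReal (∑ i ∈ Finset.Icc 1 (attempts (X ω) k),
      U i ω * tailDelay (X ω) k i) ∂μ = ∫⁻ ω, ∑ i ∈ Finset.Icc 1 (attempts (X ω) k),
      ENNReal.ofReal (U i ω) * ENNReal.ofReal (tailDelay (X ω) k i) ∂μ := by
    refine lintegral_congr_ae ?_
    filter_upwards [hU0, h.ae_isRegular] with ω a hreg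
    have hterm := fun i (hi : i ∈ Finset.Icc 1 (attempts (X ω) k)) => a i (Finset.mem_Icc.1 hi).1
    rw [ENNReal.ofReal_sum_of_nonneg fun i hi =>
      mul_nonneg (hterm i hi) (hreg.tailDelay_nonneg h.eps_pos hk i)]
    exact Finset.sum_congr rfl fun i hi => ENNReal.ofReal_mul (hterm i hi)
  have c2 : ∫⁻ ω, ENNReal.ofReal (∑ i ∈ Finset.Icc 1 (attempts (X ω) k), U i ω) ∂μ
      = ∫⁻ ω, ∑ i ∈ Finset.Icc 1 (attempts (X ω) k), ENNReal.ofReal (U i ω) ∂μ := by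
    refine lintegral_congr_ae ?_
    filter_upwards [hU0] with ω a
    rw [ENNReal.ofReal_sum_of_nonneg fun i hi => a i (Finset.mem_Icc.1 hi).1]
  rw [c1, c2, key]

/-- (Dᵛ)² is at least twice the sum of products of a virtual round trip with the tail after it, and
by memorylessness that sum has mean v². This makes the mean drift nonnegative at 0, so that a
nonnegative root exists. -/
lemma two_mul_sq_le_integral_virtualDelay_sq :
    2 * (∫ ω, virtualDelay (X ω) 1 ∂μ) ^ 2 ≤ ∫ ω, virtualDelay (X ω) 1 ^ 2 ∂μ := by
  set v := ∫ ω, virtualDelay (X ω) 1 ∂μ with hv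
  -- The first sample belongs to the actual delay and is switched off.
  set U : ℕ → Ω → ℝ := fun i ω => if i = 1 then 0 else roundTrip (X ω) 1 i with hUdef
  have hU : ∀ i, 1 ≤ i → Measurable[info X (seenSamples 1 i) (Set.Iio 1)] (U i) := by
    intro i hi
    by_cases h1 : i = 1
    · simp only [hUdef, h1, if_true]; exact measurable_const
    · simp only [hUdef, h1, if_false]
      exact measurable_roundTrip_info (Or.inr ⟨rfl, le_rfl⟩)
  have hsum : ∀ᵐ ω ∂μ, ∑ i ∈ Finset.Icc 1 (attempts (X ω) 1), U i ω = virtualDelay (X ω) 1 := by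
    filter_upwards [h.ae_isRegular] with ω hreg
    rw [hreg.sum_Icc_eq_add le_rfl]
    simp only [hUdef, if_true, zero_add, virtualDelay]
    refine Finset.sum_congr rfl fun i hi => ?_
    have := (Finset.mem_Icc.1 hi).1
    rw [if_neg (by omega)]; rfl
  obtain ⟨hint, h0⟩ := h.integral_sum_mul_tailDelay_sub le_rfl (le_refl 0) hU
    (by
      filter_upwards [h.ae_isRegular] with ω hreg i hi
      simp only [hUdef]
      split_ifs
      · exact le_rfl
      · exact hreg.roundTrip_nonneg h.eps_pos le_rfl hi)
    (by
      filter_upwards [h.ae_isRegular, hsum] with ω hreg hs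
      rw [hs]
      have h1 := hreg.actual_add_virtual_le_grossDelay le_rfl (le_refl 1)
      have h3 := hreg.roundTrip_nonneg h.eps_pos (le_refl 1) le_rfl
      rw [← actualDelay_eq_roundTrip] at h3
      linarith)
  rw [← hv] at hint h0
  have hV := h.integrable_virtualDelay (le_refl 1)
  have hV2 := (h.memLp_two_virtualDelay (le_refl 1)).integrable_sq
  have hle : ∀ᵐ ω ∂μ, 2 * (∑ i ∈ Finset.Icc 1 (attempts (X ω) 1),
      U i ω * (tailDelay (X ω) 1 i - v)) + 2 * v * virtualDelay (X ω) 1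
        ≤ virtualDelay (X ω) 1 ^ 2 := by
    filter_upwards [h.ae_isRegular, hsum] with ω hreg hs
    have e : ∑ i ∈ Finset.Icc 1 (attempts (X ω) 1), U i ω * (tailDelay (X ω) 1 i - v)
      = ∑ i ∈ Finset.Icc 1 (attempts (X ω) 1), U i ω * tailDelay (X ω) 1 i
        - virtualDelay (X ω) 1 * v := by
      simp_rw [mul_sub]
      rw [Finset.sum_sub_distrib, ← Finset.sum_mul, hs]
    have e2 : ∑ i ∈ Finset.Icc 1 (attempts (X ω) 1), U i ω * tailDelay (X ω) 1 i
        = ∑ i ∈ Finset.Icc 2 (attempts (X ω) 1), roundTrip (X ω) 1 i *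
          ∑ j ∈ Finset.Icc (i + 1) (attempts (X ω) 1), roundTrip (X ω) 1 j := by
      rw [hreg.sum_Icc_eq_add le_rfl]
      simp only [hUdef, if_true, zero_mul, zero_add]
      refine Finset.sum_congr rfl fun i hi => ?_
      have := (Finset.mem_Icc.1 hi).1
      rw [if_neg (by omega)]; rfl
    have e3 := two_mul_sum_mul_tail_le_sq (fun i => roundTrip (X ω) 1 i) 2 (attempts (X ω) 1)
    rw [e, e2]
    change _ ≤ (∑ i ∈ Finset.Icc 2 (attempts (X ω) 1), roundTrip (X ω) 1 i) ^ 2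
    linarith
  have := integral_mono_ae ((hint.const_mul 2).add (hV.const_mul (2 * v))) hV2 hle
  rw [integral_add' (hint.const_mul 2) (hV.const_mul (2 * v)), integral_const_mul,
    integral_const_mul, h0, ← hv] at this
  nlinarith

end Model

/-! ### The mean drift and its root -/

/-- The derivative of `drift` in γ is -(max d γ + v), which lies between -(max d γ' + v) and -(d +
v) on the interval up to γ'. The two ends give this bound and the next one. -/
lemma drift_le {γ γ' d v : ℝ} (hγ : γ ≤ γ') :
    drift γ' d v ≤ drift γ d v - (γ' - γ) * (d + v) := by
  unfold drift
  rcases le_total d γ with h1 | h1 <;> rcases le_total d γ' with h2 | h2 <;>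
    simp only [max_eq_left, max_eq_right, h1, h2] <;> nlinarith

lemma le_drift {γ γ' d v : ℝ} (hγ : γ ≤ γ') :
    drift γ d v - (γ' - γ) * (max d γ' + v) ≤ drift γ' d v := by
  unfold drift
  rcases le_total d γ with h1 | h1 <;> rcases le_total d γ' with h2 | h2 <;>
    simp only [max_eq_left, max_eq_right, h1, h2] <;> nlinarith

/-- The mean `E g_0(γ; Dᵃ, Dᵛ) + E[(Dᵛ)²] / 2 - E[Dᵛ]²` of the Robbins–Monro increment. -/
def driftMean {Ω : Type*} [MeasurableSpace Ω] (μ : Measure Ω) (X : Ω → Path) (γ : ℝ) : ℝ :=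
  ∫ ω, drift γ (actualDelay (X ω) 1) (virtualDelay (X ω) 1) ∂μ
    + ((1 / 2) * ∫ ω, virtualDelay (X ω) 1 ^ 2 ∂μ - (∫ ω, virtualDelay (X ω) 1 ∂μ) ^ 2)

/-- Length of epoch `k` if the sensor waits until `γ` after sampling. -/
def thresholdEpoch (γ : ℝ) (p : Path) (k : ℕ) : ℝ :=
  max (actualDelay p k) γ + virtualDelay p k

lemma thresholdEpoch_epochPath (γ : ℝ) (p : Path) (k l : ℕ) :
    thresholdEpoch γ (epochPath p k) l = thresholdEpoch γ p k := by
  rw [thresholdEpoch, actualDelay_epochPath, virtualDelay_epochPath, thresholdEpoch]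

lemma measurable_path_thresholdEpoch (γ : ℝ) (k : ℕ) :
    Measurable fun p : Path => thresholdEpoch γ p k :=
  ((measurable_path_actualDelay k).max measurable_const).add (measurable_path_virtualDelay k)

/-! ### Monotonicity, root and localization of the mean drift -/

namespace Model

variable {Ω : Type*} [MeasurableSpace Ω] {μ : Measure Ω} [IsProbabilityMeasure μ]
  {ε B α : ℝ} {PF PB : Measure ℝ} {X : Ω → Path} (h : Model μ ε B α PF PB X)

include h

lemma memLp_max_actualDelay (γ : ℝ) {k : ℕ} (hk : 1 ≤ k) :
    MemLp (fun ω => max (actualDelay (X ω) k) γ) 4 μ :=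
  (h.memLp_actualDelay hk).sup (memLp_const γ)

lemma memLp_thresholdEpoch (γ : ℝ) {k : ℕ} (hk : 1 ≤ k) :
    MemLp (fun ω => thresholdEpoch γ (X ω) k) 4 μ :=
  (h.memLp_max_actualDelay γ hk).add (h.memLp_virtualDelay hk)

lemma measurable_thresholdEpoch (γ : ℝ) (k : ℕ) :
    Measurable fun ω => thresholdEpoch γ (X ω) k :=
  (measurable_path_thresholdEpoch γ k).comp h.channel.measurable

lemma integrable_drift (γ : ℝ) {k : ℕ} (hk : 1 ≤ k) :
    Integrable (fun ω => drift γ (actualDelay (X ω) k) (virtualDelay (X ω) k)) μ := by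
  unfold drift
  have h1 := ((h.memLp_max_actualDelay γ hk).mono_exponent (by norm_num : (2 : ℝ≥0∞) ≤ 4))
  exact (h1.integrable_sq.const_mul (1 / 2)).sub
    (((h1.integrable (by norm_num)).add (h.integrable_virtualDelay hk)).const_mul γ)

lemma indepFun_actualDelay_virtualDelay (k : ℕ) :
    IndepFun (fun ω => actualDelay (X ω) k) (fun ω => virtualDelay (X ω) k) μ :=
  h.channel.indepFun_of_info (D := {(k, 1)}) (A := ∅) (D' := laterSamples k 1) (A' := {k})
    (by simp [laterSamples]) (Set.empty_disjoint _)
    (measurable_roundTrip_info (Set.mem_singleton (k, 1)))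
    (measurable_virtualDelay_info (fun j hj => ⟨rfl, hj⟩) (Set.mem_singleton k))

/-- Expanding the square leaves the cross term max(Dᵃ, γ) Dᵛ, and by independence its mean is
cancelled by v max(Dᵃ, γ). The mean increment of the algorithm is thus the expected Lagrangian cost
of an epoch. -/
lemma integral_thresholdEpoch (γ : ℝ) :
    ∫ ω, ((1 / 2) * thresholdEpoch γ (X ω) 1 ^ 2
      - (γ + ∫ ω, virtualDelay (X ω) 1 ∂μ) * thresholdEpoch γ (X ω) 1) ∂μ
      = driftMean μ X γ := by
  set v := ∫ ω, virtualDelay (X ω) 1 ∂μ with hv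
  set Z : Ω → ℝ := fun ω => max (actualDelay (X ω) 1) γ with hZ
  have hind : IndepFun Z (fun ω => virtualDelay (X ω) 1) μ :=
    (h.indepFun_actualDelay_virtualDelay 1).comp (φ := fun x => max x γ) (ψ := id)
      (by fun_prop) measurable_id
  have hZ1 : Integrable Z μ := (h.memLp_max_actualDelay γ le_rfl).integrable (by norm_num)
  have hV1 := h.integrable_virtualDelay (le_refl 1)
  have hV2 := (h.memLp_two_virtualDelay (le_refl 1)).integrable_sq
  have hZV : Integrable (fun ω => Z ω * virtualDelay (X ω) 1) μ := hind.integrable_mul hZ1 hV1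
  have hmul : ∫ ω, Z ω * virtualDelay (X ω) 1 ∂μ = (∫ ω, Z ω ∂μ) * v :=
    hind.integral_mul_eq_mul_integral hZ1.1 hV1.1
  have hd := h.integrable_drift γ (le_refl 1)
  have e : ∀ ω, (1 / 2) * thresholdEpoch γ (X ω) 1 ^ 2 - (γ + v) * thresholdEpoch γ (X ω) 1
      = drift γ (actualDelay (X ω) 1) (virtualDelay (X ω) 1)
        + ((1 / 2) * virtualDelay (X ω) 1 ^ 2 - v * virtualDelay (X ω) 1)
        + (Z ω * virtualDelay (X ω) 1 - v * Z ω) := by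
    intro ω
    simp only [thresholdEpoch, drift, hZ]
    ring
  simp_rw [e]
  have hV3 : Integrable (fun ω => (1 / 2) * virtualDelay (X ω) 1 ^ 2 - v * virtualDelay (X ω) 1)
      μ := (hV2.const_mul _).sub (hV1.const_mul _)
  have hZ3 : Integrable (fun ω => Z ω * virtualDelay (X ω) 1 - v * Z ω) μ :=
    hZV.sub (hZ1.const_mul v)
  have hd3 : Integrable (fun ω => drift γ (actualDelay (X ω) 1) (virtualDelay (X ω) 1)
      + ((1 / 2) * virtualDelay (X ω) 1 ^ 2 - v * virtualDelay (X ω) 1)) μ := hd.add hV3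
  rw [integral_add hd3 hZ3, integral_add hd hV3,
    integral_sub (hV2.const_mul _) (hV1.const_mul _), integral_sub hZV (hZ1.const_mul v),
    integral_const_mul, integral_const_mul, integral_const_mul, hmul, driftMean, ← hv]
  ring

lemma virtualMean_nonneg : 0 ≤ ∫ ω, virtualDelay (X ω) 1 ∂μ := by
  refine integral_nonneg_of_ae ?_
  filter_upwards [h.ae_isRegular] with ω hreg using hreg.virtualDelay_nonneg h.eps_pos le_rfl

lemma actualMean_pos : 0 < ∫ ω, actualDelay (X ω) 1 ∂μ := by
  have h1 : ∫ _, 2 * ε ∂μ ≤ ∫ ω, actualDelay (X ω) 1 ∂μ := by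
    refine integral_mono_ae (integrable_const _) (h.integrable_actualDelay le_rfl) ?_
    filter_upwards [h.ae_isRegular] with ω hreg using hreg.actualDelay_ge le_rfl
  have := h.eps_pos
  simp at h1
  linarith

lemma forwardMean_nonneg : 0 ≤ ∫ ω, forward (X ω) 1 1 ∂μ := by
  refine integral_nonneg_of_ae ?_
  filter_upwards [h.ae_isRegular] with ω hreg
  exact h.eps_pos.le.trans (hreg.forward_ge 1 1 le_rfl le_rfl)

/-- The uniform slope is what brackets the root and what drives the stochastic approximation towards
it. -/
lemma driftMean_le {γ γ' : ℝ} (hγ : γ ≤ γ') :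
    driftMean μ X γ' ≤ driftMean μ X γ - (γ' - γ) *
      (∫ ω, actualDelay (X ω) 1 ∂μ + ∫ ω, virtualDelay (X ω) 1 ∂μ) := by
  have hA := h.integrable_actualDelay (le_refl 1)
  have hV := h.integrable_virtualDelay (le_refl 1)
  have h1 := integral_mono (h.integrable_drift γ' (le_refl 1))
    ((h.integrable_drift γ (le_refl 1)).sub ((hA.add hV).const_mul (γ' - γ)))
    fun ω => drift_le hγ
  rw [integral_sub' (h.integrable_drift γ (le_refl 1)) ((hA.add hV).const_mul (γ' - γ)),
    integral_const_mul, integral_add' hA hV] at h1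
  unfold driftMean
  linarith

lemma le_driftMean {γ γ' : ℝ} (hγ : γ ≤ γ') :
    driftMean μ X γ - (γ' - γ) *
      (∫ ω, max (actualDelay (X ω) 1) γ' ∂μ + ∫ ω, virtualDelay (X ω) 1 ∂μ)
        ≤ driftMean μ X γ' := by
  have hA : Integrable (fun ω => max (actualDelay (X ω) 1) γ') μ :=
    (h.memLp_max_actualDelay γ' le_rfl).integrable (by norm_num)
  have hV := h.integrable_virtualDelay (le_refl 1)
  have h1 := integral_mono
    ((h.integrable_drift γ (le_refl 1)).sub ((hA.add hV).const_mul (γ' - γ)))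
    (h.integrable_drift γ' (le_refl 1))
    fun ω => le_drift hγ
  rw [integral_sub' (h.integrable_drift γ (le_refl 1)) ((hA.add hV).const_mul (γ' - γ)),
    integral_const_mul, integral_add' hA hV] at h1
  unfold driftMean
  linarith

lemma driftMean_antitone : Antitone (driftMean μ X) := fun γ γ' hγ => by
  have h1 := h.driftMean_le hγ
  have h2 := h.virtualMean_nonneg
  have h3 := h.actualMean_pos
  nlinarith

lemma continuousOn_driftMean (R : ℝ) : ContinuousOn (driftMean μ X) (Set.Icc 0 R) := by
  set K := ∫ ω, max (actualDelay (X ω) 1) R ∂μ + ∫ ω, virtualDelay (X ω) 1 ∂μ with hK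
  have hint : ∀ γ, Integrable (fun ω => max (actualDelay (X ω) 1) γ) μ := fun γ =>
    (h.memLp_max_actualDelay γ le_rfl).integrable (by norm_num)
  have key : ∀ γ γ', γ ≤ γ' → γ' ≤ R → |driftMean μ X γ - driftMean μ X γ'| ≤ K * |γ - γ'| := by
    intro γ γ' h1 h2
    have h3 := h.driftMean_antitone h1
    have h4 := h.le_driftMean h1
    have h5 : ∫ ω, max (actualDelay (X ω) 1) γ' ∂μ ≤ ∫ ω, max (actualDelay (X ω) 1) R ∂μ :=
      integral_mono (hint _) (hint _) fun ω => max_le_max le_rfl h2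
    rw [abs_of_nonneg (by linarith), abs_sub_comm, abs_of_nonneg (by linarith)]
    nlinarith
  refine (LipschitzOnWith.of_dist_le_mul (K := K.toNNReal) fun x hx y hy => ?_).continuousOn
  rw [Real.dist_eq, Real.dist_eq]
  refine le_trans ?_ (mul_le_mul_of_nonneg_right (Real.le_coe_toNNReal K) (abs_nonneg _))
  rcases le_total x y with hxy | hxy
  · exact key x y hxy hy.2
  · rw [abs_sub_comm, abs_sub_comm x y]
    exact key y x hxy hx.2

lemma driftMean_zero_nonneg : 0 ≤ driftMean μ X 0 := by
  have h1 := h.two_mul_sq_le_integral_virtualDelay_sq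
  have h2 : 0 ≤ ∫ ω, drift 0 (actualDelay (X ω) 1) (virtualDelay (X ω) 1) ∂μ :=
    integral_nonneg fun ω => by simp only [drift]; rw [zero_mul, sub_zero]; positivity
  unfold driftMean
  linarith

lemma exists_driftMean_eq_zero : ∃ γ, 0 ≤ γ ∧ driftMean μ X γ = 0 := by
  set D := ∫ ω, actualDelay (X ω) 1 ∂μ + ∫ ω, virtualDelay (X ω) 1 ∂μ with hD
  have hD0 : 0 < D := by
    have h2 := h.virtualMean_nonneg
    have h3 := h.actualMean_pos
    linarith
  have h0 := h.driftMean_zero_nonneg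
  -- At R the slope bound has used up the whole initial value, so the drift is nonpositive there.
  set R := driftMean μ X 0 / D with hR
  have hR0 : 0 ≤ R := by positivity
  have hle := h.driftMean_le hR0
  rw [← hD, sub_zero, hR, div_mul_cancel₀ _ hD0.ne', sub_self] at hle
  obtain ⟨γ, hγ, hγ0⟩ := intermediate_value_Icc' hR0 (h.continuousOn_driftMean R) ⟨hle, h0⟩
  exact ⟨γ, hγ.1, hγ0⟩

lemma integral_thresholdEpoch_mean (γ : ℝ) :
    ∫ ω, actualDelay (X ω) 1 ∂μ + ∫ ω, virtualDelay (X ω) 1 ∂μ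
      ≤ ∫ ω, thresholdEpoch γ (X ω) 1 ∂μ := by
  have hA := h.integrable_actualDelay (le_refl 1)
  have hV := h.integrable_virtualDelay (le_refl 1)
  rw [← integral_add hA hV]
  exact integral_mono (hA.add hV) ((h.memLp_thresholdEpoch γ le_rfl).integrable (by norm_num))
    fun ω => add_le_add_left (le_max_left _ _) _

/-- Second moment of the optimal epoch length in terms of the first. -/
lemma integral_thresholdEpoch_sq {γ : ℝ} (hγ : driftMean μ X γ = 0) :
    (1 / 2) * ∫ ω, thresholdEpoch γ (X ω) 1 ^ 2 ∂μ
      = (γ + ∫ ω, virtualDelay (X ω) 1 ∂μ) * ∫ ω, thresholdEpoch γ (X ω) 1 ∂μ := by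
  have h1 := h.integral_thresholdEpoch γ
  have hm := h.memLp_thresholdEpoch γ (le_refl 1)
  have i1 : Integrable (fun ω => thresholdEpoch γ (X ω) 1) μ := hm.integrable (by norm_num)
  have i2 : Integrable (fun ω => thresholdEpoch γ (X ω) 1 ^ 2) μ :=
    (hm.mono_exponent (by norm_num : (2 : ℝ≥0∞) ≤ 4)).integrable_sq
  rw [hγ, integral_sub (i2.const_mul _) (i1.const_mul _), integral_const_mul,
    integral_const_mul] at h1
  linarith

/-- At the root E[L²] = 2(γ + v) E[L], and E[L²] ≥ E[L]², hence γ + v ≥ E[L]/2 ≥ (E[Dᵃ] + v)/2. -/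
lemma gammaLb_le_root {b : Bounds} (hb : b.Valid μ X) {γ : ℝ} (hγ0 : 0 ≤ γ)
    (hγ : driftMean μ X γ = 0) : b.gammaLb ≤ γ := by
  refine max_le ?_ hγ0
  set v := ∫ ω, virtualDelay (X ω) 1 ∂μ with hv
  set L := ∫ ω, thresholdEpoch γ (X ω) 1 ∂μ with hL
  have hm := h.memLp_thresholdEpoch γ (le_refl 1)
  have h1 := h.integral_thresholdEpoch_sq hγ
  have h2 := h.integral_thresholdEpoch_mean γ
  have h3 := h.virtualMean_nonneg
  have h4 := h.actualMean_pos
  rw [← hv] at h1 h2 h3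
  rw [← hL] at h1 h2
  have h5 : ∫ ω, actualDelay (X ω) 1 ∂μ
      = ∫ ω, forward (X ω) 1 1 ∂μ + ∫ ω, backward (X ω) 1 1 ∂μ :=
    integral_add ((h.memLp_forward le_rfl le_rfl).integrable (by norm_num))
      ((h.memLp_backward le_rfl le_rfl).integrable (by norm_num))
  have hvar : L ^ 2 ≤ ∫ ω, thresholdEpoch γ (X ω) 1 ^ 2 ∂μ := by
    have hv2 := variance_nonneg (fun ω => thresholdEpoch γ (X ω) 1) μ
    rw [variance_eq_sub (hm.mono_exponent (by norm_num))] at hv2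
    have : (fun ω => thresholdEpoch γ (X ω) 1) ^ 2 = fun ω => thresholdEpoch γ (X ω) 1 ^ 2 := rfl
    rw [this] at hv2
    linarith
  have h6 : L / 2 ≤ γ + v := by
    have hLpos : 0 < L := by linarith
    by_contra! hcon
    nlinarith
  have := hb.forward_le
  have := hb.backward_le
  have := hb.le_virtual
  linarith

/-- The slope bound from 0 to the root gives γ E[Dᵃ + Dᵛ] ≤ `driftMean` at 0. Adding v E[Dᵃ + Dᵛ]
turns the right side into E[(Dᵃ + Dᵛ)²]/2, because Dᵃ and Dᵛ are uncorrelated. -/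
lemma root_le_gammaUb {b : Bounds} (hb : b.Valid μ X) {γ : ℝ} (hγ0 : 0 ≤ γ)
    (hγ : driftMean μ X γ = 0) : γ ≤ b.gammaUb := by
  have hle := h.driftMean_le hγ0
  rw [hγ, sub_zero] at hle
  set v := ∫ ω, virtualDelay (X ω) 1 ∂μ with hv
  set A := ∫ ω, actualDelay (X ω) 1 ∂μ with hA
  have h3 := h.virtualMean_nonneg
  have h4 := h.actualMean_pos
  have iA := h.integrable_actualDelay (le_refl 1)
  have iV := h.integrable_virtualDelay (le_refl 1)
  have iA2 := (h.memLp_two_actualDelay (le_refl 1)).integrable_sq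
  have iV2 := (h.memLp_two_virtualDelay (le_refl 1)).integrable_sq
  have hind := h.indepFun_actualDelay_virtualDelay 1
  have iAV : Integrable (fun ω => actualDelay (X ω) 1 * virtualDelay (X ω) 1) μ :=
    hind.integrable_mul iA iV
  have hmul : ∫ ω, actualDelay (X ω) 1 * virtualDelay (X ω) 1 ∂μ = A * v :=
    hind.integral_mul_eq_mul_integral iA.1 iV.1
  have h0 : driftMean μ X 0 = (1 / 2) * ∫ ω, actualDelay (X ω) 1 ^ 2 ∂μ
      + ((1 / 2) * ∫ ω, virtualDelay (X ω) 1 ^ 2 ∂μ - v ^ 2) := by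
    rw [driftMean, ← hv]
    congr 1
    rw [← integral_const_mul]
    refine integral_congr_ae ?_
    filter_upwards [h.ae_isRegular] with ω hreg
    have h1 := hreg.roundTrip_nonneg h.eps_pos (le_refl 1) le_rfl
    rw [← actualDelay_eq_roundTrip] at h1
    simp [drift, max_eq_left h1]
  have hsq : ∫ ω, (actualDelay (X ω) 1 + virtualDelay (X ω) 1) ^ 2 ∂μ
      = ∫ ω, actualDelay (X ω) 1 ^ 2 ∂μ + 2 * (A * v) + ∫ ω, virtualDelay (X ω) 1 ^ 2 ∂μ := by
    have e : ∀ ω, (actualDelay (X ω) 1 + virtualDelay (X ω) 1) ^ 2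
      = actualDelay (X ω) 1 ^ 2 + 2 * (actualDelay (X ω) 1 * virtualDelay (X ω) 1)
        + virtualDelay (X ω) 1 ^ 2 := fun ω => by ring
    simp_rw [e]
    have i3 : Integrable (fun ω => actualDelay (X ω) 1 ^ 2
        + 2 * (actualDelay (X ω) 1 * virtualDelay (X ω) 1)) μ := iA2.add (iAV.const_mul 2)
    rw [integral_add i3 iV2, integral_add iA2 (iAV.const_mul 2),
      integral_const_mul, hmul]
  have h5 : A = ∫ ω, forward (X ω) 1 1 ∂μ + ∫ ω, backward (X ω) 1 1 ∂μ :=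
    integral_add ((h.memLp_forward le_rfl le_rfl).integrable (by norm_num))
      ((h.memLp_backward le_rfl le_rfl).integrable (by norm_num))
  have hD := hb.delayLb_pos
  have hDle : b.delayLb ≤ A + v := by
    have := hb.forward_le
    have := hb.backward_le
    have := hb.virtual_le
    unfold Bounds.delayLb
    linarith
  have hH := hb.le_second
  have hvl : b.virtualLb ≤ v := hb.virtual_le
  rw [Bounds.gammaUb, le_sub_iff_add_le, le_div_iff₀ hD]
  -- The known lower bound of v may be negative; then the left side has the right sign without any
  -- estimate.
  rcases le_total (γ + b.virtualLb) 0 with hneg | hpos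
  · have h7 : 0 ≤ ∫ ω, (actualDelay (X ω) 1 + virtualDelay (X ω) 1) ^ 2 ∂μ :=
      integral_nonneg fun ω => sq_nonneg _
    nlinarith
  · have h8 : (γ + b.virtualLb) * b.delayLb ≤ (γ + v) * (A + v) := by
      refine mul_le_mul (by linarith) hDle hD.le (by linarith)
    nlinarith

end Model

/-! ### The optimal age -/

/-- The waiting times of a policy along a path. -/
def Policy.waits (π : Policy) (p : Path) (k j : ℕ) : ℝ := π.wait k j p

/-- Summing only the quartic term over n epochs bounds the largest of their squares, with mean s +
O(n/s); balancing with s of order √n keeps boundary effects at O(√T). -/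
lemma sq_le_add_div {s : ℝ} (hs : 0 < s) (x : ℝ) : x ^ 2 ≤ s + x ^ 4 / s := by
  have h : s + x ^ 4 / s = (s ^ 2 + x ^ 4) / s := by field_simp
  rw [h, le_div_iff₀ hs]
  nlinarith [sq_nonneg (s - x ^ 2), sq_nonneg (x ^ 2), sq_nonneg s]

lemma IsRegular.epochLength_threshold {ε γ : ℝ} {p : Path} {W : ℕ → ℕ → ℝ} (hp : IsRegular ε p)
    {k : ℕ} (hk : 1 ≤ k) (h1 : W k 1 = max (γ - actualDelay p k) 0)
    (h2 : ∀ j, 2 ≤ j → W k j = 0) : epochLength p W k = thresholdEpoch γ p k := by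
  rw [epochLength, hp.sum_Icc_eq_add hk, thresholdEpoch, virtualDelay, h1,
    Finset.sum_congr rfl fun j hj => by rw [h2 j (Finset.mem_Icc.1 hj).1, add_zero]]
  congr 1
  change actualDelay p k + _ = _
  rw [← max_add_add_left]
  simp [max_comm]

/-- Upper bound of all `(grossDelay C p k) ^ 2`, `1 ≤ k ≤ n`. -/
def overshoot (C s : ℝ) (n : ℕ) (p : Path) : ℝ :=
  s + ∑ k ∈ Finset.range n, grossDelay C p (k + 1) ^ 4 / s

lemma sq_grossDelay_le_overshoot {C s : ℝ} (hs : 0 < s) {n k : ℕ} (hk : k < n) (p : Path) :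
    grossDelay C p (k + 1) ^ 2 ≤ overshoot C s n p := by
  refine (sq_le_add_div hs _).trans (add_le_add_right ?_ _)
  exact Finset.single_le_sum (f := fun k => grossDelay C p (k + 1) ^ 4 / s)
    (fun i _ => by positivity) (Finset.mem_range.2 hk)

/-! ### Boundary effects at a fixed time horizon -/

section PolicyPath

variable {ε C s T : ℝ} {p : Path} {W : ℕ → ℕ → ℝ}

lemma IsRegular.sub_sampleTime_mem (hp : IsRegular ε p) (hε : 0 < ε) (hW : ∀ k j, 0 ≤ W k j)
    (hWC : ∀ k j, W k j ≤ C) (k : ℕ) :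
    0 ≤ sampleTime p W (k + 1) - sampleTime p W k ∧
      (sampleTime p W (k + 1) - sampleTime p W k) ^ 2
        ≤ if k = 0 then 0 else grossDelay C p k ^ 2 := by
  have h0 := hp.sampleTime_mono hε hW (Nat.le_succ k)
  refine ⟨sub_nonneg.2 h0, ?_⟩
  split_ifs with hk
  · simp [hk]
  · have h1 := IsRegular.epochLength_le_grossDelay (p := p) hWC k
    have h2 : sampleTime p W (k + 1) = _ := sampleTime_succ (Nat.one_le_iff_ne_zero.2 hk)
    exact pow_le_pow_left₀ (sub_nonneg.2 h0) (by linarith) 2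

/-- Comparison of the age integral up to a fixed time with sums over the epochs begun by then. -/
lemma IsRegular.age_bounds (hp : IsRegular ε p) (hε : 0 < ε) (hW : ∀ k j, 0 ≤ W k j)
    (hWC : ∀ k j, W k j ≤ C) (hs : 0 < s) (hT : 0 ≤ T) {n : ℕ} (hn : T < 2 * ε * n) :
    let S : (ℕ → ℝ) → ℝ := fun a =>
      ∑ k ∈ Finset.range n, if sampleTime p W (k + 1) ≤ T then a k else 0
    let G := overshoot C s n p
    ENNReal.ofReal (S (fun k => cycleArea p W (k + 1)) - 2 * G)
        ≤ ∫⁻ t in Set.Icc 0 T, ENNReal.ofReal (age p W t) ∧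
      ∫⁻ t in Set.Icc 0 T, ENNReal.ofReal (age p W t)
        ≤ ENNReal.ofReal (S (fun k => cycleArea p W (k + 1))) ∧
      T ≤ S (fun k => epochLength p W (k + 1)) ∧
      S (fun k => epochLength p W (k + 1)) ≤ T + 1 + G ∧
      T - 1 - G ≤ S (fun k => sampleTime p W (k + 1) - sampleTime p W k) ∧
      S (fun k => sampleTime p W (k + 1) - sampleTime p W k) ≤ T := by
  intro S G
  -- Epoch N + 1 is the one in progress at time T: integrating to its start bounds the area below,
  -- to its end bounds it above.
  obtain ⟨N, hNn, hN1, hN2, hsum⟩ := hp.exists_epoch hε hW hT hn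
  have hS : ∀ a, S a = ∑ k ∈ Finset.range (N + 1), a k := hsum
  have e1 : S (fun k => epochLength p W (k + 1)) = sampleTime p W (N + 2) := by
    rw [hS, ← sampleTime_succ_eq_sum_range]
  have e2 : S (fun k => sampleTime p W (k + 1) - sampleTime p W k) = sampleTime p W (N + 1) := by
    rw [hS, Finset.sum_range_sub (fun k => sampleTime p W k)]
    simp
  have hL : epochLength p W (N + 1) ≤ grossDelay C p (N + 1) :=
    IsRegular.epochLength_le_grossDelay hWC _
  have hL0 : 0 ≤ epochLength p W (N + 1) :=
    (by positivity : (0 : ℝ) ≤ 2 * ε).trans (hp.epochLength_ge hε hW (by omega))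
  have hG : grossDelay C p (N + 1) ^ 2 ≤ G := sq_grossDelay_le_overshoot hs hNn p
  have hG1 : grossDelay C p (N + 1) ≤ 1 + G := by nlinarith [sq_nonneg (grossDelay C p (N + 1) - 1)]
  have e3 : sampleTime p W (N + 2) = sampleTime p W (N + 1) + epochLength p W (N + 1) :=
    sampleTime_succ (by omega)
  have hG0 : 0 ≤ G := (sq_nonneg _).trans hG
  refine ⟨?_, ?_, ?_, ?_, ?_, ?_⟩
  · have h1 := hp.lintegral_age hε hW N
    refine le_trans ?_ (lintegral_mono_set (Set.Icc_subset_Icc_right hN1))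
    rw [h1, hS, Finset.sum_range_succ]
    refine ENNReal.ofReal_le_ofReal ?_
    -- The area of the epoch in progress is quadratic in its length, its forward delay and the
    -- preceding difference of sampling times, each with square at most G.
    have h2 : cycleArea p W (N + 1) ≤ 2 * G := by
      obtain ⟨d0, d1⟩ := hp.sub_sampleTime_mem hε hW hWC N
      have d2 : (sampleTime p W (N + 1) - sampleTime p W N) ^ 2 ≤ G := by
        refine d1.trans ?_
        split_ifs with h0
        · exact hG0
        · obtain ⟨m, rfl⟩ := Nat.exists_eq_succ_of_ne_zero h0
          exact sq_grossDelay_le_overshoot hs (by omega) p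
      have hF0 : 0 ≤ forward p (N + 1) 1 := hε.le.trans (hp.forward_ge _ _ (by omega) le_rfl)
      have hF1 : forward p (N + 1) 1 ≤ epochLength p W (N + 1) := by
        have := hp.actualDelay_le_epochLength hε hW (show 1 ≤ N + 1 by omega)
        have := hp.backward_ge (N + 1) 1 (by omega) le_rfl
        unfold actualDelay at *
        linarith
      have hL2 : epochLength p W (N + 1) ^ 2 ≤ G := (pow_le_pow_left₀ hL0 hL 2).trans hG
      have hF2 : forward p (N + 1) 1 ^ 2 ≤ G := (pow_le_pow_left₀ hF0 hF1 2).trans hL2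
      rw [cycleArea, Nat.add_sub_cancel]
      nlinarith [sq_nonneg (forward p (N + 1) 1 - (sampleTime p W (N + 1) - sampleTime p W N))]
    linarith
  · have h1 := hp.lintegral_age hε hW (N + 1)
    refine (lintegral_mono_set (Set.Icc_subset_Icc_right hN2.le)).trans ?_
    rw [hS]
    exact h1.le
  · rw [e1]; exact hN2.le
  · rw [e1]; linarith
  · rw [e2]; linarith
  · rw [e2]; exact hN1

end PolicyPath

/-! ### Expected Lagrangian cost of a single epoch -/

namespace Model

variable {Ω : Type*} [MeasurableSpace Ω] {μ : Measure Ω} [IsProbabilityMeasure μ]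
  {ε B α : ℝ} {PF PB : Measure ℝ} {X : Ω → Path} (h : Model μ ε B α PF PB X)

lemma measurable_epochLength_info (π : Policy) {i k : ℕ} (hi : 1 ≤ i) (hik : i < k) :
    Measurable[info X (pastSamples k) (Set.Iio k)] fun ω =>
      epochLength (X ω) (π.waits (X ω)) i := by
  refine measurable_sum_attempts (measurable_attempts_info (Set.mem_Iio.2 hik)) 1 fun j hj => ?_
  have h1 : Measurable[info X (pastSamples k) (Set.Iio k)] fun ω => roundTrip (X ω) i j :=
    measurable_roundTrip_info (show (i, j) ∈ pastSamples k from hik)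
  have h2 : Measurable[info X (pastSamples k) (Set.Iio k)] fun ω => π.wait i j (X ω) :=
    (π.measurable_wait_info hi hj).mono (info_mono
      (fun x hx => by rcases hx with hx | hx <;> simp only [pastSamples, Set.mem_ofPred_eq] <;> omega)
      (Set.Iio_subset_Iio hik.le)) le_rfl
  exact h1.add h2

lemma measurable_sampleTime_info (π : Policy) {i k : ℕ} (hik : i ≤ k) :
    Measurable[info X (pastSamples k) (Set.Iio k)] fun ω =>
      sampleTime (X ω) (π.waits (X ω)) i := by
  refine Finset.measurable_fun_sum _ fun j hj => ?_
  have := Finset.mem_Ico.1 hj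
  exact measurable_epochLength_info π this.1 (by omega)

include h

lemma measurable_epochLength (π : Policy) (k : ℕ) :
    Measurable fun ω => epochLength (X ω) (π.waits (X ω)) k := by
  refine measurable_sum_attempts (h.channel.measurable_attempts k) 1 fun j hj => ?_
  exact (h.measurable_roundTrip k j).add ((π.measurable k j).comp h.channel.measurable)

lemma memLp_epochLength (π : Policy) {k : ℕ} (hk : 1 ≤ k) :
    MemLp (fun ω => epochLength (X ω) (π.waits (X ω)) k) 2 μ := by
  obtain ⟨C, hC⟩ := π.bounded
  refine (h.memLp_two_grossDelay C hk).mono (h.measurable_epochLength π k).aestronglyMeasurable ?_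
  filter_upwards [h.ae_isRegular] with ω hreg
  have h1 := hreg.epochLength_ge h.eps_pos (fun k j => π.nonneg k j (X ω)) hk
  have h2 : epochLength (X ω) (π.waits (X ω)) k ≤ grossDelay C (X ω) k :=
    IsRegular.epochLength_le_grossDelay (fun k j => hC k j (X ω)) k
  have h3 : epochLength (X ω) (π.waits (X ω)) k
    = epochLength (X ω) (fun k j => π.wait k j (X ω)) k := rfl
  have := h.eps_pos
  rw [Real.norm_of_nonneg (by linarith), Real.norm_of_nonneg (by linarith)]
  exact h2

lemma memLp_sampleTime (π : Policy) (k : ℕ) :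
    MemLp (fun ω => sampleTime (X ω) (π.waits (X ω)) k) 2 μ :=
  memLp_finsetSum _ fun _ hi => h.memLp_epochLength π (Finset.mem_Ico.1 hi).1

lemma indepFun_past_epoch {k : ℕ} {E E' : Type*} [MeasurableSpace E] [MeasurableSpace E']
    {I : Ω → E} (hI : Measurable[info X (pastSamples k) (Set.Iio k)] I)
    {Φ : Path → E'} (hΦ : Measurable Φ) : IndepFun I (fun ω => Φ (epochPath (X ω) k)) μ := by
  refine h.channel.indepFun_of_info ?_ ?_ hI (hΦ.comp (measurable_epochPath_info k))
  · rw [Set.disjoint_left]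
    rintro x h1 h2
    simp only [pastSamples, epochSamples, Set.mem_ofPred_eq] at h1 h2
    omega
  · simp

/-- The equality case of the optimality bound: the epoch is independent of the past, and its mean
cost is `driftMean` at the root. -/
lemma integral_past_mul_thresholdEpoch {γ : ℝ} (hγ : driftMean μ X γ = 0) {k : ℕ} (hk : 1 ≤ k)
    {I : Ω → ℝ} (hI : Measurable[info X (pastSamples k) (Set.Iio k)] I) :
    ∫ ω, I ω * ((1 / 2) * thresholdEpoch γ (X ω) k ^ 2
      - (γ + ∫ ω, virtualDelay (X ω) 1 ∂μ) * thresholdEpoch γ (X ω) k) ∂μ = 0 := by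
  set θ := γ + ∫ ω, virtualDelay (X ω) 1 ∂μ with hθ
  set Φ : Path → ℝ := fun p => (1 / 2) * thresholdEpoch γ p 1 ^ 2 - θ * thresholdEpoch γ p 1 with hΦ
  have hΦm : Measurable Φ := by
    have := measurable_path_thresholdEpoch γ 1
    fun_prop
  have hind := h.indepFun_past_epoch hI hΦm
  have hmul := hind.integral_mul_eq_mul_integral
    (hI.mono (h.channel.info_le _ _) le_rfl).aestronglyMeasurable
    ((hΦm.comp (measurable_epochPath_info k)).mono (h.channel.info_le _ _)
      le_rfl).aestronglyMeasurable
  have hid := (h.identDistrib_comp_epochPath hΦm hk).integral_eq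
  simp only [hΦ, thresholdEpoch_epochPath] at hid hmul
  rw [h.integral_thresholdEpoch γ, hγ] at hid
  rw [hid, mul_zero] at hmul
  exact hmul

/-- In every epoch, whatever the past, the threshold rule minimizes `E[L² / 2 - θ L]`. -/
lemma integral_past_mul_epochLength_nonneg (π : Policy) {γ : ℝ}
    (hγ : driftMean μ X γ = 0) {k : ℕ} (hk : 1 ≤ k) {I : Ω → ℝ}
    (hI : Measurable[info X (pastSamples k) (Set.Iio k)] I) (hI0 : ∀ ω, 0 ≤ I ω)
    (hI1 : ∀ ω, I ω ≤ 1) :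
    0 ≤ ∫ ω, I ω * ((1 / 2) * epochLength (X ω) (π.waits (X ω)) k ^ 2
      - (γ + ∫ ω, virtualDelay (X ω) 1 ∂μ) * epochLength (X ω) (π.waits (X ω)) k) ∂μ := by
  obtain ⟨C, hC⟩ := π.bounded
  have hC0 : 0 ≤ C := (π.nonneg 0 0 0).trans (hC 0 0 0)
  set v := ∫ ω, virtualDelay (X ω) 1 ∂μ with hv
  have hIm : Measurable I := hI.mono (h.channel.info_le _ _) le_rfl
  have hIb : ∀ᵐ ω ∂μ, ‖I ω‖ ≤ 1 := Eventually.of_forall fun ω => by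
    rw [Real.norm_of_nonneg (hI0 ω)]; exact hI1 ω
  have hIseen : ∀ i, Measurable[info X (seenSamples k i) (Set.Iio k)] I := fun i =>
    hI.mono (info_mono (fun x hx => Or.inl hx) subset_rfl) le_rfl
  -- the quantities known at the decision epochs
  set U : ℕ → Ω → ℝ := fun i ω =>
    I ω * ((if i = 1 then roundTrip (X ω) k 1 else 0) + π.wait k i (X ω)) with hU
  have hUm : ∀ i, 1 ≤ i → Measurable[info X (seenSamples k i) (Set.Iio k)] (U i) := by
    intro i hi
    have h1 : Measurable[info X (seenSamples k i) (Set.Iio k)] fun ω =>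
        if i = 1 then roundTrip (X ω) k 1 else 0 := by
      by_cases hi1 : i = 1
      · simp only [hi1, if_true]
        exact measurable_roundTrip_info (Or.inr ⟨rfl, hi⟩)
      · simp only [hi1, if_false]
        exact measurable_const
    exact (hIseen i).mul (h1.add (π.measurable_wait_info hk hi))
  obtain ⟨iU, eU⟩ := h.integral_sum_mul_tailDelay_sub hk hC0 hUm
    (by
      filter_upwards [h.ae_isRegular] with ω hreg i hi
      have h1 := hreg.roundTrip_nonneg h.eps_pos hk (le_refl 1)
      have h2 := π.nonneg k i (X ω)
      have h3 := hI0 ω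
      simp only [hU]
      split_ifs <;> positivity)
    (by
      filter_upwards [h.ae_isRegular] with ω hreg
      refine Finset.sum_le_sum fun i hi => ?_
      have h1 := hreg.roundTrip_nonneg h.eps_pos hk (le_refl 1)
      have h1' := hreg.roundTrip_nonneg h.eps_pos hk (Finset.mem_Icc.1 hi).1
      have h2 := π.nonneg k i (X ω)
      have h3 := hC k i (X ω)
      have h4 : (if i = 1 then roundTrip (X ω) k 1 else 0) ≤ roundTrip (X ω) k i := by
        split_ifs with h5
        · rw [h5]
        · exact h1'
      have h5 : 0 ≤ (if i = 1 then roundTrip (X ω) k 1 else 0) := by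
        split_ifs
        · exact h1
        · exact le_rfl
      calc U i ω ≤ 1 * ((if i = 1 then roundTrip (X ω) k 1 else 0) + π.wait k i (X ω)) :=
            mul_le_mul_of_nonneg_right (hI1 ω) (by linarith)
        _ ≤ _ := by linarith)
  rw [← hv] at iU eU
  -- the threshold part
  set Z : Ω → ℝ := fun ω => max (actualDelay (X ω) k) γ with hZ
  have hZ1 : Integrable Z μ := (h.memLp_max_actualDelay γ hk).integrable (by norm_num)
  have hIZ : Integrable (fun ω => I ω * Z ω) μ := hZ1.bdd_mul hIm.aestronglyMeasurable hIb
  have hV := h.integrable_virtualDelay hk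
  -- Z is known at the first feedback, while Dᵛ consists of the later samples and the number of
  -- attempts.
  have hindZ : IndepFun (fun ω => I ω * Z ω) (fun ω => virtualDelay (X ω) k - v) μ := by
    refine h.channel.indepFun_of_info (D := seenSamples k 1) (A := Set.Iio k)
      (D' := laterSamples k 1) (A' := {k}) ?_ (by simp) ?_ ?_
    · rw [Set.disjoint_left]
      rintro ⟨a, b⟩ (h1 | h1) h2
      · exact absurd h2.1 h1.ne
      · exact absurd h2.2 (not_lt.2 h1.2)
    · have h1 : Measurable[info X (seenSamples k 1) (Set.Iio k)] fun ω => actualDelay (X ω) k :=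
        measurable_roundTrip_info (Or.inr ⟨rfl, le_rfl⟩)
      exact (hIseen 1).mul (h1.max measurable_const)
    · have h1 : Measurable[info X (laterSamples k 1) {k}] fun ω => virtualDelay (X ω) k :=
        measurable_virtualDelay_info (fun j hj => ⟨rfl, hj⟩) (Set.mem_singleton k)
      exact h1.sub_const v
  have iZ : Integrable (fun ω => I ω * Z ω * (virtualDelay (X ω) k - v)) μ :=
    hindZ.integrable_mul hIZ (hV.sub (integrable_const v))
  have eZ : ∫ ω, I ω * Z ω * (virtualDelay (X ω) k - v) ∂μ = 0 := by
    have h1 := hindZ.integral_mul_eq_mul_integral hIZ.1 (hV.sub (integrable_const v)).1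
    have h2 : ∫ ω, (virtualDelay (X ω) k - v) ∂μ = 0 := by
      rw [integral_sub hV (integrable_const v), (h.identDistrib_virtualDelay hk).integral_eq]
      simp [hv]
    rw [h2, mul_zero] at h1
    exact h1
  have hm := (h.memLp_thresholdEpoch γ hk).mono_exponent (by norm_num : (2 : ℝ≥0∞) ≤ 4)
  have iT : Integrable (fun ω => I ω * ((1 / 2) * thresholdEpoch γ (X ω) k ^ 2
      - (γ + v) * thresholdEpoch γ (X ω) k)) μ :=
    ((hm.integrable_sq.const_mul (1 / 2)).sub
      ((hm.integrable (by norm_num)).const_mul (γ + v))).bdd_mul hIm.aestronglyMeasurable hIb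
  have eT := h.integral_past_mul_thresholdEpoch hγ hk hI
  rw [← hv] at eT
  have hmL := h.memLp_epochLength π hk
  have iL : Integrable (fun ω => I ω * ((1 / 2) * epochLength (X ω) (π.waits (X ω)) k ^ 2
      - (γ + v) * epochLength (X ω) (π.waits (X ω)) k)) μ :=
    ((hmL.integrable_sq.const_mul (1 / 2)).sub
      ((hmL.integrable (by norm_num)).const_mul (γ + v))).bdd_mul hIm.aestronglyMeasurable hIb
  have hle : ∀ᵐ ω ∂μ, (I ω * ((1 / 2) * thresholdEpoch γ (X ω) k ^ 2
        - (γ + v) * thresholdEpoch γ (X ω) k)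
      + ∑ i ∈ Finset.Icc 1 (attempts (X ω) k), U i ω * (tailDelay (X ω) k i - v))
      - I ω * Z ω * (virtualDelay (X ω) k - v)
      ≤ I ω * ((1 / 2) * epochLength (X ω) (π.waits (X ω)) k ^ 2
        - (γ + v) * epochLength (X ω) (π.waits (X ω)) k) := by
    filter_upwards [h.ae_isRegular] with ω hreg
    set L := epochLength (X ω) (π.waits (X ω)) k with hL
    set L' := thresholdEpoch γ (X ω) k with hL'
    set u : ℕ → ℝ := fun i =>
      (if i = 1 then roundTrip (X ω) k 1 else 0) + π.wait k i (X ω) with hu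
    have e1 : ∑ i ∈ Finset.Icc 1 (attempts (X ω) k), U i ω * (tailDelay (X ω) k i - v)
        = I ω * ∑ i ∈ Finset.Icc 1 (attempts (X ω) k), u i * (tailDelay (X ω) k i - v) := by
      rw [Finset.mul_sum]
      exact Finset.sum_congr rfl fun i _ => by simp only [hU, hu]; ring
    -- The round trips after the first sample occur in both lengths and cancel, leaving only
    -- quantities chosen or seen causally.
    have e2 : L - L' = ∑ i ∈ Finset.Icc 1 (attempts (X ω) k), u i - Z ω := by
      have h1 : L = ∑ i ∈ Finset.Icc 1 (attempts (X ω) k), (roundTrip (X ω) k i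
        + π.wait k i (X ω)) := rfl
      rw [h1, hL', thresholdEpoch, hreg.sum_Icc_eq_add hk, hreg.sum_Icc_eq_add hk]
      have h2 : ∑ i ∈ Finset.Icc 2 (attempts (X ω) k), u i
          = ∑ i ∈ Finset.Icc 2 (attempts (X ω) k), π.wait k i (X ω) :=
        Finset.sum_congr rfl fun i hi => by
          have := (Finset.mem_Icc.1 hi).1
          simp [hu, show i ≠ 1 by omega]
      have h3 : virtualDelay (X ω) k = ∑ i ∈ Finset.Icc 2 (attempts (X ω) k),
        roundTrip (X ω) k i := rfl
      rw [h2, Finset.sum_add_distrib, h3]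
      simp only [hu, if_true, hZ]
      ring
    -- each summand of the first-order term is bounded below
    have e3 : ∑ i ∈ Finset.Icc 1 (attempts (X ω) k), u i * (tailDelay (X ω) k i - v)
        - Z ω * (virtualDelay (X ω) k - v)
        ≤ (L' - (γ + v)) * (∑ i ∈ Finset.Icc 1 (attempts (X ω) k), u i - Z ω) := by
      rw [hreg.sum_Icc_eq_add hk, hreg.sum_Icc_eq_add hk u, ← virtualDelay_eq_tailDelay]
      have h1 : L' - (γ + v) = (Z ω - γ) + (virtualDelay (X ω) k - v) := by
        simp only [hL', thresholdEpoch, hZ]; ring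
      have hZγ : 0 ≤ Z ω - γ := sub_nonneg.2 (le_max_right _ _)
      have h2 : 0 ≤ (Z ω - γ) * (u 1 - Z ω) := by
        have hw := π.nonneg k 1 (X ω)
        have h5 : u 1 = actualDelay (X ω) k + π.wait k 1 (X ω) := by
          simp [hu, actualDelay_eq_roundTrip]
        rcases le_total (actualDelay (X ω) k) γ with h3 | h3
        · have h4 : Z ω = γ := max_eq_right h3
          rw [h4]; simp
        · have h4 : Z ω = actualDelay (X ω) k := max_eq_left h3
          exact mul_nonneg hZγ (by rw [h4, h5]; linarith)
      -- Replacing the full virtual delay by the shorter tail lowers the term because the waiting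
      -- times are nonnegative; Z ≥ γ permits dropping the remaining part.
      have h3 : ∑ i ∈ Finset.Icc 2 (attempts (X ω) k), u i * (tailDelay (X ω) k i - v)
          ≤ (L' - (γ + v)) * ∑ i ∈ Finset.Icc 2 (attempts (X ω) k), u i := by
        rw [Finset.mul_sum]
        refine Finset.sum_le_sum fun i hi => ?_
        have hi2 := (Finset.mem_Icc.1 hi).1
        have h4 := hreg.tailDelay_le_virtualDelay h.eps_pos hk (show 1 ≤ i by omega)
        have h5 : 0 ≤ u i := by
          have := π.nonneg k i (X ω)
          simp [hu, show i ≠ 1 by omega, this]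
        rw [mul_comm]
        exact mul_le_mul_of_nonneg_right (by linarith) h5
      have h4 : ∀ s, (L' - (γ + v)) * (u 1 + s - Z ω) = (L' - (γ + v)) * s
          + ((Z ω - γ) * (u 1 - Z ω) + (virtualDelay (X ω) k - v) * (u 1 - Z ω)) := by
        intro s; rw [h1]; ring
      rw [h4]
      linarith
    -- The convex parabola lies above its tangent at L'.
    have e4 : (1 / 2) * L' ^ 2 - (γ + v) * L' + (L' - (γ + v)) * (L - L')
        ≤ (1 / 2) * L ^ 2 - (γ + v) * L := by nlinarith [sq_nonneg (L - L')]
    rw [e1]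
    have e5 : (1 / 2) * L' ^ 2 - (γ + v) * L'
        + ∑ i ∈ Finset.Icc 1 (attempts (X ω) k), u i * (tailDelay (X ω) k i - v)
        - Z ω * (virtualDelay (X ω) k - v) ≤ (1 / 2) * L ^ 2 - (γ + v) * L := by
      rw [e2] at e4; linarith
    have := mul_le_mul_of_nonneg_left e5 (hI0 ω)
    linarith
  have iTU := iT.add iU
  have := integral_mono_ae (iTU.sub iZ) iL hle
  rw [integral_sub' iTU iZ, integral_add' iT iU, eT, eU, eZ] at this
  linarith

end Model

/-! ### Expected age integral of a policy up to time T -/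

namespace Model

variable {Ω : Type*} [MeasurableSpace Ω] {μ : Measure Ω} [IsProbabilityMeasure μ]
  {ε B α : ℝ} {PF PB : Measure ℝ} {X : Ω → Path} (h : Model μ ε B α PF PB X)

/-- Indicator of the event that epoch `k + 1` has begun by time `T`. -/
def begun (π : Policy) (X : Ω → Path) (T : ℝ) (k : ℕ) (ω : Ω) : ℝ :=
  if sampleTime (X ω) (π.waits (X ω)) (k + 1) ≤ T then 1 else 0

lemma begun_nonneg (π : Policy) (T : ℝ) (k : ℕ) (ω : Ω) : 0 ≤ begun π X T k ω := by
  unfold begun; split_ifs <;> norm_num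

lemma begun_le_one (π : Policy) (T : ℝ) (k : ℕ) (ω : Ω) : begun π X T k ω ≤ 1 := by
  unfold begun; split_ifs <;> norm_num

lemma sum_begun_mul (π : Policy) (T : ℝ) (n : ℕ) (ω : Ω) (a : ℕ → ℝ) :
    ∑ k ∈ Finset.range n, begun π X T k ω * a k
      = ∑ k ∈ Finset.range n,
        if sampleTime (X ω) (π.waits (X ω)) (k + 1) ≤ T then a k else 0 :=
  Finset.sum_congr rfl fun k _ => by simp [begun]

/-- The start of an epoch is decided by the preceding epochs alone, so this indicator is an
admissible past weight. -/
lemma measurable_begun_info (π : Policy) (T : ℝ) (k : ℕ) :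
    Measurable[info X (pastSamples (k + 1)) (Set.Iio (k + 1))] (begun π X T k) :=
  Measurable.ite (measurableSet_le (measurable_sampleTime_info π le_rfl) measurable_const)
    measurable_const measurable_const

include h

lemma measurable_begun (π : Policy) (T : ℝ) (k : ℕ) : Measurable (begun π X T k) :=
  (measurable_begun_info π T k).mono (h.channel.info_le _ _) le_rfl

lemma ae_norm_begun_le (π : Policy) (T : ℝ) (k : ℕ) : ∀ᵐ ω ∂μ, ‖begun π X T k ω‖ ≤ 1 :=
  Eventually.of_forall fun ω => by
    rw [Real.norm_of_nonneg (begun_nonneg π T k ω)]; exact begun_le_one π T k ω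

lemma integrable_begun_mul (π : Policy) (T : ℝ) (k : ℕ) {f : Ω → ℝ} (hf : Integrable f μ) :
    Integrable (fun ω => begun π X T k ω * f ω) μ :=
  hf.bdd_mul (h.measurable_begun π T k).aestronglyMeasurable (h.ae_norm_begun_le π T k)

lemma integral_overshoot (C : ℝ) {s : ℝ} (n : ℕ) :
    Integrable (fun ω => overshoot C s n (X ω)) μ ∧
    ∫ ω, overshoot C s n (X ω) ∂μ = s + n * ((∫ ω, grossDelay C (X ω) 1 ^ 4 ∂μ) / s) := by
  have hint : ∀ k, Integrable (fun ω => grossDelay C (X ω) (k + 1) ^ 4) μ := fun k => by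
    have := (h.memLp_grossDelay C (show 1 ≤ k + 1 by omega)).integrable_norm_pow (by norm_num)
    simpa [abs_pow, (show Even 4 by decide).pow_abs] using this
  have hΦ : Measurable fun p : Path => grossDelay C p 1 ^ 4 :=
    (measurable_sum_attempts (measurable_path_attempts 1) 1 fun j _ =>
      (measurable_path_roundTrip 1 j).add_const C).pow_const 4
  have he : ∀ (p : Path) k, grossDelay C (epochPath p k) 1 = grossDelay C p k := fun p k =>
    Finset.sum_congr rfl fun j hj => by rw [roundTrip_epochPath p k 1 (Finset.mem_Icc.1 hj).1]
  have hid : ∀ k, ∫ ω, grossDelay C (X ω) (k + 1) ^ 4 ∂μ = ∫ ω, grossDelay C (X ω) 1 ^ 4 ∂μ :=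
    fun k => by
      have := (h.identDistrib_comp_epochPath hΦ (show 1 ≤ k + 1 by omega)).integral_eq
      simpa only [he] using this
  have hsum : Integrable (fun ω => ∑ k ∈ Finset.range n, grossDelay C (X ω) (k + 1) ^ 4 / s) μ :=
    integrable_finsetSum _ fun k _ => (hint k).div_const s
  refine ⟨(integrable_const s).add hsum, ?_⟩
  unfold overshoot
  rw [integral_add (integrable_const s) hsum, integral_finsetSum _ fun k _ => (hint k).div_const s]
  simp_rw [integral_div, hid]
  simp

lemma integrable_cycleArea (π : Policy) (k : ℕ) :
    Integrable (fun ω => cycleArea (X ω) (π.waits (X ω)) (k + 1)) μ := by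
  have h1 := (h.memLp_epochLength π (show 1 ≤ k + 1 by omega)).integrable_sq
  have h2 := (h.memLp_sampleTime π (k + 1)).sub (h.memLp_sampleTime π k)
  have h3 := (h.memLp_forward (show 1 ≤ k + 1 by omega) (le_refl 1)).mono_exponent
    (by norm_num : (2 : ℝ≥0∞) ≤ 4)
  exact (h1.div_const 2).add (h3.integrable_mul h2)

/-- The forward delay of the current epoch is independent of the past factor multiplying it, so its
mean comes out. The term θL is subtracted to form the Lagrangian cost and added back. -/
lemma integral_begun_mul_cycleArea (π : Policy) (T θ : ℝ) (k : ℕ) :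
    ∫ ω, begun π X T k ω * cycleArea (X ω) (π.waits (X ω)) (k + 1) ∂μ
      = ∫ ω, begun π X T k ω * ((1 / 2) * epochLength (X ω) (π.waits (X ω)) (k + 1) ^ 2
          - θ * epochLength (X ω) (π.waits (X ω)) (k + 1)) ∂μ
        + θ * ∫ ω, begun π X T k ω * epochLength (X ω) (π.waits (X ω)) (k + 1) ∂μ
        + (∫ ω, forward (X ω) 1 1 ∂μ) * ∫ ω, begun π X T k ω *
          (sampleTime (X ω) (π.waits (X ω)) (k + 1) - sampleTime (X ω) (π.waits (X ω)) k) ∂μ := by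
  have hk : 1 ≤ k + 1 := by omega
  have hm := h.memLp_epochLength π hk
  have i1 := h.integrable_begun_mul π T k (hm.integrable (by norm_num))
  have i2 : Integrable (fun ω => begun π X T k ω *
      ((1 / 2) * epochLength (X ω) (π.waits (X ω)) (k + 1) ^ 2
          - θ * epochLength (X ω) (π.waits (X ω)) (k + 1))) μ :=
    h.integrable_begun_mul π T k ((hm.integrable_sq.const_mul (1 / 2)).sub
      ((hm.integrable (by norm_num)).const_mul θ))
  have h2 := (h.memLp_sampleTime π (k + 1)).sub (h.memLp_sampleTime π k)
  have i3 : Integrable (fun ω => begun π X T k ω *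
      (sampleTime (X ω) (π.waits (X ω)) (k + 1) - sampleTime (X ω) (π.waits (X ω)) k)) μ :=
    h.integrable_begun_mul π T k (h2.integrable (by norm_num))
  have hind : IndepFun (fun ω => begun π X T k ω *
      (sampleTime (X ω) (π.waits (X ω)) (k + 1) - sampleTime (X ω) (π.waits (X ω)) k))
      (fun ω => forward (X ω) (k + 1) 1) μ := by
    have hI : Measurable[info X (pastSamples (k + 1)) (Set.Iio (k + 1))] fun ω =>
        begun π X T k ω * (sampleTime (X ω) (π.waits (X ω)) (k + 1)
          - sampleTime (X ω) (π.waits (X ω)) k) :=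
      (measurable_begun_info π T k).mul ((measurable_sampleTime_info π le_rfl).sub
        (measurable_sampleTime_info π (Nat.le_succ k)))
    have := h.indepFun_past_epoch hI (measurable_path_forward 1 1)
    simpa only [forward_epochPath _ _ _ (le_refl 1)] using this
  have hF := h.integrable_forward hk
  have i4 := hind.integrable_mul i3 hF
  have e4 := hind.integral_mul_eq_mul_integral i3.1 hF.1
  rw [(h.identDistrib_forward hk (le_refl 1)).integral_eq] at e4
  rw [mul_comm (∫ ω, forward (X ω) 1 1 ∂μ), ← e4, ← integral_const_mul, ← integral_add i2 (i1.const_mul θ), ← integral_add _ i4]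
  · refine integral_congr_ae (Eventually.of_forall fun ω => ?_)
    simp only [cycleArea, Pi.mul_apply, Nat.add_sub_cancel]
    ring
  · exact i2.add (i1.const_mul θ)

/-- Bounds of the expected age integral up to time `T`. -/
lemma expected_age_bounds (π : Policy) {C : ℝ} (hC : ∀ k j p, π.wait k j p ≤ C) {θ : ℝ}
    (hθ : 0 ≤ θ) {s T : ℝ} (hs : 0 < s) (hT : 0 ≤ T) {n : ℕ} (hn : T < 2 * ε * n) :
    let EF := ∫ ω, forward (X ω) 1 1 ∂μ
    let G := ∫ ω, overshoot C s n (X ω) ∂μ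
    let age := ∫⁻ ω, ∫⁻ t in Set.Icc 0 T,
        ENNReal.ofReal (age (X ω) (fun k j => π.wait k j (X ω)) t) ∂volume ∂μ
    let cost : ℕ → ℝ := fun k => ∫ ω, begun π X T k ω *
      ((1 / 2) * epochLength (X ω) (π.waits (X ω)) (k + 1) ^ 2
          - θ * epochLength (X ω) (π.waits (X ω)) (k + 1)) ∂μ
    ((∀ k, 0 ≤ cost k) → ENNReal.ofReal ((θ + EF) * T - EF * (1 + G) - 2 * G) ≤ age) ∧
    ((∀ k, cost k = 0) → age ≤ ENNReal.ofReal ((θ + EF) * T + θ * (1 + G))) := by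
  intro EF G age cost
  have hEF : 0 ≤ EF := h.forwardMean_nonneg
  obtain ⟨iG, -⟩ := h.integral_overshoot C (s := s) n
  have hb := h.ae_isRegular.mono fun ω (hreg : IsRegular ε (X ω)) =>
    hreg.age_bounds (W := π.waits (X ω)) h.eps_pos (fun k j => π.nonneg k j (X ω))
      (fun k j => hC k j (X ω)) hs hT hn
  simp only [← sum_begun_mul] at hb
  set S1 : Ω → ℝ := fun ω => ∑ k ∈ Finset.range n, begun π X T k ω *
    cycleArea (X ω) (π.waits (X ω)) (k + 1) with hS1
  set S2 : Ω → ℝ := fun ω => ∑ k ∈ Finset.range n, begun π X T k ω *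
    epochLength (X ω) (π.waits (X ω)) (k + 1) with hS2
  set S3 : Ω → ℝ := fun ω => ∑ k ∈ Finset.range n, begun π X T k ω *
    (sampleTime (X ω) (π.waits (X ω)) (k + 1) - sampleTime (X ω) (π.waits (X ω)) k) with hS3
  have j1 := fun k => h.integrable_begun_mul π T k (h.integrable_cycleArea π k)
  have j2 := fun k => h.integrable_begun_mul π T k
    ((h.memLp_epochLength π (show 1 ≤ k + 1 by omega)).integrable (by norm_num))
  have j3 : ∀ k, Integrable (fun ω => begun π X T k ω *
      (sampleTime (X ω) (π.waits (X ω)) (k + 1) - sampleTime (X ω) (π.waits (X ω)) k)) μ :=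
    fun k => h.integrable_begun_mul π T k
      (((h.memLp_sampleTime π (k + 1)).sub (h.memLp_sampleTime π k)).integrable (by norm_num))
  have i1 : Integrable S1 μ := integrable_finsetSum _ fun k _ => j1 k
  have i2 : Integrable S2 μ := integrable_finsetSum _ fun k _ => j2 k
  have i3 : Integrable S3 μ := integrable_finsetSum _ fun k _ => j3 k
  have e1 : ∫ ω, S1 ω ∂μ = ∑ k ∈ Finset.range n, cost k + θ * ∫ ω, S2 ω ∂μ
      + EF * ∫ ω, S3 ω ∂μ := by
    simp only [hS1, hS2, hS3]
    rw [integral_finsetSum _ fun k _ => j1 k, integral_finsetSum _ fun k _ => j2 k,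
      integral_finsetSum _ fun k _ => j3 k, Finset.mul_sum, Finset.mul_sum,
      ← Finset.sum_add_distrib, ← Finset.sum_add_distrib]
    exact Finset.sum_congr rfl fun k _ => h.integral_begun_mul_cycleArea π T θ k
  have cT : ∫ _, T ∂μ = T := by simp
  have b2 : T ≤ ∫ ω, S2 ω ∂μ := by
    rw [← cT]
    refine integral_mono_ae (integrable_const T) i2 ?_
    filter_upwards [hb] with ω hω using hω.2.2.1
  have b2' : ∫ ω, S2 ω ∂μ ≤ T + 1 + G := by
    have : ∫ ω, (T + 1 + overshoot C s n (X ω)) ∂μ = T + 1 + G := by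
      rw [integral_add (integrable_const _) iG]; simp [G]
    rw [← this]
    refine integral_mono_ae i2 ((integrable_const _).add iG) ?_
    filter_upwards [hb] with ω hω using hω.2.2.2.1
  have b3 : T - 1 - G ≤ ∫ ω, S3 ω ∂μ := by
    have : ∫ ω, (T - 1 - overshoot C s n (X ω)) ∂μ = T - 1 - G := by
      rw [integral_sub (integrable_const _) iG]; simp [G]
    rw [← this]
    refine integral_mono_ae ((integrable_const _).sub iG) i3 ?_
    filter_upwards [hb] with ω hω using hω.2.2.2.2.1
  have b3' : ∫ ω, S3 ω ∂μ ≤ T := by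
    rw [← cT]
    refine integral_mono_ae i3 (integrable_const T) ?_
    filter_upwards [hb] with ω hω using hω.2.2.2.2.2
  have m2 := mul_le_mul_of_nonneg_left b2 hθ
  have m2' := mul_le_mul_of_nonneg_left b2' hθ
  have m3 := mul_le_mul_of_nonneg_left b3 hEF
  have m3' := mul_le_mul_of_nonneg_left b3' hEF
  constructor
  · intro hcost
    have hsum : 0 ≤ ∑ k ∈ Finset.range n, cost k := Finset.sum_nonneg fun k _ => hcost k
    have i4 : Integrable (fun ω => S1 ω - 2 * overshoot C s n (X ω)) μ := i1.sub (iG.const_mul 2)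
    have h1 : (θ + EF) * T - EF * (1 + G) - 2 * G
        ≤ ∫ ω, (S1 ω - 2 * overshoot C s n (X ω)) ∂μ := by
      rw [integral_sub i1 (iG.const_mul 2), integral_const_mul, e1]
      linarith
    refine (ENNReal.ofReal_le_ofReal h1).trans ?_
    -- The integrand may be negative, so only an inequality with the integral of its positive part
    -- is available.
    have h2 : ENNReal.ofReal (∫ ω, (S1 ω - 2 * overshoot C s n (X ω)) ∂μ)
        ≤ ∫⁻ ω, ENNReal.ofReal (S1 ω - 2 * overshoot C s n (X ω)) ∂μ := by
      rw [integral_eq_lintegral_pos_part_sub_lintegral_neg_part i4]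
      exact (ENNReal.ofReal_le_ofReal (sub_le_self _ ENNReal.toReal_nonneg)).trans
        ENNReal.ofReal_toReal_le
    refine h2.trans (lintegral_mono_ae ?_)
    filter_upwards [hb] with ω hω using hω.1
  · intro hcost
    have hsum : ∑ k ∈ Finset.range n, cost k = 0 := Finset.sum_eq_zero fun k _ => hcost k
    have h1 : ∫ ω, S1 ω ∂μ ≤ (θ + EF) * T + θ * (1 + G) := by
      rw [e1, hsum]; linarith
    refine le_trans ?_ (ENNReal.ofReal_le_ofReal h1)
    rw [ofReal_integral_eq_lintegral_ofReal i1]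
    · refine lintegral_mono_ae ?_
      filter_upwards [hb] with ω hω using hω.2.1
    · filter_upwards [h.ae_isRegular] with ω hreg
      refine Finset.sum_nonneg fun k _ => mul_nonneg (begun_nonneg π T k ω) ?_
      have hW : ∀ k j, 0 ≤ π.waits (X ω) k j := fun k j => π.nonneg k j (X ω)
      have h2 := hreg.sampleTime_mono h.eps_pos hW (Nat.le_succ k)
      have h3 := h.eps_pos.le.trans (hreg.forward_ge (k + 1) 1 (by omega) le_rfl)
      rw [cycleArea, Nat.add_sub_cancel]
      have := mul_nonneg h3 (sub_nonneg.2 h2)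
      positivity

end Model

lemma tendsto_ofReal_sub_div_sqrt (β κ : ℝ) :
    Tendsto (fun T : ℝ => ENNReal.ofReal (β * T + κ * √T) / ENNReal.ofReal T) atTop
      (𝓝 (ENNReal.ofReal β)) := by
  have h1 : Tendsto (fun T : ℝ => β + κ / √T) atTop (𝓝 (β + 0)) :=
    tendsto_const_nhds.add (tendsto_const_nhds.div_atTop Real.tendsto_sqrt_atTop)
  rw [add_zero] at h1
  refine (ENNReal.tendsto_ofReal h1).congr' ?_
  filter_upwards [eventually_gt_atTop 0] with T hT
  rw [← ENNReal.ofReal_div_of_pos hT]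
  congr 1
  have h2 : √T * √T = T := Real.mul_self_sqrt hT.le
  have h3 : √T ≠ 0 := (Real.sqrt_pos.2 hT).ne'
  field_simp
  linear_combination (-κ) * h2

/-- The policy that waits until the time since sampling reaches `γ`. -/
def thresholdPolicy (γ : ℝ) (hγ : 0 ≤ γ) : Policy where
  -- The inner maximum with 0 keeps the waiting time below γ also on irregular paths with negative
  -- delays; on regular paths it changes nothing.
  wait k j p := if j = 1 then max (γ - max (actualDelay p k) 0) 0 else 0
  measurable k j := by
    by_cases hj : j = 1
    · simp only [hj, if_true]
      exact (measurable_const.sub ((measurable_path_actualDelay k).max measurable_const)).max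
        measurable_const
    · simp only [hj, if_false]
      exact measurable_const
  nonneg k j p := by
    split_ifs
    · exact le_max_right _ _
    · exact le_rfl
  bounded := ⟨γ, fun k j p => by
    split_ifs
    · exact max_le (by linarith [le_max_right (actualDelay p k) 0]) hγ
    · exact hγ⟩
  causal k j _ _ p q _ hpq := by
    split_ifs with hj
    · have := hpq 1 le_rfl (by omega)
      simp only [actualDelay, forward, backward, this]
    · rfl

/-! ### Value of the optimal age -/

namespace Model

variable {Ω : Type*} [MeasurableSpace Ω] {μ : Measure Ω} [IsProbabilityMeasure μ]
  {ε B α : ℝ} {PF PB : Measure ℝ} {X : Ω → Path} (h : Model μ ε B α PF PB X)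

include h

/-- Each epoch lasts at least 2ε, so O(T) epochs cover [0, T]; with s = √T both parts of the mean
overshoot are O(√T). -/
lemma exists_overshoot_le (C : ℝ) : ∃ κ, 0 ≤ κ ∧ ∀ T, 1 ≤ T → ∃ (s : ℝ) (n : ℕ), 0 < s ∧
    T < 2 * ε * n ∧ ∫ ω, overshoot C s n (X ω) ∂μ ≤ κ * √T := by
  have hε := h.eps_pos
  set K := ∫ ω, grossDelay C (X ω) 1 ^ 4 ∂μ with hK
  have hK0 : 0 ≤ K := integral_nonneg fun ω => by positivity
  refine ⟨1 + (1 / (2 * ε) + 2) * K, by positivity, fun T hT => ?_⟩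
  have hT0 : 0 < T := by linarith
  have hs : 0 < √T := Real.sqrt_pos.2 hT0
  have hn1 := Nat.le_ceil (T / (2 * ε))
  have hn2 := (Nat.ceil_lt_add_one (show 0 ≤ T / (2 * ε) by positivity)).le
  refine ⟨√T, ⌈T / (2 * ε)⌉₊ + 1, hs, ?_, ?_⟩
  · push_cast
    rw [div_le_iff₀ (by positivity)] at hn1
    nlinarith
  · rw [(h.integral_overshoot C _).2, ← hK]
    have h2 : √T * √T = T := Real.mul_self_sqrt hT0.le
    have h1 : ((⌈T / (2 * ε)⌉₊ + 1 : ℕ) : ℝ) ≤ (1 / (2 * ε) + 2) * T := by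
      push_cast
      have : (1 / (2 * ε) + 2) * T = T / (2 * ε) + 2 * T := by field_simp
      linarith
    have h3 : (1 / (2 * ε) + 2) * T * (K / √T) = (1 / (2 * ε) + 2) * K * √T := by
      field_simp
      rw [Real.sq_sqrt hT0.le, mul_comm]
    have h4 := mul_le_mul_of_nonneg_right h1 (show 0 ≤ K / √T by positivity)
    rw [h3] at h4
    linarith

/-- All epoch costs of the policy are nonnegative, so only the linear terms and an O(√T) error
remain, and the error vanishes after division by T. -/
lemma le_averageAge (π : Policy) {γ : ℝ} (hγ0 : 0 ≤ γ) (hγ : driftMean μ X γ = 0) :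
    ENNReal.ofReal (γ + ∫ ω, virtualDelay (X ω) 1 ∂μ + ∫ ω, forward (X ω) 1 1 ∂μ)
      ≤ π.averageAge μ X := by
  obtain ⟨C, hC⟩ := π.bounded
  obtain ⟨κ, hκ, hover⟩ := h.exists_overshoot_le C
  set v := ∫ ω, virtualDelay (X ω) 1 ∂μ with hv
  set EF := ∫ ω, forward (X ω) 1 1 ∂μ with hEF
  have hEF0 : 0 ≤ EF := h.forwardMean_nonneg
  have hθ : 0 ≤ γ + v := add_nonneg hγ0 h.virtualMean_nonneg
  rw [← (tendsto_ofReal_sub_div_sqrt (γ + v + EF) (-(EF * (1 + κ) + 2 * κ))).limsup_eq]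
  refine limsup_le_limsup ?_
  filter_upwards [eventually_ge_atTop 1] with T hT
  refine ENNReal.div_le_div_right ?_ _
  obtain ⟨s, n, hs, hn, hG⟩ := hover T hT
  refine le_trans (ENNReal.ofReal_le_ofReal ?_)
    ((h.expected_age_bounds π hC hθ hs (by linarith) hn).1 fun k =>
      h.integral_past_mul_epochLength_nonneg π hγ (by omega) (measurable_begun_info π T k)
        (begun_nonneg π T k) (begun_le_one π T k))
  have h1 : 1 ≤ √T := by rwa [Real.one_le_sqrt]
  have h2 := mul_le_mul_of_nonneg_left (add_le_add h1 hG) hEF0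
  linarith

/-- All epoch costs vanish exactly for this policy, so the bound of `le_averageAge` is attained. -/
lemma averageAge_thresholdPolicy_le {γ : ℝ} (hγ0 : 0 ≤ γ) (hγ : driftMean μ X γ = 0) :
    (thresholdPolicy γ hγ0).averageAge μ X
      ≤ ENNReal.ofReal (γ + ∫ ω, virtualDelay (X ω) 1 ∂μ + ∫ ω, forward (X ω) 1 1 ∂μ) := by
  set π := thresholdPolicy γ hγ0 with hπ
  obtain ⟨C, hC⟩ := π.bounded
  obtain ⟨κ, hκ, hover⟩ := h.exists_overshoot_le C
  set v := ∫ ω, virtualDelay (X ω) 1 ∂μ with hv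
  set EF := ∫ ω, forward (X ω) 1 1 ∂μ with hEF
  have hθ : 0 ≤ γ + v := add_nonneg hγ0 h.virtualMean_nonneg
  rw [← (tendsto_ofReal_sub_div_sqrt (γ + v + EF) ((γ + v) * (1 + κ))).limsup_eq]
  refine limsup_le_limsup ?_
  filter_upwards [eventually_ge_atTop 1] with T hT
  refine ENNReal.div_le_div_right ?_ _
  obtain ⟨s, n, hs, hn, hG⟩ := hover T hT
  refine le_trans ((h.expected_age_bounds π hC hθ hs (by linarith) hn).2 fun k => ?_)
    (ENNReal.ofReal_le_ofReal ?_)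
  · rw [← h.integral_past_mul_thresholdEpoch hγ (show 1 ≤ k + 1 by omega)
      (measurable_begun_info π T k)]
    refine integral_congr_ae ?_
    filter_upwards [h.ae_isRegular] with ω hreg
    have hA : 0 ≤ actualDelay (X ω) (k + 1) := by
      rw [actualDelay_eq_roundTrip]
      exact hreg.roundTrip_nonneg h.eps_pos (by omega) le_rfl
    have : epochLength (X ω) (π.waits (X ω)) (k + 1) = thresholdEpoch γ (X ω) (k + 1) := by
      refine hreg.epochLength_threshold (by omega) ?_ fun j hj => ?_
      · simp [hπ, Policy.waits, thresholdPolicy, max_eq_left hA]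
      · simp [hπ, Policy.waits, thresholdPolicy, show j ≠ 1 by omega]
    simp only [this, hv]
  · have h1 : 1 ≤ √T := by rwa [Real.one_le_sqrt]
    have h2 := mul_le_mul_of_nonneg_left (add_le_add h1 hG) hθ
    linarith

lemma optimalAge_eq {γ : ℝ} (hγ0 : 0 ≤ γ) (hγ : driftMean μ X γ = 0) :
    optimalAge μ X
      = ENNReal.ofReal (γ + ∫ ω, virtualDelay (X ω) 1 ∂μ + ∫ ω, forward (X ω) 1 1 ∂μ) :=
  le_antisymm ((iInf_le _ _).trans (h.averageAge_thresholdPolicy_le hγ0 hγ))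
    (le_iInf fun π => h.le_averageAge π hγ0 hγ)

lemma toReal_optimalAge {γ : ℝ} (hγ0 : 0 ≤ γ) (hγ : driftMean μ X γ = 0) :
    (optimalAge μ X).toReal
      = γ + ∫ ω, virtualDelay (X ω) 1 ∂μ + ∫ ω, forward (X ω) 1 1 ∂μ := by
  rw [h.optimalAge_eq hγ0 hγ, ENNReal.toReal_ofReal]
  have h1 := h.virtualMean_nonneg
  have h2 := h.forwardMean_nonneg
  linarith

lemma optimalThreshold_eq {γ : ℝ} (hγ0 : 0 ≤ γ) (hγ : driftMean μ X γ = 0) :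
    optimalThreshold μ X = γ := by
  rw [optimalThreshold, h.toReal_optimalAge hγ0 hγ]
  ring

end Model

/-! ### Almost sure convergence of the thresholds -/

section Martingale

variable {Ω : Type*} [mΩ : MeasurableSpace Ω] {μ : Measure Ω} [IsProbabilityMeasure μ]

/-- A centred function of independent arguments, centred given its first argument. -/
lemma integral_eq_zero_of_indepFun {E F : Type*} [MeasurableSpace E] [MeasurableSpace F]
    {Q : Ω → E} {P : Ω → F} (hQ : Measurable Q) (hP : Measurable P) (hind : IndepFun Q P μ)
    {φ : E × F → ℝ} (hφ : Measurable φ) (hint : Integrable (fun ω => φ (Q ω, P ω)) μ)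
    (hzero : ∀ q, ∫ ω, φ (q, P ω) ∂μ = 0) : ∫ ω, φ (Q ω, P ω) ∂μ = 0 := by
  have hlaw := (indepFun_iff_map_prod_eq_prod_map_map hQ.aemeasurable hP.aemeasurable).1 hind
  have hQP : Measurable fun ω => (Q ω, P ω) := hQ.prodMk hP
  have hint' : Integrable φ ((μ.map Q).prod (μ.map P)) := by
    rw [← hlaw]
    exact (integrable_map_measure hφ.aestronglyMeasurable hQP.aemeasurable).2 hint
  have : ∫ ω, φ (Q ω, P ω) ∂μ = ∫ z, φ z ∂((μ.map Q).prod (μ.map P)) := by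
    rw [← hlaw, integral_map hQP.aemeasurable hφ.aestronglyMeasurable]
  rw [this, integral_prod _ hint']
  refine integral_eq_zero_of_ae (Eventually.of_forall fun q => ?_)
  simp only [Pi.zero_apply]
  have hq : Measurable fun y => φ (q, y) := hφ.comp measurable_prodMk_left
  rw [integral_map hP.aemeasurable hq.aestronglyMeasurable]
  exact hzero q

/-- Series of orthogonal martingale increments with summable variances converge. -/
lemma ae_cauchySeq_of_orthogonal_increments {ℱ : Filtration ℕ mΩ} {d : ℕ → Ω → ℝ} {a : ℕ → ℝ}
    (hd : ∀ k, Measurable[ℱ (k + 1)] (d k)) (hd2 : ∀ k, MemLp (d k) 2 μ)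
    (horth : ∀ k (u : Ω → ℝ), Measurable[ℱ k] u → MemLp u 2 μ → ∫ ω, u ω * d k ω ∂μ = 0)
    (hvar : ∀ k, ∫ ω, d k ω ^ 2 ∂μ ≤ a k) (ha : Summable a) :
    ∀ᵐ ω ∂μ, CauchySeq fun n => ∑ k ∈ Finset.range n, d k ω := by
  set N : ℕ → Ω → ℝ := fun n ω => ∑ k ∈ Finset.range n, d k ω with hN
  have hNm : ∀ n, Measurable[ℱ n] (N n) := fun n =>
    Finset.measurable_fun_sum _ fun k hk =>
      (hd k).mono (ℱ.mono (Finset.mem_range.1 hk)) le_rfl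
  have hN2 : ∀ n, MemLp (N n) 2 μ := fun n => memLp_finsetSum _ fun k _ => hd2 k
  have hNi : ∀ n, Integrable (N n) μ := fun n => (hN2 n).integrable (by norm_num)
  have hsucc : ∀ n ω, N (n + 1) ω = N n ω + d n ω := fun n ω => Finset.sum_range_succ _ _
  have hmart : Martingale N ℱ μ := by
    refine martingale_of_setIntegral_eq_succ (fun n => (hNm n).stronglyMeasurable) hNi ?_
    intro n s hs
    have hs' := ℱ.le n s hs
    -- Orthogonality tested against indicators of past events is the martingale property.
    have h1 := horth n (s.indicator 1) (measurable_const.indicator hs)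
      ((memLp_const (1 : ℝ)).indicator hs')
    have h2 : ∫ ω in s, d n ω ∂μ = 0 := by
      rw [← integral_indicator hs', ← h1]
      refine integral_congr_ae (Eventually.of_forall fun ω => ?_)
      by_cases hω : ω ∈ s <;> simp [hω]
    simp_rw [hsucc]
    rw [integral_add (hNi n).integrableOn ((hd2 n).integrable (by norm_num)).integrableOn, h2,
      add_zero]
  have ha0 : ∀ k, 0 ≤ a k := fun k => (integral_nonneg fun ω => sq_nonneg _).trans (hvar k)
  have hsq : ∀ n, ∫ ω, N n ω ^ 2 ∂μ ≤ ∑ k ∈ Finset.range n, a k := by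
    intro n
    induction n with
    | zero => simp [hN]
    | succ n ih =>
      have e : ∀ ω, N (n + 1) ω ^ 2 = N n ω ^ 2 + 2 * (N n ω * d n ω) + d n ω ^ 2 := fun ω => by
        rw [hsucc]; ring
      have i1 : Integrable (fun ω => N n ω * d n ω) μ := (hN2 n).integrable_mul (hd2 n)
      have i2 : Integrable (fun ω => N n ω ^ 2 + 2 * (N n ω * d n ω)) μ :=
        (hN2 n).integrable_sq.add (i1.const_mul 2)
      simp_rw [e]
      rw [integral_add i2 (hd2 n).integrable_sq, integral_add (hN2 n).integrable_sq
        (i1.const_mul 2), integral_const_mul, horth n (N n) (hNm n) (hN2 n), Finset.sum_range_succ]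
      have := hvar n
      linarith
  set R : NNReal := (1 + ∑' k, a k).toNNReal with hR
  have hbdd : ∀ n, eLpNorm (N n) 1 μ ≤ R := by
    intro n
    rw [eLpNorm_one_eq_lintegral_enorm, ← ofReal_integral_norm_eq_lintegral_enorm (hNi n)]
    refine ENNReal.ofReal_le_ofReal ?_
    -- The convergence theorem asks for an L¹ bound, which follows from the second moments via |x| ≤
    -- 1 + x².
    have h1 : ∫ ω, ‖N n ω‖ ∂μ ≤ ∫ ω, (1 + N n ω ^ 2) ∂μ := by
      refine integral_mono (hNi n).norm ((integrable_const _).add (hN2 n).integrable_sq)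
        fun ω => ?_
      simp only [Real.norm_eq_abs]
      nlinarith [sq_abs (N n ω), sq_nonneg (|N n ω| - 1)]
    rw [integral_add (integrable_const _) (hN2 n).integrable_sq] at h1
    simp only [integral_const, probReal_univ, smul_eq_mul, mul_one] at h1
    have h2 := ha.sum_le_tsum (Finset.range n) fun k _ => ha0 k
    linarith [hsq n]
  filter_upwards [hmart.submartingale.exists_ae_tendsto_of_bdd hbdd] with ω hω
  obtain ⟨c, hc⟩ := hω
  exact hc.cauchySeq

end Martingale

/-! ### Dependence of the thresholds on the channel -/

section ThresholdMeasurability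

lemma measurable_runningMean {Ω : Type*} {m : MeasurableSpace Ω} {V : ℕ → Ω → ℝ} {k : ℕ}
    (hV : ∀ i, 1 ≤ i → i ≤ k → Measurable (V i)) :
    Measurable fun ω => runningMean (fun i => V i ω) k := by
  induction k with
  | zero => exact measurable_const
  | succ k ih =>
    have h1 := ih fun i h1 h2 => hV i h1 (by omega)
    have h2 := hV (k + 1) (by omega) le_rfl
    exact h1.add (measurable_const.mul (h2.sub h1))

lemma measurable_drift {Ω : Type*} {m : MeasurableSpace Ω} {f g u : Ω → ℝ} (hf : Measurable f)
    (hg : Measurable g) (hu : Measurable u) : Measurable fun ω => drift (f ω) (g ω) (u ω) :=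
  (measurable_const.mul ((hg.max hf).pow_const 2)).sub (hf.mul ((hg.max hf).add hu))

lemma measurable_threshold (b : Bounds) (lag : ℕ) {Ω : Type*} {m : MeasurableSpace Ω}
    {Y : Ω → Path} {c : Ω → ℝ} (hc : Measurable c) {k : ℕ}
    (hA : ∀ i, 1 ≤ i → i ≤ k → Measurable fun ω => actualDelay (Y ω) i)
    (hV : ∀ i, 1 ≤ i → i ≤ k → Measurable fun ω => usedVirtualDelay lag (Y ω) i) :
    Measurable fun ω => threshold b lag (c ω) (Y ω) k := by
  induction k with
  | zero => exact hc
  | succ k ih =>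
    have h1 := ih (fun i h1 h2 => hA i h1 (by omega)) fun i h1 h2 => hV i h1 (by omega)
    have h2 := measurable_drift h1 (hA (k + 1) (by omega) le_rfl) (hV (k + 1) (by omega) le_rfl)
    have h3 := measurable_runningMean hV
    have h4 := measurable_runningMean (V := fun i ω => usedVirtualDelay lag (Y ω) i ^ 2)
      fun i h1 h2 => (hV i h1 h2).pow_const 2
    exact measurable_const.min (measurable_const.max (h1.add (measurable_const.mul
      (h2.add ((measurable_const.mul h4).sub (h3.pow_const 2))))))

end ThresholdMeasurability

lemma usedVirtualDelay_add_two {lag : ℕ} (hlag : lag ≤ 1) (p : Path) (k : ℕ) :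
    usedVirtualDelay lag p (k + 2) = virtualDelay p (k + 2 - lag) := by
  simp [usedVirtualDelay, show ¬ k + 2 ≤ lag by omega]

lemma threshold_succ_mem {b : Bounds} (hb : b.gammaLb ≤ b.gammaUb) (lag : ℕ) (c : ℝ) (p : Path)
    (k : ℕ) : b.gammaLb ≤ threshold b lag c p (k + 1) ∧ threshold b lag c p (k + 1) ≤ b.gammaUb :=
  ⟨le_min hb (le_max_left _ _), min_le_left _ _⟩

/-- Samples whose delays enter the thresholds up to step `k`. -/
def usedSamples (lag k : ℕ) : Set (ℕ × ℕ) := {x | x.2 = 1 ∧ x.1 ≤ k ∨ x.2 ≠ 1 ∧ x.1 + lag ≤ k}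

/-- Epochs whose numbers of attempts enter the thresholds up to step `k`. -/
def usedEpochs (lag k : ℕ) : Set ℕ := {i | i + lag ≤ k}

/-- Samples whose delays enter step `k` for the first time. -/
def newSamples (lag k : ℕ) : Set (ℕ × ℕ) :=
  {x | x.2 = 1 ∧ x.1 = k ∨ x.2 ≠ 1 ∧ x.1 + lag = k}

section UsedInfo

variable {Ω : Type*} {X : Ω → Path} {lag : ℕ}

lemma info_used_mono : Monotone fun k => info X (usedSamples lag k) (usedEpochs lag k) :=
  fun k l hkl => info_mono
    (fun x hx => by simp only [usedSamples, Set.mem_ofPred_eq] at *; omega)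
    (fun i hi => by simp only [usedEpochs, Set.mem_ofPred_eq] at *; omega)

lemma measurable_actualDelay_used {i k : ℕ} (hik : i ≤ k) :
    Measurable[info X (usedSamples lag k) (usedEpochs lag k)] fun ω => actualDelay (X ω) i :=
  measurable_roundTrip_info (show (i, 1) ∈ usedSamples lag k from Or.inl ⟨rfl, hik⟩)

lemma measurable_virtualDelay_used {i k : ℕ} (hik : i ≤ k) :
    Measurable[info X (usedSamples lag k) (usedEpochs lag k)] fun ω =>
      usedVirtualDelay lag (X ω) i := by
  unfold usedVirtualDelay
  split_ifs with hi
  · exact measurable_const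
  · exact measurable_virtualDelay_info
      (fun j hj => Or.inr ⟨by simp only; omega, by simp only; omega⟩)
      (by simp only [usedEpochs, Set.mem_ofPred_eq]; omega)

lemma measurable_threshold_used (b : Bounds) (c : ℝ) (k : ℕ) :
    Measurable[info X (usedSamples lag k) (usedEpochs lag k)] fun ω =>
      threshold b lag c (X ω) k :=
  measurable_threshold b lag measurable_const (fun _ _ h => measurable_actualDelay_used h)
    fun _ _ h => measurable_virtualDelay_used h

lemma measurable_new (hlag : lag ≤ 1) (k : ℕ) :
    Measurable[info X (newSamples lag (k + 2)) {k + 2 - lag}] fun ω =>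
      (actualDelay (X ω) (k + 2), usedVirtualDelay lag (X ω) (k + 2)) := by
  simp_rw [usedVirtualDelay_add_two hlag]
  have h1 : Measurable[info X (newSamples lag (k + 2)) {k + 2 - lag}] fun ω =>
      actualDelay (X ω) (k + 2) :=
    measurable_roundTrip_info (show (k + 2, 1) ∈ newSamples lag (k + 2) from Or.inl ⟨rfl, rfl⟩)
  have h2 : Measurable[info X (newSamples lag (k + 2)) {k + 2 - lag}] fun ω =>
      virtualDelay (X ω) (k + 2 - lag) :=
    measurable_virtualDelay_info
      (fun j hj => Or.inr ⟨by simp only; omega, by simp only; omega⟩) (Set.mem_singleton _)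
  exact h1.prodMk h2

end UsedInfo

/-- Envelope of the drift, locally uniform in the threshold. -/
lemma abs_drift_le {γ u d v : ℝ} (h0 : 0 ≤ γ) (hu : γ ≤ u) :
    |drift γ d v| ≤ (|d| + u) ^ 2 / 2 + u * (|d| + u + |v|) := by
  have h1 : |max d γ| ≤ |d| + u := by
    rw [abs_le]
    have := neg_abs_le d
    have := abs_nonneg d
    exact ⟨by linarith [le_max_right d γ], max_le (by linarith [le_abs_self d]) (by linarith)⟩
  have h2 : (max d γ) ^ 2 ≤ (|d| + u) ^ 2 := sq_le_sq' (abs_le.1 h1).1 (abs_le.1 h1).2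
  have h3 : |γ * (max d γ + v)| ≤ u * (|d| + u + |v|) := by
    rw [abs_mul, abs_of_nonneg h0]
    exact mul_le_mul hu ((abs_add_le _ _).trans (by linarith)) (abs_nonneg _) (by linarith)
  unfold drift
  have h4 := abs_le.1 h3
  have h5 := sq_nonneg (max d γ)
  rw [abs_le]
  constructor <;> linarith

lemma measurable_drift_right (γ : ℝ) : Measurable fun z : ℝ × ℝ => drift γ z.1 z.2 :=
  measurable_drift (f := fun _ => γ) (g := Prod.fst) (u := Prod.snd) measurable_const
    measurable_fst measurable_snd

/-! ### Noise, bias and convergence of the recursion -/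

namespace Model

variable {Ω : Type*} [MeasurableSpace Ω] {μ : Measure Ω} [IsProbabilityMeasure μ]
  {ε B α : ℝ} {PF PB : Measure ℝ} {X : Ω → Path} (h : Model μ ε B α PF PB X)

include h

/-- Strong law of large numbers for functions of the epochs. -/
lemma strong_law {Φ : Path → ℝ} (hΦ : Measurable Φ)
    (hint : Integrable (fun ω => Φ (epochPath (X ω) 1)) μ) :
    ∀ᵐ ω ∂μ, Tendsto (average fun i => Φ (epochPath (X ω) (i + 1))) atTop
      (𝓝 (∫ ω, Φ (epochPath (X ω) 1) ∂μ)) := by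
  refine strong_law_ae_real (fun i ω => Φ (epochPath (X ω) (i + 1))) hint ?_
    fun i => h.identDistrib_comp_epochPath hΦ (by omega)
  intro i j hij
  refine h.channel.indepFun_of_info ?_ ?_ (hΦ.comp (measurable_epochPath_info (i + 1)))
    (hΦ.comp (measurable_epochPath_info (j + 1)))
  · rw [Set.disjoint_left]
    intro x h1 h2
    simp only [epochSamples, Set.mem_ofPred_eq] at h1 h2
    omega
  · simp [hij]

lemma tendsto_runningMean {Φ : ℝ → ℝ} (hΦ : Measurable Φ)
    (hint : Integrable (fun ω => Φ (virtualDelay (X ω) 1)) μ) {lag : ℕ} (hlag : lag ≤ 1) :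
    ∀ᵐ ω ∂μ, Tendsto (runningMean fun i => Φ (usedVirtualDelay lag (X ω) i)) atTop
      (𝓝 (∫ ω, Φ (virtualDelay (X ω) 1) ∂μ)) := by
  have h1 := h.strong_law (hΦ.comp (measurable_path_virtualDelay 1))
    (by simpa only [Function.comp, virtualDelay_epochPath] using hint)
  simp only [Function.comp, virtualDelay_epochPath] at h1
  filter_upwards [h1] with ω hω
  have e : (runningMean fun i => Φ (usedVirtualDelay lag (X ω) i))
      = average fun i => Φ (usedVirtualDelay lag (X ω) (i + 1)) :=
    funext fun k => runningMean_eq_average _ k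
  rw [e]
  interval_cases lag
  · exact hω
  · refine tendsto_average_of_shift (hω.congr' (Eventually.of_forall fun n => ?_))
    simp [usedVirtualDelay]

/-- With lag 1 the two delays come from different epochs, but the joint law is unchanged because
they are independent within one epoch as well. The index starts at 2 because the first lagged update
uses the value 0. -/
lemma identDistrib_new {lag : ℕ} (hlag : lag ≤ 1) (k : ℕ) :
    IdentDistrib (fun ω => (actualDelay (X ω) (k + 2), usedVirtualDelay lag (X ω) (k + 2)))
      (fun ω => (actualDelay (X ω) 1, virtualDelay (X ω) 1)) μ μ := by
  simp_rw [usedVirtualDelay_add_two hlag]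
  refine (h.identDistrib_actualDelay (by omega)).prodMk (h.identDistrib_virtualDelay (by omega))
    ?_ (h.indepFun_actualDelay_virtualDelay 1)
  refine h.channel.indepFun_of_info (D := {(k + 2, 1)}) (A := ∅)
    (D' := laterSamples (k + 2 - lag) 1) (A' := {k + 2 - lag})
    (by simp [laterSamples]) (Set.empty_disjoint _)
    (measurable_roundTrip_info (Set.mem_singleton (k + 2, 1)))
    (measurable_virtualDelay_info (fun j hj => ⟨rfl, hj⟩) (Set.mem_singleton _))

/-- With lag 1 the virtual delay of epoch k + 1 has not entered the threshold of step k + 1, so it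
is still fresh at step k + 2. -/
lemma indepFun_used_new {lag : ℕ} (hlag : lag ≤ 1) (k : ℕ) {E : Type*} [MeasurableSpace E]
    {Q : Ω → E} (hQ : Measurable[info X (usedSamples lag (k + 1)) (usedEpochs lag (k + 1))] Q) :
    IndepFun Q (fun ω => (actualDelay (X ω) (k + 2), usedVirtualDelay lag (X ω) (k + 2))) μ := by
  refine h.channel.indepFun_of_info ?_ ?_ hQ (measurable_new hlag k)
  · rw [Set.disjoint_left]
    intro x h1 h2
    simp only [usedSamples, newSamples, Set.mem_ofPred_eq] at h1 h2
    omega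
  · rw [Set.disjoint_left]
    intro i h1 h2
    simp only [usedEpochs, Set.mem_ofPred_eq, Set.mem_singleton_iff] at h1 h2
    omega

/-- The mean of the drift `g_0(γ; Dᵃ, Dᵛ)`. -/
lemma integral_drift_new {lag : ℕ} (hlag : lag ≤ 1) (k : ℕ) (γ : ℝ) :
    ∫ ω, drift γ (actualDelay (X ω) (k + 2)) (usedVirtualDelay lag (X ω) (k + 2)) ∂μ
      = ∫ ω, drift γ (actualDelay (X ω) 1) (virtualDelay (X ω) 1) ∂μ :=
  ((h.identDistrib_new hlag k).comp (measurable_drift_right γ)).integral_eq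

lemma integrable_drift_new {lag : ℕ} (hlag : lag ≤ 1) (k : ℕ) (γ : ℝ) :
    Integrable (fun ω => drift γ (actualDelay (X ω) (k + 2)) (usedVirtualDelay lag (X ω) (k + 2)))
      μ :=
  ((h.identDistrib_new hlag k).comp (measurable_drift_right γ)).integrable_iff.2
    (h.integrable_drift γ le_rfl)

/-- The noise of the recursion is orthogonal to the past. -/
lemma integral_mul_noise_eq_zero {lag : ℕ} (hlag : lag ≤ 1) (k : ℕ) {w x : Ω → ℝ} {g : ℝ → ℝ}
    (hg : ∀ y, g y = ∫ ω, drift y (actualDelay (X ω) 1) (virtualDelay (X ω) 1) ∂μ)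
    (hgm : Measurable g)
    (hw : Measurable[info X (usedSamples lag (k + 1)) (usedEpochs lag (k + 1))] w)
    (hx : Measurable[info X (usedSamples lag (k + 1)) (usedEpochs lag (k + 1))] x)
    (hint : Integrable (fun ω => w ω * (drift (x ω) (actualDelay (X ω) (k + 2))
      (usedVirtualDelay lag (X ω) (k + 2)) - g (x ω))) μ) :
    ∫ ω, w ω * (drift (x ω) (actualDelay (X ω) (k + 2))
      (usedVirtualDelay lag (X ω) (k + 2)) - g (x ω)) ∂μ = 0 := by
  have hind := h.indepFun_used_new hlag k (hw.prodMk hx)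
  have hQ : Measurable fun ω => (w ω, x ω) := (hw.prodMk hx).mono (h.channel.info_le _ _) le_rfl
  have hP := (measurable_new (X := X) hlag k).mono (h.channel.info_le _ _) le_rfl
  have hφ : Measurable fun z : (ℝ × ℝ) × ℝ × ℝ =>
      z.1.1 * (drift z.1.2 z.2.1 z.2.2 - g z.1.2) := by
    have h1 : Measurable fun z : (ℝ × ℝ) × ℝ × ℝ => z.1.2 := by fun_prop
    have h2 : Measurable fun z : (ℝ × ℝ) × ℝ × ℝ => z.2.1 := by fun_prop
    have h3 : Measurable fun z : (ℝ × ℝ) × ℝ × ℝ => z.2.2 := by fun_prop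
    have h4 : Measurable fun z : (ℝ × ℝ) × ℝ × ℝ => z.1.1 := by fun_prop
    exact h4.mul ((measurable_drift h1 h2 h3).sub (hgm.comp h1))
  refine integral_eq_zero_of_indepFun hQ hP hind hφ hint fun q => ?_
  have e := h.integral_drift_new hlag k q.2
  rw [← hg] at e
  simp only
  rw [integral_const_mul, integral_sub (h.integrable_drift_new hlag k q.2) (integrable_const _), e]
  simp

/-- The noise of the recursion is summable along almost every realization. -/
lemma ae_cauchySeq_noise {b : Bounds} (hlu : b.gammaLb ≤ b.gammaUb) {lag : ℕ} (hlag : lag ≤ 1)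
    (c : ℝ) {η : ℕ → ℝ} (hη : Summable fun k => η k ^ 2) :
    ∀ᵐ ω ∂μ, CauchySeq fun n => ∑ k ∈ Finset.range n, η k *
      (drift (threshold b lag c (X ω) (k + 1)) (actualDelay (X ω) (k + 2))
          (usedVirtualDelay lag (X ω) (k + 2))
        - ∫ ω', drift (threshold b lag c (X ω) (k + 1)) (actualDelay (X ω') 1)
          (virtualDelay (X ω') 1) ∂μ) := by
  set gd : ℝ → ℝ := fun γ => ∫ ω', drift γ (actualDelay (X ω') 1) (virtualDelay (X ω') 1) ∂μ
    with hgd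
  have hgd_anti : Antitone gd := fun x y hxy => by
    have := h.driftMean_antitone hxy
    unfold driftMean at this
    simp only [hgd]
    linarith
  set u := b.gammaUb with hu
  have hl0 : 0 ≤ b.gammaLb := le_max_right _ _
  have hu0 : 0 ≤ u := hl0.trans hlu
  set G := |gd b.gammaLb| + |gd u| with hG
  have hgdG : ∀ y, b.gammaLb ≤ y → y ≤ u → |gd y| ≤ G := fun y h1 h2 => by
    have h3 := hgd_anti h1
    have h4 := hgd_anti h2
    rw [abs_le]
    constructor
    · linarith [neg_abs_le (gd u), abs_nonneg (gd b.gammaLb)]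
    · linarith [le_abs_self (gd b.gammaLb), abs_nonneg (gd u)]
  set Ψ : ℝ × ℝ → ℝ := fun z => (|z.1| + u) ^ 2 / 2 + u * (|z.1| + u + |z.2|) + G with hΨ
  have hΨm : Measurable Ψ := by fun_prop
  -- The envelope is quadratic in the actual delay, so its square integrability uses the fourth
  -- moment.
  have hΨ2 : MemLp (fun ω => Ψ (actualDelay (X ω) 1, virtualDelay (X ω) 1)) 2 μ := by
    have hA := (h.memLp_actualDelay (le_refl 1)).norm
    have hV := (h.memLp_two_virtualDelay (le_refl 1)).norm
    have hAu : MemLp (fun ω => |actualDelay (X ω) 1| + u) 4 μ := hA.add (memLp_const u)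
    have hsq : MemLp (fun ω => (|actualDelay (X ω) 1| + u) ^ 2) 2 μ := by
      have hm : AEStronglyMeasurable (fun ω => (|actualDelay (X ω) 1| + u) ^ 2) μ := hAu.1.pow 2
      rw [memLp_two_iff_integrable_sq hm]
      have := hAu.integrable_norm_pow (p := 4) (by norm_num)
      refine this.congr (Eventually.of_forall fun ω => ?_)
      simp only [Real.norm_eq_abs, (show Even 4 by decide).pow_abs]
      ring
    have hAu2 := hAu.mono_exponent (by norm_num : (2 : ℝ≥0∞) ≤ 4)
    have h1 := (hsq.const_mul (1 / 2)).add (((hAu2.add hV).const_mul u).add (memLp_const G))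
    refine h1.congr_norm ?_ ?_
    · have := h.measurable_actualDelay 1
      have := h.measurable_virtualDelay 1
      exact (hΨm.comp (by fun_prop)).aestronglyMeasurable
    · refine Eventually.of_forall fun ω => ?_
      congr 1
      simp only [Pi.add_apply, hΨ, Real.norm_eq_abs]
      ring
  set x : ℕ → Ω → ℝ := fun k ω => threshold b lag c (X ω) (k + 1) with hx
  set P : ℕ → Ω → ℝ × ℝ := fun k ω =>
    (actualDelay (X ω) (k + 2), usedVirtualDelay lag (X ω) (k + 2)) with hP
  set Δ : ℕ → Ω → ℝ := fun k ω => drift (x k ω) (P k ω).1 (P k ω).2 - gd (x k ω) with hΔ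
  let ℱ : Filtration ℕ ‹MeasurableSpace Ω› :=
    { seq := fun n => info X (usedSamples lag (n + 1)) (usedEpochs lag (n + 1))
      mono' := fun m n hmn => info_used_mono (by omega)
      le' := fun n => h.channel.info_le _ _ }
  have hxm : ∀ k, Measurable[ℱ k] (x k) := fun k => measurable_threshold_used b c (k + 1)
  have hPm' : ∀ k, Measurable[ℱ (k + 1)] (P k) := fun k =>
    (measurable_actualDelay_used le_rfl).prodMk (measurable_virtualDelay_used le_rfl)
  have hxM : ∀ k, Measurable (x k) := fun k => (hxm k).mono (h.channel.info_le _ _) le_rfl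
  have hPM : ∀ k, Measurable (P k) := fun k => (hPm' k).mono (h.channel.info_le _ _) le_rfl
  have hΔm : ∀ k, Measurable[ℱ (k + 1)] (Δ k) := fun k => by
    have h1 : Measurable[ℱ (k + 1)] (x k) := (hxm k).mono (ℱ.mono (Nat.le_succ k)) le_rfl
    exact (measurable_drift h1 (measurable_fst.comp (hPm' k)) (measurable_snd.comp (hPm' k))).sub
      (hgd_anti.measurable.comp h1)
  have hΔM : ∀ k, Measurable (Δ k) := fun k => (hΔm k).mono (h.channel.info_le _ _) le_rfl
  have hΔle : ∀ k ω, |Δ k ω| ≤ Ψ (P k ω) := fun k ω => by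
    obtain ⟨h1, h2⟩ := threshold_succ_mem hlu lag c (X ω) k
    have h3 := abs_drift_le (d := (P k ω).1) (v := (P k ω).2) (hl0.trans h1) h2
    have h4 := hgdG (x k ω) h1 h2
    exact (abs_sub _ _).trans (add_le_add h3 h4)
  have hid : ∀ k, IdentDistrib (fun ω => Ψ (P k ω))
      (fun ω => Ψ (actualDelay (X ω) 1, virtualDelay (X ω) 1)) μ μ := fun k =>
    (h.identDistrib_new hlag k).comp hΨm
  have hΨP : ∀ k, MemLp (fun ω => Ψ (P k ω)) 2 μ := fun k => (hid k).memLp_iff.2 hΨ2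
  have hΔ2 : ∀ k, MemLp (Δ k) 2 μ := fun k =>
    (hΨP k).mono' (hΔM k).aestronglyMeasurable (Eventually.of_forall fun ω => hΔle k ω)
  set K := ∫ ω, Ψ (actualDelay (X ω) 1, virtualDelay (X ω) 1) ^ 2 ∂μ with hK
  refine ae_cauchySeq_of_orthogonal_increments (ℱ := ℱ) (d := fun k ω => η k * Δ k ω)
    (a := fun k => η k ^ 2 * K) (fun k => (hΔm k).const_mul (η k)) (fun k => (hΔ2 k).const_mul (η k))
    ?_ ?_ (hη.mul_right K)
  · intro k w hw hw2
    have hi : Integrable (fun ω => w ω * Δ k ω) μ := hw2.integrable_mul (hΔ2 k)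
    have key : ∫ ω, w ω * Δ k ω ∂μ = 0 :=
      h.integral_mul_noise_eq_zero hlag k (fun _ => rfl) hgd_anti.measurable hw (hxm k) hi
    have e : ∀ ω, w ω * (η k * Δ k ω)
        = η k * (w ω * Δ k ω) := fun ω => by ring
    simp_rw [e]
    rw [integral_const_mul, key, mul_zero]
  · intro k
    simp_rw [mul_pow]
    rw [integral_const_mul]
    refine mul_le_mul_of_nonneg_left ?_ (sq_nonneg _)
    have h1 : ∫ ω, Ψ (P k ω) ^ 2 ∂μ = K :=
      ((hid k).comp (u := fun y => y ^ 2) (by fun_prop)).integral_eq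
    rw [← h1]
    refine integral_mono (hΔ2 k).integrable_sq (hΨP k).integrable_sq fun ω => ?_
    exact sq_le_sq' (by linarith [(abs_le.1 (hΔle k ω)).1]) (abs_le.1 (hΔle k ω)).2

/-- Almost sure convergence of the thresholds from a deterministic starting point. -/
lemma tendsto_threshold {b : Bounds} (hb : b.Valid μ X) {lag : ℕ} (hlag : lag ≤ 1) {γ : ℝ}
    (hγ0 : 0 ≤ γ) (hγ : driftMean μ X γ = 0) (c : ℝ) :
    ∀ᵐ ω ∂μ, Tendsto (fun k => threshold b lag c (X ω) k) atTop (𝓝 γ) := by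
  have hl := h.gammaLb_le_root hb hγ0 hγ
  have hu := h.root_le_gammaUb hb hγ0 hγ
  have hlu := hl.trans hu
  have hD := hb.delayLb_pos
  -- The recursion is followed from index 1 on: γ₀ may lie outside the projection interval, the
  -- first step size is special, and the first lagged virtual delay is artificial.
  set η : ℕ → ℝ := fun k => 1 / (((k : ℝ) + 4) * b.delayLb) with hη
  have hη0 : ∀ k, 0 ≤ η k := fun k => by simp only [hη]; positivity
  have hηeq : ∀ k, η k = (1 / ((k + 4 : ℕ) : ℝ)) * (1 / b.delayLb) := fun k => by
    simp only [hη]; push_cast; field_simp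
  have hstep : ∀ k, b.stepSize (k + 2) = η k := fun k => by
    simp only [Bounds.stepSize, hη, show k + 2 ≠ 1 by omega, if_false]
    push_cast; ring
  have hηlim : Tendsto η atTop (𝓝 0) := by
    have h1 : Tendsto (fun k : ℕ => 1 / ((k + 4 : ℕ) : ℝ)) atTop (𝓝 0) :=
      (tendsto_add_atTop_iff_nat 4).2 (tendsto_one_div_atTop_nhds_zero_nat (𝕜 := ℝ))
    have h2 := h1.mul_const (1 / b.delayLb)
    rw [zero_mul] at h2
    exact h2.congr fun k => (hηeq k).symm
  have hηsum : Tendsto (fun n => ∑ k ∈ Finset.range n, η k) atTop atTop := by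
    rw [← not_summable_iff_tendsto_nat_atTop_of_nonneg hη0, funext hηeq]
    intro hs
    have h1 := hs.mul_right b.delayLb
    simp only [mul_assoc, one_div_mul_cancel hD.ne', mul_one] at h1
    exact Real.not_summable_one_div_natCast
      ((summable_nat_add_iff (f := fun n : ℕ => 1 / (n : ℝ)) 4).1 h1)
  have hηsq : Summable fun k => η k ^ 2 := by
    have h1 := (summable_nat_add_iff (f := fun n : ℕ => 1 / (n : ℝ) ^ 2) 4).2
      (Real.summable_one_div_nat_pow.2 (by norm_num))
    refine (h1.mul_right ((1 / b.delayLb) ^ 2)).congr fun k => ?_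
    rw [hηeq]; ring
  set v := ∫ ω, virtualDelay (X ω) 1 ∂μ with hv
  set v2 := ∫ ω, virtualDelay (X ω) 1 ^ 2 ∂μ with hv2
  set D := ∫ ω, actualDelay (X ω) 1 ∂μ + v with hDdef
  have hD0 : 0 < D := add_pos_of_pos_of_nonneg h.actualMean_pos h.virtualMean_nonneg
  filter_upwards [h.ae_cauchySeq_noise hlu hlag c hηsq,
    h.tendsto_runningMean (Φ := fun y => y) measurable_id (h.integrable_virtualDelay le_rfl) hlag,
    h.tendsto_runningMean (Φ := fun y => y ^ 2) (by fun_prop)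
      (h.memLp_two_virtualDelay le_rfl).integrable_sq hlag] with ω hN hm1 hm2
  rw [← tendsto_add_atTop_iff_nat 1]
  set N : ℕ → ℝ := fun n => ∑ k ∈ Finset.range n, η k *
      (drift (threshold b lag c (X ω) (k + 1)) (actualDelay (X ω) (k + 2))
          (usedVirtualDelay lag (X ω) (k + 2))
        - ∫ ω', drift (threshold b lag c (X ω) (k + 1)) (actualDelay (X ω') 1)
          (virtualDelay (X ω') 1) ∂μ) with hNdef
  -- The bias: running estimates in place of the true moments of Dᵛ.
  set e : ℕ → ℝ := fun k => ((1 / 2) * runningMean (fun i => usedVirtualDelay lag (X ω) i ^ 2)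
    (k + 2) - runningMean (usedVirtualDelay lag (X ω)) (k + 2) ^ 2) - ((1 / 2) * v2 - v ^ 2) with he
  have he0 : Tendsto e atTop (𝓝 0) := by
    have h1 := ((((hm2.const_mul (1 / 2)).sub (hm1.pow 2))).sub_const ((1 / 2) * v2 - v ^ 2))
    rw [sub_self] at h1
    exact (tendsto_add_atTop_iff_nat 2).2 h1
  refine tendsto_of_projected_recursion (x := fun k => threshold b lag c (X ω) (k + 1)) (N := N)
    (η := η) (e := e) (h := driftMean μ X) (c := D)
    (G := |driftMean μ X b.gammaLb| + |driftMean μ X b.gammaUb|)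
    hl hu hD0 hη0 hηlim hηsum hN he0 ?_
    (fun k => (threshold_succ_mem hlu lag c (X ω) k).1)
    (fun k => (threshold_succ_mem hlu lag c (X ω) k).2) ?_ ?_ ?_
  · intro k
    simp only [hNdef]
    rw [Finset.sum_range_succ, add_sub_cancel_left, threshold, hstep, driftMean]
    congr 2
    simp only [he, ← hv, ← hv2]
    ring
  · intro y h1 h2
    have h3 := h.driftMean_antitone h1
    have h4 := h.driftMean_antitone h2
    rw [abs_le]
    constructor
    · linarith [neg_abs_le (driftMean μ X b.gammaUb), abs_nonneg (driftMean μ X b.gammaLb)]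
    · linarith [le_abs_self (driftMean μ X b.gammaLb), abs_nonneg (driftMean μ X b.gammaUb)]
  · intro y h1 _
    have := h.driftMean_le h1
    rw [hγ] at this
    linarith
  · intro y _ h1
    have := h.driftMean_le h1
    rw [hγ] at this
    linarith

/-- Almost sure convergence of the thresholds from an independent random starting point. -/
lemma tendsto_threshold_random {b : Bounds} (hb : b.Valid μ X) {lag : ℕ} (hlag : lag ≤ 1) {γ : ℝ}
    (hγ0 : 0 ≤ γ) (hγ : driftMean μ X γ = 0) {c : Ω → ℝ} (hc : Measurable c)
    (hcX : IndepFun c X μ) :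
    ∀ᵐ ω ∂μ, Tendsto (fun k => threshold b lag (c ω) (X ω) k) atTop (𝓝 γ) := by
  have hV : ∀ i, Measurable fun p : Path => usedVirtualDelay lag p i := fun i => by
    unfold usedVirtualDelay
    split_ifs
    · exact measurable_const
    · exact measurable_path_virtualDelay _
  have hset : MeasurableSet {z : ℝ × Path |
      Tendsto (fun k => threshold b lag z.1 z.2 k) atTop (𝓝 γ)} :=
    measurableSet_tendsto _ fun k => measurable_threshold b lag measurable_fst
      (fun i _ _ => (measurable_path_actualDelay i).comp measurable_snd)
      fun i _ _ => (hV i).comp measurable_snd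
  have hX := h.channel.measurable
  have hlaw := (indepFun_iff_map_prod_eq_prod_map_map hc.aemeasurable hX.aemeasurable).1 hcX
  have h1 : ∀ᵐ z ∂(μ.map c).prod (μ.map X),
      Tendsto (fun k => threshold b lag z.1 z.2 k) atTop (𝓝 γ) := by
    have : IsProbabilityMeasure (μ.map X) := Measure.isProbabilityMeasure_map hX.aemeasurable
    -- By independence the joint law is a product, so it suffices to fix the starting point.
    rw [Measure.ae_prod_iff_ae_ae hset]
    refine Eventually.of_forall fun a => ?_
    have hset' : MeasurableSet {y : Path |
        Tendsto (fun k => threshold b lag a y k) atTop (𝓝 γ)} := measurable_prodMk_left hset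
    exact (ae_map_iff hX.aemeasurable hset').2 (h.tendsto_threshold hb hlag hγ0 hγ a)
  rw [← hlaw] at h1
  exact ae_of_ae_map (hc.prodMk hX).aemeasurable h1

end Model

/-! ### Time-average age under thresholds that converge -/

lemma abs_thresholdEpoch_sub_le (θ γ : ℝ) (p : Path) (k : ℕ) :
    |thresholdEpoch θ p k - thresholdEpoch γ p k| ≤ |θ - γ| := by
  simp only [thresholdEpoch, add_sub_add_right_eq_sub]
  rw [max_comm, max_comm _ γ]
  exact abs_max_sub_max_le_abs θ γ _

lemma IsRegular.thresholdEpoch_ge {ε : ℝ} {p : Path} (hp : IsRegular ε p) (hε : 0 < ε) (γ : ℝ)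
    {k : ℕ} (hk : 1 ≤ k) : 2 * ε ≤ thresholdEpoch γ p k := by
  have h1 := hp.actualDelay_ge hk
  have h2 := hp.virtualDelay_nonneg hε hk
  have h3 := le_max_left (actualDelay p k) γ
  unfold thresholdEpoch
  linarith

/-- Time-average age on a path, from the averages under the limiting threshold. -/
lemma IsRegular.tendsto_timeAverage_age {ε : ℝ} {p : Path} (hp : IsRegular ε p) (hε : 0 < ε)
    {W : ℕ → ℕ → ℝ} (hW : ∀ k j, 0 ≤ W k j) {θ : ℕ → ℝ} {γ ℓ q f : ℝ}
    (hWθ : ∀ k, 1 ≤ k → epochLength p W k = thresholdEpoch (θ k) p k)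
    (hθ : Tendsto θ atTop (𝓝 γ)) (hℓ : ℓ ≠ 0)
    (h1 : Tendsto (average fun i => thresholdEpoch γ p (i + 1)) atTop (𝓝 ℓ))
    (h2 : Tendsto (average fun i => thresholdEpoch γ p (i + 1) ^ 2) atTop (𝓝 q))
    (h3 : Tendsto (average fun i => forward p (i + 2) 1) atTop (𝓝 f))
    (h4 : Tendsto (average fun i => forward p (i + 2) 1 * thresholdEpoch γ p (i + 1)) atTop
      (𝓝 (f * ℓ))) :
    Tendsto (fun k => (∫ t in (0 : ℝ)..sampleTime p W (k + 1), age p W t)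
      / sampleTime p W (k + 1)) atTop (𝓝 ((q / 2 + f * ℓ) / ℓ)) := by
  set δ : ℕ → ℝ := fun i => |θ (i + 1) - γ| with hδ
  have hδ0 : Tendsto δ atTop (𝓝 0) := by
    have := ((tendsto_add_atTop_iff_nat 1).2 hθ).sub_const γ
    rw [sub_self] at this
    simpa [hδ] using this.abs
  have hL0 : ∀ i, 2 * ε ≤ thresholdEpoch γ p (i + 1) := fun i =>
    hp.thresholdEpoch_ge hε γ (by omega)
  have hLnn : ∀ i, 0 ≤ thresholdEpoch γ p (i + 1) := fun i => by linarith [hL0 i]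
  have hdiff : ∀ i, |epochLength p W (i + 1) - thresholdEpoch γ p (i + 1)| ≤ δ i := fun i => by
    rw [hWθ (i + 1) (by omega)]
    exact abs_thresholdEpoch_sub_le _ _ _ _
  have hFnn : ∀ i, 0 ≤ forward p (i + 2) 1 := fun i =>
    hε.le.trans (hp.forward_ge (i + 2) 1 (by omega) le_rfl)
  have hδn : ∀ i, 0 ≤ δ i := fun i => abs_nonneg _
  -- Lengths are at least 2ε, so dividing by 2ε turns the absolute error δ into a relative one.
  have t1 : Tendsto (average fun i => epochLength p W (i + 1)) atTop (𝓝 ℓ) := by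
    refine tendsto_average_of_abs_sub_le (δ := fun i => δ i / (2 * ε)) h1 h1 hLnn
      (by simpa using hδ0.div_const (2 * ε)) fun i => (hdiff i).trans ?_
    rw [div_mul_eq_mul_div, le_div_iff₀ (by positivity)]
    exact mul_le_mul_of_nonneg_left (hL0 i) (hδn i)
  have t2 : Tendsto (average fun i => epochLength p W (i + 1) ^ 2) atTop (𝓝 q) := by
    refine tendsto_average_of_abs_sub_le (δ := fun i => 2 * δ i + δ i ^ 2 / (2 * ε)) h2 h1 hLnn
      (by simpa using (hδ0.const_mul 2).add ((hδ0.pow 2).div_const (2 * ε))) fun i => ?_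
    set L := thresholdEpoch γ p (i + 1) with hL
    have e1 : |epochLength p W (i + 1) + L| ≤ 2 * L + δ i := by
      have := abs_le.1 (hdiff i)
      rw [abs_le]
      constructor <;> linarith [this.1, this.2, hLnn i, hδn i]
    have e2 : δ i ^ 2 ≤ δ i ^ 2 / (2 * ε) * L := by
      rw [div_mul_eq_mul_div, le_div_iff₀ (by positivity)]
      exact mul_le_mul_of_nonneg_left (hL0 i) (sq_nonneg _)
    calc |epochLength p W (i + 1) ^ 2 - L ^ 2|
        = |epochLength p W (i + 1) - L| * |epochLength p W (i + 1) + L| := by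
          rw [← abs_mul]; ring_nf
      _ ≤ δ i * (2 * L + δ i) := mul_le_mul (hdiff i) e1 (abs_nonneg _) (hδn i)
      _ ≤ (2 * δ i + δ i ^ 2 / (2 * ε)) * L := by linarith
  -- After the shift, the forward delay of epoch i + 2 multiplies the length of epoch i + 1; the
  -- term dropped is zero since S_1 = S_0 = 0.
  have t3 : Tendsto (average fun i => forward p (i + 1) 1 *
      (sampleTime p W (i + 1) - sampleTime p W i)) atTop (𝓝 (f * ℓ)) := by
    refine tendsto_average_of_shift (tendsto_average_of_abs_sub_le h4 h3 hFnn hδ0 fun i => ?_)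
    rw [sampleTime_succ (by omega : 1 ≤ i + 1), add_sub_cancel_left, ← mul_sub, abs_mul,
      abs_of_nonneg (hFnn i), mul_comm (δ i)]
    exact mul_le_mul_of_nonneg_left (hdiff i) (hFnn i)
  refine (((t2.div_const 2).add t3).div t1 hℓ).congr' ?_
  filter_upwards [eventually_ge_atTop 1] with n hn
  have hn0 : (n : ℝ) ≠ 0 := by positivity
  rw [(hp.integral_age hε hW n).2, sampleTime_succ_eq_sum_range]
  simp only [average, cycleArea, Pi.div_apply, Finset.sum_add_distrib,
    ← Finset.sum_div, Nat.add_sub_cancel]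
  rw [div_right_comm, ← add_div, div_div_div_cancel_right₀ hn0]

/-! ### Strong laws and the almost sure time average -/

namespace Model

variable {Ω : Type*} [MeasurableSpace Ω] {μ : Measure Ω} [IsProbabilityMeasure μ]
  {ε B α : ℝ} {PF PB : Measure ℝ} {X : Ω → Path} (h : Model μ ε B α PF PB X)

include h

lemma indepFun_forward_thresholdEpoch (γ : ℝ) (i : ℕ) :
    IndepFun (fun ω => forward (X ω) (i + 2) 1) (fun ω => thresholdEpoch γ (X ω) (i + 1)) μ := by
  have hA : Measurable[info X (epochSamples (i + 1)) {i + 1}] fun ω => actualDelay (X ω) (i + 1) :=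
    measurable_roundTrip_info (D := epochSamples (i + 1)) (k := i + 1) (j := 1) rfl
  have hV : Measurable[info X (epochSamples (i + 1)) {i + 1}] fun ω =>
      virtualDelay (X ω) (i + 1) :=
    measurable_virtualDelay_info (D := epochSamples (i + 1)) (fun j _ => rfl)
      (Set.mem_singleton _)
  refine h.channel.indepFun_of_info (D := {(i + 2, 1)}) (A := ∅) ?_ (Set.empty_disjoint _)
    (measurable_forward_info (Set.mem_singleton (i + 2, 1)))
    ((hA.max measurable_const).add hV)
  simp [epochSamples]

/-- Strong law of large numbers for products over two consecutive epochs. -/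
lemma strong_law_consecutive (γ : ℝ) :
    ∀ᵐ ω ∂μ, Tendsto
      (average fun i => forward (X ω) (i + 2) 1 * thresholdEpoch γ (X ω) (i + 1)) atTop
      (𝓝 ((∫ ω, forward (X ω) 1 1 ∂μ) * ∫ ω, thresholdEpoch γ (X ω) 1 ∂μ)) := by
  set Y : ℕ → Ω → ℝ := fun i ω => forward (X ω) (i + 2) 1 * thresholdEpoch γ (X ω) (i + 1) with hY
  have hL : ∀ i, IdentDistrib (fun ω => thresholdEpoch γ (X ω) (i + 1))
      (fun ω => thresholdEpoch γ (X ω) 1) μ μ := fun i => by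
    have := h.identDistrib_comp_epochPath (measurable_path_thresholdEpoch γ 1)
      (k := i + 1) (by omega)
    simpa only [thresholdEpoch_epochPath] using this
  have hF : ∀ i, IdentDistrib (fun ω => forward (X ω) (i + 2) 1)
      (fun ω => forward (X ω) 1 1) μ μ := fun i => h.identDistrib_forward (by omega) le_rfl
  have hid : ∀ i, IdentDistrib (Y i) (Y 0) μ μ := fun i =>
    (((hF i).trans (hF 0).symm).prodMk ((hL i).trans (hL 0).symm)
      (h.indepFun_forward_thresholdEpoch γ i) (h.indepFun_forward_thresholdEpoch γ 0)).comp
      (measurable_fst.mul measurable_snd)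
  have hLint : Integrable (fun ω => thresholdEpoch γ (X ω) 1) μ :=
    (h.memLp_thresholdEpoch γ le_rfl).integrable (by norm_num)
  have hint : ∀ i, Integrable (Y i) μ := fun i =>
    (hid i).integrable_iff.2 ((h.indepFun_forward_thresholdEpoch γ 0).integrable_mul
      (h.integrable_forward (by omega)) hLint)
  have hmean : ∀ i, ∫ ω, Y i ω ∂μ
      = (∫ ω, forward (X ω) 1 1 ∂μ) * ∫ ω, thresholdEpoch γ (X ω) 1 ∂μ := fun i => by
    rw [← (hF i).integral_eq, ← (hL i).integral_eq]
    exact (h.indepFun_forward_thresholdEpoch γ i).integral_fun_mul_eq_mul_integral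
      (h.channel.measurable_forward _ _).aestronglyMeasurable
      (h.measurable_thresholdEpoch γ _).aestronglyMeasurable
  have hYm : ∀ i, Measurable[info X (epochSamples (i + 1) ∪ epochSamples (i + 2)) {i + 1}] (Y i) :=
    fun i => by
    have m1 : Measurable[info X (epochSamples (i + 1) ∪ epochSamples (i + 2)) {i + 1}] fun ω =>
        forward (X ω) (i + 2) 1 :=
      measurable_forward_info (k := i + 2) (j := 1) (Or.inr rfl)
    have m2 : Measurable[info X (epochSamples (i + 1) ∪ epochSamples (i + 2)) {i + 1}] fun ω =>
        actualDelay (X ω) (i + 1) :=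
      measurable_roundTrip_info (k := i + 1) (j := 1) (Or.inl rfl)
    have m3 : Measurable[info X (epochSamples (i + 1) ∪ epochSamples (i + 2)) {i + 1}] fun ω =>
        virtualDelay (X ω) (i + 1) :=
      measurable_virtualDelay_info (fun j _ => Or.inl rfl) (Set.mem_singleton _)
    exact m1.mul ((m2.max measurable_const).add m3)
  have hind : ∀ i j, i + 2 ≤ j ∨ j + 2 ≤ i → IndepFun (Y i) (Y j) μ := fun i j hij => by
    refine h.channel.indepFun_of_info ?_ ?_ (hYm i) (hYm j)
    · rw [Set.disjoint_left]
      intro x h1 h2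
      simp only [epochSamples, Set.mem_union, Set.mem_ofPred_eq] at h1 h2
      omega
    · rw [Set.disjoint_singleton]
      omega
  -- Neighbouring products share an epoch and may be dependent; products two apart use disjoint
  -- data.
  have key : ∀ r, ∀ᵐ ω ∂μ, Tendsto (average fun i => Y (2 * i + r) ω) atTop
      (𝓝 ((∫ ω, forward (X ω) 1 1 ∂μ) * ∫ ω, thresholdEpoch γ (X ω) 1 ∂μ)) := fun r => by
    rw [← hmean (2 * 0 + r)]
    exact strong_law_ae_real (fun i ω => Y (2 * i + r) ω) (hint _)
      (fun i j hij => hind _ _ (by omega)) fun i => (hid _).trans (hid _).symm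
  filter_upwards [key 0, key 1] with ω h0 h1 using tendsto_average_of_even_odd h0 h1

/-- Time-average age under thresholds that converge to the root of the mean drift. -/
lemma tendsto_timeAverage_age {γ : ℝ} (hγ : driftMean μ X γ = 0) {θ : Ω → ℕ → ℝ}
    (hθ : ∀ᵐ ω ∂μ, Tendsto (θ ω) atTop (𝓝 γ)) {W : Ω → ℕ → ℕ → ℝ}
    (hW1 : ∀ ω k, W ω k 1 = max (θ ω k - actualDelay (X ω) k) 0)
    (hW2 : ∀ ω k j, j ≠ 1 → W ω k j = 0) :
    ∀ᵐ ω ∂μ, Tendsto (fun k => (∫ t in (0 : ℝ)..sampleTime (X ω) (W ω) (k + 1),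
        age (X ω) (W ω) t) / sampleTime (X ω) (W ω) (k + 1)) atTop
      (𝓝 (γ + ∫ ω, virtualDelay (X ω) 1 ∂μ + ∫ ω, forward (X ω) 1 1 ∂μ)) := by
  have hm := h.memLp_thresholdEpoch γ (le_refl 1)
  have s1 := h.strong_law (measurable_path_thresholdEpoch γ 1)
    (by simpa only [thresholdEpoch_epochPath] using hm.integrable (by norm_num))
  have s2 := h.strong_law ((measurable_path_thresholdEpoch γ 1).pow_const 2)
    (by simpa only [thresholdEpoch_epochPath] using
      (hm.mono_exponent (by norm_num : (2 : ℝ≥0∞) ≤ 4)).integrable_sq)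
  have s3 : ∀ᵐ ω ∂μ, Tendsto (average fun i => forward (X ω) (i + 2) 1) atTop
      (𝓝 (∫ ω, forward (X ω) 1 1 ∂μ)) := by
    have hF : ∀ i, IdentDistrib (fun ω => forward (X ω) (i + 2) 1)
        (fun ω => forward (X ω) 1 1) μ μ := fun i => h.identDistrib_forward (by omega) le_rfl
    rw [← (hF 0).integral_eq]
    refine strong_law_ae_real (fun i ω => forward (X ω) (i + 2) 1)
      (h.integrable_forward (by omega)) (fun i j hij => ?_) fun i => (hF i).trans (hF 0).symm
    exact h.channel.indepFun_of_info (D := {(i + 2, 1)}) (A := ∅) (D' := {(j + 2, 1)}) (A' := ∅)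
      (by simpa using hij) (Set.empty_disjoint _)
      (measurable_forward_info (Set.mem_singleton _))
      (measurable_forward_info (Set.mem_singleton _))
  simp only [thresholdEpoch_epochPath] at s1 s2
  have hℓ : 0 < ∫ ω, thresholdEpoch γ (X ω) 1 ∂μ := by
    have h1 := h.integral_thresholdEpoch_mean γ
    have h2 := h.actualMean_pos
    have h3 := h.virtualMean_nonneg
    linarith
  -- At the root half the second moment is (γ + v) times the first, so the renewal-reward ratio
  -- collapses to AoI_opt.
  have hlim : ((∫ ω, thresholdEpoch γ (X ω) 1 ^ 2 ∂μ) / 2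
      + (∫ ω, forward (X ω) 1 1 ∂μ) * ∫ ω, thresholdEpoch γ (X ω) 1 ∂μ)
        / ∫ ω, thresholdEpoch γ (X ω) 1 ∂μ
      = γ + ∫ ω, virtualDelay (X ω) 1 ∂μ + ∫ ω, forward (X ω) 1 1 ∂μ := by
    rw [div_eq_iff hℓ.ne']
    linarith [h.integral_thresholdEpoch_sq hγ]
  rw [← hlim]
  filter_upwards [h.ae_isRegular, hθ, s1, s2, s3, h.strong_law_consecutive γ]
    with ω hp hω h1 h2 h3 h4
  refine hp.tendsto_timeAverage_age h.eps_pos (fun k j => ?_)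
    (fun k hk => hp.epochLength_threshold hk (hW1 ω k) fun j hj => hW2 ω k j (by omega))
    hω hℓ.ne' h1 h2 h3 h4
  by_cases hj : j = 1
  · rw [hj, hW1]; exact le_max_right _ _
  · rw [hW2 ω k j hj]

end Model

end AoI

end

theorem theorem1 {Ω : Type*} [MeasurableSpace Ω] (μ : Measure Ω) [IsProbabilityMeasure μ]
    (ε B α : ℝ) (hε : 0 < ε) (hα0 : 0 ≤ α) (hα1 : α < 1)
    (PF PB : Measure ℝ) (hPF : AoI.IsDelayLaw ε B PF) (hPB : AoI.IsDelayLaw ε B PB)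
    (X : Ω → AoI.Path) (hX : AoI.IsChannel μ α PF PB X)
    (b : AoI.Bounds) (hb : b.Valid μ X)
    (γ₀ : Ω → ℝ) (hγ₀ : Measurable γ₀) (hγ₀X : IndepFun γ₀ X μ)
    (lag : ℕ) (hlag : lag = 0 ∨ lag = 1) :
    AoI.optimalAge μ X ≠ ∞ ∧
    (∀ᵐ ω ∂μ, Tendsto (fun k => AoI.threshold b lag (γ₀ ω) (X ω) k) atTop
      (𝓝 (AoI.optimalThreshold μ X))) ∧
    (∀ᵐ ω ∂μ, Tendsto
      (fun k =>
        (∫ t in (0 : ℝ)..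
            AoI.sampleTime (X ω) (AoI.algorithmWait b lag (γ₀ ω) (X ω)) (k + 1),
          AoI.age (X ω) (AoI.algorithmWait b lag (γ₀ ω) (X ω)) t)
        / AoI.sampleTime (X ω) (AoI.algorithmWait b lag (γ₀ ω) (X ω)) (k + 1))
      atTop (𝓝 (AoI.optimalAge μ X).toReal)) := by
  have h : AoI.Model μ ε B α PF PB X := ⟨hε, hα0, hα1, hPF, hPB, hX⟩
  obtain ⟨γ, hγ0, hγ⟩ := h.exists_driftMean_eq_zero
  have hθ := h.tendsto_threshold_random hb (lag := lag) (by omega) hγ0 hγ hγ₀ hγ₀X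
  refine ⟨?_, ?_, ?_⟩
  · rw [h.optimalAge_eq hγ0 hγ]
    exact ENNReal.ofReal_ne_top
  · rwa [h.optimalThreshold_eq hγ0 hγ]
  · rw [h.toReal_optimalAge hγ0 hγ]
    exact h.tendsto_timeAverage_age hγ hθ (fun ω k => by simp [AoI.algorithmWait])
      fun ω k j hj => by simp [AoI.algorithmWait, hj]
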